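/- **Setting.** Let $\mathcal X\subset\mathbb R^d$ be nonempty, closed and convex with $\|x-y\|\le R$ for all $x,y\in\mathcal X$, where $R>0$. Let $P_0$ be a probability distribution on a measurable space $\mathbb S$. Let $\ell:\mathcal X\times\mathbb S\to[0,B]$ be measurable in $s$, and convex and $G$-Lipschitz in $x$, where $G>0$. Let $\nabla\ell(x;s)$ be a jointly measurable choice of subgradients of $\ell(\cdot;s)$ on $\mathcal X$ with $\|\nabla\ell(x;s)\|\le G$. The objective $\mathcal L(x;P)$ is one of $$\mathcal L_{\mathrm{CVaR}}(x;P)=\sup\Big\{\mathbb E_Q\,\ell(x;S):\ Q\ll P,\ \tfrac{dQ}{dP}\le\tfrac1\alpha\Big\}\quad(0<\alpha\le1),$$ $$\mathcal L_{\chi^2\text{-pen}}(x;P)=\sup_{Q\ll P}\Big\{\mathbb E_Q\,\ell(x;S)-\tfrac{\lambda}{2}\int\Big(\tfrac{dQ}{dP}-1\Big)^2dP\Big\}\quad(\lambda>0).$$ Put $\kappa=\alpha^{-1}$ for CVaR and $\kappa=1+B/\lambda$ for the $\chi^2$ penalty. For a sample $s_1,\dots,s_m$ let $\mathcal L(x;s_1^m)$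 be the objective for the uniform distribution on the $m$ points, written as a supremum over weight vectors $q$ in the simplex (with $q_i\le\frac1{\alpha m}$ for CVaR, and with penalty $\frac{\lambda}{2m}\sum_i(mq_i-1)^2$ otherwise). Let $q^\star$ be the maximizing weight vector that gives equal weights to samples with equal losses, and put $\nabla\mathcal L(x;s_1^m)=\sum_{i\le m}q_i^\star\nabla\ell(x;s_i)$. For integers $n_0,j_{\max}\ge1$ and $n=2^{j_{\max}}n_0$, the multilevel Monte Carlo (MLMC) estimator draws $J\in\{1,\dots,j_{\max}\}$ with $\mathbb P(J=j)=q(j)=2^{-j+\mathbf 1\{j=j_{\max}\}}$ and, independently of it, i.i.d. samples $S_1,\dots,S_{2^Jn_0}$ from $P_0$, and returns, with $k=2^Jn_0$, $$\tilde g(x)=\nabla\mathcal L(x;S_1^{n_0})+\frac1{q(J)}\Big(\nabla\mathcal L(x;S_1^{k})-\tfrac12\big(\nabla\mathcal L(x;S_1^{k/2})+\nabla\mathcal L(x;S_{k/2+1}^{k})\big)\Big).$$ Projected SGM starts at some $x_0\in\mathcal X$ and iterates $x_{t+1}=\Pi_{\mathcal X}(x_t-\eta\,\tilde g_t(x_t))$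 with independent draws of the estimator; $\bar x_T=\frac1T\sum_{t=1}^Tx_t$. Its complexity is the number of evaluations of $\nabla\ell$ in $T$ steps. Let $\Gamma^2=G^2\big(1+\frac{\log(n/n_0)}{\alpha n_0}\big)$ for CVaR and $\Gamma^2=G^2\big(1+\frac{B\log(n/n_0)}{\lambda n_0}\big)$ for the $\chi^2$ penalty. **Theorem (MLMC complexity guarantees).** Let $p\ge1$ be an integer and $\epsilon\in(0,B)$. Set $$n\asymp\frac{\kappa B^2}{\epsilon^2},\qquad 1\le n_0\lesssim\kappa\log n,\qquad T\asymp\frac{\kappa(GR)^2}{n_0\epsilon^2}\log^{p}n\ \text{ (rounded up to an integer } T\ge1),\qquad \eta\asymp\frac{R}{\Gamma\sqrt T}.$$ Then $$\mathbb E\,\mathcal L(\bar x_T;P_0)-\inf_{x\in\mathcal X}\mathcal L(x;P_0)\le\epsilon,$$ and with probability at least $1-\frac1n$ the complexity is at most $$n_0\log_2\Big(\frac{2n}{n_0}\Big)T+5\sqrt{(n\log n)^2+n_0\,n\,T\log n}\ \lesssim\ \frac{\kappa(GR+B)^2}{\epsilon^2}\,\log^{p+1}\Big(1+\frac{\kappa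 B^2}{\epsilon^2}\Big),$$ where the last inequality is deterministic. In particular, for $p=1$ the complexity is $\lesssim\frac{\kappa(GR+B)^2}{\epsilon^2}\log^2\big(1+\frac{\kappa B^2}{\epsilon^2}\big)$. Here $\lesssim$ and $\asymp$ hide constants that do not depend on the problem, and the constants in the parameter choices are as follows. There is a universal $c_n>0$, and for all $c_\eta,C_\eta,C_0>0$ there is $c_T>0$ depending only on these three numbers, such that for all $p$, $C_n$, $C_T$ there is a $C>0$ depending only on the constants named so far, for which the theorem holds, with $C$ as the constant of the last inequality, whenever $c_n\frac{\kappa B^2}{\epsilon^2}\le n\le C_n\frac{\kappa B^2}{\epsilon^2}$, $1\le n_0\le C_0\kappa\log n$, $1\le T$, $c_T\tau\le T\le C_T\tau+1$ with $\tau=\frac{\kappa(GR)^2}{n_0\epsilon^2}\log^pn$, and $c_\eta\frac{R}{\Gamma\sqrt T}\le\eta\le C_\eta\frac{R}{\Gamma\sqrt T}$. -/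

import Mathlib

open MeasureTheory ProbabilityTheory

namespace DRO

noncomputable section

/-- The two robust objectives: conditional value at risk at level `α`, and the `χ²` penalty with
multiplier `lam`. -/
inductive Objective where
  | cvar (α : ℝ) : Objective
  | chiSqPen (lam : ℝ) : Objective

namespace Objective

/-- Admissible parameters: `α ∈ (0, 1]`, respectively `lam > 0`. -/
def IsValid : Objective → Prop
  | cvar α => 0 < α ∧ α ≤ 1
  | chiSqPen lam => 0 < lam

/-- The robust risk of a random loss `Z` under the reference distribution `P`.

* CVaR: the supremum of `E_Q Z` over all probability measures `Q ≪ P` with `dQ/dP ≤ 1/α`.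
* `χ²` penalty: the supremum of `E_Q Z - lam * D(Q, P)` over all probability measures `Q ≪ P`
  whose divergence `D(Q, P) = ½ ∫ (dQ/dP - 1)² dP` is finite (the others have value `-∞`). -/
def risk {S : Type*} [MeasurableSpace S] : Objective → Measure S → (S → ℝ) → ℝ
  | cvar α, P, Z => sSup {r : ℝ | ∃ Q : Measure S, IsProbabilityMeasure Q ∧ Q ≪ P ∧
      (∀ᵐ s ∂P, Q.rnDeriv P s ≤ ENNReal.ofReal (1 / α)) ∧ r = ∫ s, Z s ∂Q}
  | chiSqPen lam, P, Z => sSup {r : ℝ | ∃ Q : Measure S, IsProbabilityMeasure Q ∧ Q ≪ P ∧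
      Integrable (fun s => ((Q.rnDeriv P s).toReal - 1) ^ 2) P ∧
      r = ∫ s, Z s ∂Q - lam * (1 / 2 * ∫ s, ((Q.rnDeriv P s).toReal - 1) ^ 2 ∂P)}

/-- The feasible weight vectors `q` on a sample indexed by `ι`: the simplex, for CVaR with
`q i ≤ 1 / (α m)`, where `m` is the sample size. -/
def feasible (ι : Type*) [Fintype ι] : Objective → Set (ι → ℝ)
  | cvar α => {q | q ∈ stdSimplex ℝ ι ∧ ∀ i, q i ≤ 1 / (α * Fintype.card ι)}
  | chiSqPen _ => stdSimplex ℝ ι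

/-- The value of the weight vector `q` on a sample with losses `v`. -/
def value {ι : Type*} [Fintype ι] : Objective → (ι → ℝ) → (ι → ℝ) → ℝ
  | cvar _, v, q => ∑ i, q i * v i
  | chiSqPen lam, v, q => ∑ i, q i * v i -
      lam * (1 / Fintype.card ι * ∑ i, 1 / 2 * (Fintype.card ι * q i - 1) ^ 2)

/-- `q` attains the supremum that defines the robust loss of a sample with losses `v`, and gives
equal weights to samples with equal losses. These two conditions determine `q`; the second one is
automatic for the `χ²` penalty, and only breaks ties for CVaR. -/
def IsOptimalWeight (obj : Objective) {ι : Type*} [Fintype ι] (v q : ι → ℝ) : Prop :=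
  q ∈ obj.feasible ι ∧ (∀ q' ∈ obj.feasible ι, obj.value v q' ≤ obj.value v q) ∧
    ∀ i j, v i = v j → q i = q j

/-- The optimal weight vector `q⋆` of a sample with losses `v`. -/
def optimalWeight (obj : Objective) {ι : Type*} [Fintype ι] (v : ι → ℝ) : ι → ℝ :=
  Classical.epsilon (obj.IsOptimalWeight v)

/-- The factor `α⁻¹` for CVaR, and `1 + B / lam` for the `χ²` penalty. -/
def kappa (B : ℝ) : Objective → ℝ
  | cvar α => α⁻¹
  | chiSqPen lam => 1 + B / lam

/-- The bound (up to a numerical factor) on the second moment of the multilevel gradient estimator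
that sets the scale of the step size: `G² (1 + log (n / n₀) / (α n₀))` for CVaR, and
`G² (1 + B log (n / n₀) / (lam n₀))` for the `χ²` penalty. -/
def secondMomentScale (G B n n₀ : ℝ) : Objective → ℝ
  | cvar α => G ^ 2 * (1 + Real.log (n / n₀) / (α * n₀))
  | chiSqPen lam => G ^ 2 * (1 + B * Real.log (n / n₀) / (lam * n₀))

end Objective

section Estimator

variable {S E : Type*} [AddCommGroup E] [Module ℝ E]

/-- The mini-batch gradient `∑ q⋆ i • ∇ℓ(x; s i)` of the robust loss at `x` on the sub-sample of
`s 0, s 1, …` with indices in `I`; `l x s` is the loss and `g x s` its subgradient. -/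
def batchGrad (obj : Objective) (l : E → S → ℝ) (g : E → S → E) (s : ℕ → S) (I : Finset ℕ)
    (x : E) : E :=
  ∑ i : I, obj.optimalWeight (fun i : I => l x (s i)) i • g x (s i)

/-- The probability that `min {Geo(1/2), jmax}` equals `j ∈ {1, …, jmax}`. -/
def levelProb (jmax j : ℕ) : ℝ := (2 : ℝ) ^ (-(j : ℤ) + if j = jmax then 1 else 0)

/-- The distribution of the level `J`, a truncated geometric distribution on `{1, …, jmax}`. -/
def levelLaw (jmax : ℕ) : Measure ℕ :=
  ∑ j ∈ Finset.Icc 1 jmax, ENNReal.ofReal (levelProb jmax j) • Measure.dirac j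

/-- The distribution of the randomness in one step: a level `J`, and independently of it an
i.i.d. sequence of samples from `P₀` (of which the estimator uses the first `2 ^ J * n₀`). -/
def drawLaw [MeasurableSpace S] (jmax : ℕ) (P₀ : Measure S) [IsProbabilityMeasure P₀] :
    Measure (ℕ × (ℕ → S)) :=
  (levelLaw jmax).prod (Measure.infinitePi fun _ : ℕ => P₀)

/-- The bias increment `∇L(S_1^k) - ½ (∇L(S_1^{k/2}) + ∇L(S_{k/2+1}^k))`, for even `k`. -/
def biasIncrement (obj : Objective) (l : E → S → ℝ) (g : E → S → E) (s : ℕ → S) (k : ℕ)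
    (x : E) : E :=
  batchGrad obj l g s (Finset.range k) x - (1 / 2 : ℝ) •
    (batchGrad obj l g s (Finset.range (k / 2)) x + batchGrad obj l g s (Finset.Ico (k / 2) k) x)

/-- The multilevel Monte Carlo gradient estimator at `x`, for the draw `w = (J, S)`. -/
def mlmcGrad (obj : Objective) (l : E → S → ℝ) (g : E → S → E) (jmax n₀ : ℕ)
    (w : ℕ × (ℕ → S)) (x : E) : E :=
  batchGrad obj l g w.2 (Finset.range n₀) x +
    (levelProb jmax w.1)⁻¹ • biasIncrement obj l g w.2 (2 ^ w.1 * n₀) x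

/-- The indices of the samples at which `mlmcGrad` evaluates `∇ℓ(x; ·)`: the union of the
mini-batches that it uses. -/
def mlmcQueries (n₀ j : ℕ) : Finset ℕ :=
  Finset.range n₀ ∪ (Finset.range (2 ^ j * n₀) ∪
    (Finset.range (2 ^ j * n₀ / 2) ∪ Finset.Ico (2 ^ j * n₀ / 2) (2 ^ j * n₀)))

/-- The number of evaluations of `∇ℓ` in the first `T` steps of the method. -/
def evalCount (n₀ T : ℕ) (w : ℕ → ℕ × (ℕ → S)) : ℕ :=
  ∑ t ∈ Finset.range T, (mlmcQueries n₀ (w t).1).card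

end Estimator

section SGM

variable {D E : Type*} [NormedAddCommGroup E] [NormedSpace ℝ E]

/-- The nearest point of `X` to `y` (the Euclidean projection if `X` is closed and convex). -/
def proj (X : Set E) (y : E) : E :=
  Classical.epsilon fun z => z ∈ X ∧ ∀ z' ∈ X, ‖y - z‖ ≤ ‖y - z'‖

/-- The projected stochastic gradient method with step size `η`, started at `x₀`, with gradient
estimator `est` fed by the draws `w 0, w 1, …`. -/
def sgm (X : Set E) (η : ℝ) (est : D → E → E) (x₀ : E) (w : ℕ → D) : ℕ → E
  | 0 => x₀
  | t + 1 => proj X (sgm X η est x₀ w t - η • est (w t) (sgm X η est x₀ w t))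

/-- The average `(1 / T) ∑_{1 ≤ t ≤ T} x_t` of the iterates. -/
def sgmAverage (X : Set E) (η : ℝ) (est : D → E → E) (x₀ : E) (w : ℕ → D) (T : ℕ) : E :=
  (1 / (T : ℝ)) • ∑ t ∈ Finset.Icc 1 T, sgm X η est x₀ w t

end SGM

/-- The bound `n₀ log₂(2 n / n₀) T + 5 √((n log n)² + n₀ n T log n)` on the number of
evaluations. -/
def evalBound (n n₀ T : ℝ) : ℝ :=
  n₀ * Real.logb 2 (2 * n / n₀) * T +
    5 * √((n * Real.log n) ^ 2 + n₀ * n * T * Real.log n)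

end

end DRO

/-! The suboptimality splits into a statistical bias and an optimization error, each at most `ε /
2`. The method really minimizes the surrogate, the expected robust loss of a sample of size `n`: the
increments over the levels telescope in expectation, so the multilevel estimator has the mean of the
gradient on `n` samples (`integral_inner_mlmcGrad`), while the mean size of its largest batch is
only `n₀ (log₂ (n / n₀) + 1)`.

Bias. The surrogate is at most the risk, because drawing a sample and then one of its points with
the optimal weights produces an admissible `Q` (`integral_batchLoss_le_risk`). Conversely, the
density `ρ` of a competitor gives sample weights `ρ (S i) / n`; their total mass differs from one by
`O(√(κ / n))` on average, and correcting it costs at most `B` per unit of mass. Hence the risk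
exceeds the surrogate by at most `B √(2 κ / n)` (`risk_le_integral_batchLoss`).

Variance, the heart of the matter. Both objectives maximize a linear gain minus a quadratic penalty
over a capped simplex, the penalty being zero for CVaR. Optimal weights on a batch and, after
rescaling, on one of its halves are comparable: one dominates the other on the whole half
(`IsTieFreeMax.not_crossing`). Their `ℓ¹` distance is therefore a difference of masses, and the bias
increment is at most `G` times the imbalance of the weights between the two halves. Exchanging the
samples `i` and `m + i` reverses the sign of the `i`-th paired difference and fixes the others, so
the cross terms in the squared imbalance have mean zero and only a sum of squares of order `1 / m`
remains (`integral_sq_imbalance_le`). The importance factor `1 / q(J) ≤ 2 ^ J` cancels this decay,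
every level contributes the same amount, and the second moment is of the order of
`secondMomentScale`.

With these facts, the usual analysis of projected stochastic gradients bounds the optimization
error. The cost is `n₀` times a sum of independent copies of `2 ^ J`, with `E 2 ^ J = jmax + 1` and
`E 4 ^ J ≤ 3 * 2 ^ jmax`, and a Chernoff bound controls it. -/

namespace DRO

/-! ### Maximizing a penalized linear gain over a capped simplex. -/

section Allocation

variable {ι : Type*} [Fintype ι]

/-- The weight vectors in the simplex with entries at most `u`. -/
def cappedSimplex (ι : Type*) [Fintype ι] (u : ℝ) : Set (ι → ℝ) :=
  {q | (∀ i, 0 ≤ q i) ∧ ∑ i, q i = 1 ∧ ∀ i, q i ≤ u}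

/-- The linear gain `∑ q i * v i` minus a quadratic penalty of curvature `a` centred at `c`. -/
noncomputable def penalizedGain (a c : ℝ) (v q : ι → ℝ) : ℝ :=
  ∑ i, q i * v i - a / 2 * ∑ i, (q i - c) ^ 2

theorem convex_cappedSimplex (u : ℝ) : Convex ℝ (cappedSimplex ι u) := by
  rintro q ⟨h0, h1, h2⟩ q' ⟨h0', h1', h2'⟩ s t hs ht hst
  refine ⟨fun i => ?_, ?_, fun i => ?_⟩
  · simp only [Pi.add_apply, Pi.smul_apply, smul_eq_mul]
    have := h0 i; have := h0' i; positivity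
  · simp [Finset.sum_add_distrib, ← Finset.mul_sum, h1, h1', hst]
  · simp only [Pi.add_apply, Pi.smul_apply, smul_eq_mul]
    have h : s * q i + t * q' i ≤ s * u + t * u := by
      gcongr
      · exact h2 i
      · exact h2' i
    rwa [← add_mul, hst, one_mul] at h

theorem isCompact_cappedSimplex (u : ℝ) : IsCompact (cappedSimplex ι u) := by
  refine (isCompact_stdSimplex ℝ ι).of_isClosed_subset ?_ fun q hq => ⟨hq.1, hq.2.1⟩
  have : cappedSimplex ι u =
      (⋂ i, {q | 0 ≤ q i}) ∩ ({q | ∑ i, q i = 1} ∩ ⋂ i, {q | q i ≤ u}) := by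
    ext q; simp [cappedSimplex]
  rw [this]
  refine (isClosed_iInter fun i => isClosed_le continuous_const (continuous_apply i)).inter
    ((isClosed_eq (by fun_prop) continuous_const).inter
      (isClosed_iInter fun i => isClosed_le (continuous_apply i) continuous_const))

theorem continuous_penalizedGain (a c : ℝ) (v : ι → ℝ) : Continuous (penalizedGain a c v) := by
  unfold penalizedGain; fun_prop

theorem penalizedGain_add_smul (a c t : ℝ) (v q d : ι → ℝ) :
    penalizedGain a c v (q + t • d) = penalizedGain a c v q +
      t * ∑ i, (v i - a * (q i - c)) * d i - t ^ 2 * (a / 2 * ∑ i, d i ^ 2) := by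
  simp only [penalizedGain, Pi.add_apply, Pi.smul_apply, smul_eq_mul, Finset.mul_sum,
    ← Finset.sum_sub_distrib, ← Finset.sum_add_distrib]
  exact Finset.sum_congr rfl fun i _ => by ring

/-- First-order optimality along the segment from `q` to `q'`, on which the gain is an explicit
quadratic polynomial. -/
theorem variational_inequality {a c u : ℝ} (ha : 0 ≤ a) {v q : ι → ℝ}
    (hq : q ∈ cappedSimplex ι u)
    (hmax : ∀ q' ∈ cappedSimplex ι u, penalizedGain a c v q' ≤ penalizedGain a c v q)
    {q' : ι → ℝ} (hq' : q' ∈ cappedSimplex ι u) :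
    ∑ i, (v i - a * (q i - c)) * (q' i - q i) ≤ 0 := by
  set X := ∑ i, (v i - a * (q i - c)) * (q' i - q i) with hX
  set K := a / 2 * ∑ i, (q' i - q i) ^ 2 with hK
  have hK0 : 0 ≤ K := by positivity
  by_contra! hpos
  -- The gain at `q + t (q' - q)` exceeds the one at `q` by `t X - t² K`. The step `t = X / (X + K)`
  -- lies in `(0, 1]` and makes this `t X² / (X + K) > 0`, also when `K = 0`.
  have ht0 : 0 < X / (X + K) := by positivity
  have ht1 : X / (X + K) ≤ 1 := by
    rw [div_le_one (by positivity)]; linarith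
  have hmem : q + (X / (X + K)) • (q' - q) ∈ cappedSimplex ι u :=
    (convex_cappedSimplex u).add_smul_sub_mem hq hq' ⟨ht0.le, ht1⟩
  have h := hmax _ hmem
  rw [penalizedGain_add_smul] at h
  simp only [Pi.sub_apply] at h
  rw [← hX, ← hK] at h
  have h2 : X / (X + K) * (X - X / (X + K) * K) ≤ 0 := by nlinarith
  have h3 : X - X / (X + K) * K = X ^ 2 / (X + K) := by field_simp; ring
  rw [h3] at h2
  have : 0 < X / (X + K) * (X ^ 2 / (X + K)) := by positivity
  linarith

theorem shift_mem_cappedSimplex [DecidableEq ι] {u δ : ℝ} {q : ι → ℝ}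
    (hq : q ∈ cappedSimplex ι u) {i j : ι} (hij : i ≠ j) (hδ : 0 ≤ δ) (hi : δ ≤ q i)
    (hj : q j + δ ≤ u) :
    q + δ • (Pi.single j 1 - Pi.single i 1) ∈ cappedSimplex ι u := by
  have key : ∀ k, (q + δ • (Pi.single j 1 - Pi.single i 1 : ι → ℝ)) k =
      if k = j then q j + δ else if k = i then q i - δ else q k := by
    intro k
    by_cases h1 : k = j
    · subst h1; simp [hij.symm]
    · by_cases h2 : k = i
      · subst h2; simp [h1]; ring
      · simp [h1, h2]
  refine ⟨fun k => ?_, ?_, fun k => ?_⟩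
  · rw [key]; split_ifs
    · have := hq.1 j; linarith
    · linarith
    · exact hq.1 k
  · simp [Finset.sum_add_distrib, ← Finset.mul_sum, hq.2.1]
  · rw [key]; split_ifs
    · exact hj
    · have := hq.2.2 i; linarith
    · exact hq.2.2 k

/-- The optimality conditions in exchange form, without multipliers: a little mass could be moved
from `i` to `j`, and this must not pay. -/
theorem slope_le_of_exchange {a c u : ℝ} (ha : 0 ≤ a) {v q : ι → ℝ}
    (hq : q ∈ cappedSimplex ι u)
    (hmax : ∀ q' ∈ cappedSimplex ι u, penalizedGain a c v q' ≤ penalizedGain a c v q)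
    {i j : ι} (hi : 0 < q i) (hj : q j < u) :
    v j - a * (q j - c) ≤ v i - a * (q i - c) := by
  classical
  by_cases hij : i = j
  · subst hij; exact le_rfl
  set δ := min (q i) (u - q j)
  have hδ : 0 < δ := lt_min hi (by linarith)
  have h := variational_inequality ha hq hmax (shift_mem_cappedSimplex hq hij hδ.le
    (min_le_left _ _) (by have := min_le_right (q i) (u - q j); linarith))
  have h2 : ∑ k, (v k - a * (q k - c)) *
      ((q + δ • (Pi.single j 1 - Pi.single i 1 : ι → ℝ)) k - q k) =
      δ * ((v j - a * (q j - c)) - (v i - a * (q i - c))) := by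
    simp only [Pi.add_apply, Pi.smul_apply, Pi.sub_apply, smul_eq_mul, add_sub_cancel_left,
      mul_sub, Finset.sum_sub_distrib]
    simp [Pi.single_apply]
    ring
  rw [h2] at h
  by_contra! hlt
  have := mul_pos hδ (sub_pos.2 hlt)
  linarith

/-- A maximizer of the penalized gain over the capped simplex that treats ties equally. -/
def IsTieFreeMax (a c u : ℝ) (v q : ι → ℝ) : Prop :=
  q ∈ cappedSimplex ι u ∧
    (∀ q' ∈ cappedSimplex ι u, penalizedGain a c v q' ≤ penalizedGain a c v q) ∧
    ∀ i j, v i = v j → q i = q j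

/-- Among the maximizers, one of least sum of squares treats ties equally: replacing two unequal
weights with equal gains by their mean would keep it a maximizer and decrease the sum of squares. -/
theorem exists_isTieFreeMax {a c u : ℝ} (ha : 0 ≤ a) (hne : (cappedSimplex ι u).Nonempty)
    (v : ι → ℝ) : ∃ q, IsTieFreeMax a c u v q := by
  classical
  obtain ⟨q₀, hq₀, hmax₀⟩ := (isCompact_cappedSimplex u).exists_isMaxOn hne
    (continuous_penalizedGain a c v).continuousOn
  have hcpt : IsCompact (cappedSimplex ι u ∩ {q | penalizedGain a c v q₀ ≤ penalizedGain a c v q}) :=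
    (isCompact_cappedSimplex u).inter_right
      (isClosed_le continuous_const (continuous_penalizedGain a c v))
  have hsq : Continuous fun q : ι → ℝ => ∑ i, q i ^ 2 := by fun_prop
  obtain ⟨q, ⟨hq, hq1⟩, hmin⟩ := hcpt.exists_isMinOn ⟨q₀, hq₀, le_refl (penalizedGain a c v q₀)⟩ hsq.continuousOn
  have hmax : ∀ q' ∈ cappedSimplex ι u, penalizedGain a c v q' ≤ penalizedGain a c v q :=
    fun q' hq' => (hmax₀ hq').trans hq1
  have key : ∀ i j, v i = v j → q i ≤ q j := by
    intro i j hv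
    by_contra! hlt
    have hij : i ≠ j := by rintro rfl; exact lt_irrefl _ hlt
    set δ := (q i - q j) / 2 with hδ
    have hδ0 : 0 < δ := by rw [hδ]; linarith
    have h0 := hq.1 j
    have hmem : q + δ • (Pi.single j 1 - Pi.single i 1) ∈ cappedSimplex ι u :=
      shift_mem_cappedSimplex hq hij hδ0.le (by rw [hδ]; linarith)
        (by have := hq.2.2 i; rw [hδ]; linarith)
    have hsum : ∀ f : ι → ℝ, ∑ k, f k * (Pi.single j 1 - Pi.single i 1 : ι → ℝ) k = f j - f i := by
      intro f
      simp [Pi.single_apply, mul_sub, Finset.sum_sub_distrib]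
    have hd2 : ∑ k, (Pi.single j 1 - Pi.single i 1 : ι → ℝ) k ^ 2 = 2 := by
      simp only [sq, hsum]
      simp [hij, hij.symm]; norm_num
    have hval : penalizedGain a c v q ≤
        penalizedGain a c v (q + δ • (Pi.single j 1 - Pi.single i 1)) := by
      rw [penalizedGain_add_smul, hsum, hd2, hv]
      have : δ * (v j - a * (q j - c) - (v j - a * (q i - c))) = a * (2 * δ ^ 2) := by
        rw [hδ]; ring
      rw [this]
      nlinarith [mul_nonneg ha (sq_nonneg δ)]
    have h := hmin ⟨hmem, hq1.trans hval⟩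
    simp only [Set.mem_ofPred_eq] at h
    have h3 : ∑ k, (q + δ • (Pi.single j 1 - Pi.single i 1 : ι → ℝ)) k ^ 2 =
        ∑ k, q k ^ 2 + 2 * δ * ∑ k, q k * (Pi.single j 1 - Pi.single i 1 : ι → ℝ) k +
          δ ^ 2 * ∑ k, (Pi.single j 1 - Pi.single i 1 : ι → ℝ) k ^ 2 := by
      rw [Finset.mul_sum, Finset.mul_sum, ← Finset.sum_add_distrib, ← Finset.sum_add_distrib]
      refine Finset.sum_congr rfl fun k _ => ?_
      simp only [Pi.add_apply, Pi.smul_apply, smul_eq_mul]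
      ring
    rw [hsum, hd2] at h3
    rw [h3] at h
    have : q j - q i = -(2 * δ) := by rw [hδ]; ring
    rw [this] at h
    nlinarith
  exact ⟨q, hq, hmax, fun i j hv => le_antisymm (key i j hv) (key j i hv.symm)⟩

/-- Optimal allocations of different total mass are comparable: if `q` is optimal on a sample and
`p` on a sub-sample, for the same curvature after rescaling, then no two indices are ordered in
opposite ways. -/
theorem IsTieFreeMax.not_crossing {κ : Type*} [Fintype κ] {a b c c' u u' r : ℝ} (ha : 0 ≤ a)
    (hr : 0 < r) (hb : b = r * a) (hc : c = r * c') (hu : u = r * u') {v q : ι → ℝ} {p : κ → ℝ}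
    (e : κ → ι) (hq : IsTieFreeMax a c u v q) (hp : IsTieFreeMax b c' u' (v ∘ e) p) {i j : κ}
    (hi : r * p i < q (e i)) (hj : q (e j) < r * p j) : False := by
  have hi0 : 0 < q (e i) := (mul_nonneg hr.le (hp.1.1 i)).trans_lt hi
  have hj0 : 0 < p j := by
    have := (hq.1.1 (e j)).trans_lt hj
    exact (mul_pos_iff_of_pos_left hr).1 this
  have hju : q (e j) < u := hj.trans_le (by rw [hu]; gcongr; exact hp.1.2.2 j)
  have hiu : p i < u' := by
    have : r * p i < r * u' := hu ▸ hi.trans_le (hq.1.2.2 _)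
    exact lt_of_mul_lt_mul_left this hr.le
  have h1 := slope_le_of_exchange ha hq.1 hq.2.1 hi0 hju
  have h2 := slope_le_of_exchange (by rw [hb]; positivity) hp.1 hp.2.1 hj0 hiu
  have e1 : b * (p i - c') = a * (r * p i - c) := by rw [hb, hc]; ring
  have e2 : b * (p j - c') = a * (r * p j - c) := by rw [hb, hc]; ring
  simp only [Function.comp_apply] at h2
  rw [e1, e2] at h2
  have hgap : a * (q (e i) - r * p i) + a * (r * p j - q (e j)) ≤ 0 := by linarith
  -- For `a > 0` both terms of `hgap` are positive. For `a = 0` the two exchange inequalities force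
  -- a tie between the gains, and the tie rule, applied to `q` and to `p`, contradicts the strict
  -- crossing.
  rcases ha.eq_or_lt with rfl | ha
  · have hv : v (e i) = v (e j) := by simp at h1 h2; exact le_antisymm h2 h1
    have := hq.2.2 _ _ hv
    have := hp.2.2 i j hv
    simp_all
    linarith
  · have := mul_pos ha (sub_pos.2 hi)
    have := mul_pos ha (sub_pos.2 hj)
    linarith

/-- As crossings are excluded, all differences have the same sign, so the sum of absolute values is
the absolute value of the sum; `p` has mass one. -/
theorem IsTieFreeMax.sum_abs_sub {κ : Type*} [Fintype κ] {a b c c' u u' r : ℝ} (ha : 0 ≤ a)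
    (hr : 0 < r) (hb : b = r * a) (hc : c = r * c') (hu : u = r * u') {v q : ι → ℝ} {p : κ → ℝ}
    (e : κ → ι) (hq : IsTieFreeMax a c u v q) (hp : IsTieFreeMax b c' u' (v ∘ e) p) :
    ∑ i, |q (e i) - r * p i| = |∑ i, q (e i) - r| := by
  have hs : ∑ i, q (e i) - r = ∑ i, (q (e i) - r * p i) := by
    rw [Finset.sum_sub_distrib, ← Finset.mul_sum, hp.1.2.1, mul_one]
  rw [hs]
  by_cases h : ∃ i, r * p i < q (e i)
  · obtain ⟨i, hi⟩ := h
    have hall : ∀ j, 0 ≤ q (e j) - r * p j := fun j => by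
      by_contra! hj
      exact hq.not_crossing ha hr hb hc hu e hp hi (by linarith)
    rw [abs_of_nonneg (Finset.sum_nonneg fun j _ => hall j)]
    exact Finset.sum_congr rfl fun j _ => abs_of_nonneg (hall j)
  · push Not at h
    have hall : ∀ j, q (e j) - r * p j ≤ 0 := fun j => by linarith [h j]
    rw [abs_of_nonpos (Finset.sum_nonpos fun j _ => hall j), ← Finset.sum_neg_distrib]
    exact Finset.sum_congr rfl fun j _ => abs_of_nonpos (hall j)

/-- The comparison with `r = 1` and the identity embedding: equal masses force distance zero. This
includes zero curvature, where strict concavity fails. -/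
theorem IsTieFreeMax.unique {a c u : ℝ} (ha : 0 ≤ a) {v q p : ι → ℝ}
    (hq : IsTieFreeMax a c u v q) (hp : IsTieFreeMax a c u v p) : q = p := by
  have h := hq.sum_abs_sub ha one_pos (one_mul a).symm (one_mul c).symm (one_mul u).symm id hp
  simp only [id, hq.1.2.1, one_mul, sub_self, abs_zero] at h
  rw [Finset.sum_eq_zero_iff_of_nonneg fun i _ => abs_nonneg _] at h
  funext i
  have := abs_eq_zero.1 (h i (Finset.mem_univ i))
  linarith

theorem IsTieFreeMax.comp_equiv {κ : Type*} [Fintype κ] {a c u : ℝ} {v q : ι → ℝ} (e : κ ≃ ι)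
    (hq : IsTieFreeMax a c u v q) : IsTieFreeMax a c u (v ∘ e) (q ∘ e) := by
  have hgain : ∀ q : ι → ℝ, penalizedGain a c (v ∘ e) (q ∘ e) = penalizedGain a c v q := by
    intro q
    simp only [penalizedGain, Function.comp_apply]
    rw [e.sum_comp fun i => q i * v i, e.sum_comp fun i => (q i - c) ^ 2]
  refine ⟨⟨fun i => hq.1.1 _, ?_, fun i => hq.1.2.2 _⟩, fun q' hq' => ?_, fun i j h => hq.2.2 _ _ h⟩
  · simp only [Function.comp_apply]
    rw [e.sum_comp q, hq.1.2.1]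
  · have h : q' = (q' ∘ e.symm) ∘ e := by ext; simp
    rw [h, hgain, hgain]
    refine hq.2.1 _ ⟨fun i => hq'.1 _, ?_, fun i => hq'.2.2 _⟩
    simp only [Function.comp_apply]
    rw [e.symm.sum_comp q', hq'.2.1]

/-- Without penalty, optimality depends only on the order of the gains. -/
theorem IsTieFreeMax.of_same_order {c u : ℝ} {v w q : ι → ℝ}
    (h : ∀ i j, v i < v j ↔ w i < w j) (hq : IsTieFreeMax 0 c u v q) :
    IsTieFreeMax 0 c u w q := by
  have hgain : ∀ v q : ι → ℝ, penalizedGain 0 c v q = ∑ i, q i * v i := fun v q => by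
    simp [penalizedGain]
  refine ⟨hq.1, fun q' hq' => ?_, fun i j hw => hq.2.2 i j ?_⟩
  · rw [hgain, hgain]
    have hexch : ∀ i j, 0 < q i → q j < u → w j ≤ w i := fun i j hi hj => by
      have := slope_le_of_exchange le_rfl hq.1 hq.2.1 hi hj
      simp only [zero_mul, sub_zero] at this
      exact not_lt.1 fun hlt => absurd ((h i j).2 hlt) (not_lt.2 this)
    have hne : (Finset.univ.filter fun i => 0 < q i).Nonempty := by
      by_contra hne
      rw [Finset.not_nonempty_iff_eq_empty, Finset.filter_eq_empty_iff] at hne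
      have : ∑ i, q i ≤ 0 := Finset.sum_nonpos fun i _ => not_lt.1 (hne (Finset.mem_univ i))
      linarith [hq.1.2.1]
    -- The least gain that carries mass is a threshold: strictly below it the weights vanish,
    -- strictly above it they are at the cap. Hence no competitor improves any term measured
    -- relative to `w k`.
    obtain ⟨k, hk, hkmin⟩ := Finset.exists_min_image _ w hne
    rw [Finset.mem_filter] at hk
    have hterm : ∀ i, (q' i - q i) * (w i - w k) ≤ 0 := fun i => by
      rcases lt_trichotomy (w i) (w k) with hlt | heq | hgt
      · have h0 : q i = 0 := by
          refine le_antisymm (not_lt.1 fun hpos => ?_) (hq.1.1 i)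
          have := hkmin i (by simp [hpos])
          linarith
        rw [h0]
        nlinarith [hq'.1 i]
      · simp [heq]
      · have h0 : u ≤ q i := not_lt.1 fun hlt => by
          have := hexch k i hk.2 hlt
          linarith
        nlinarith [hq'.2.2 i]
    have hsum := Finset.sum_nonpos fun i (_ : i ∈ Finset.univ) => hterm i
    have hexp : ∑ i, (q' i - q i) * (w i - w k) =
        (∑ i, q' i * w i - ∑ i, q i * w i) - (∑ i, q' i - ∑ i, q i) * w k := by
      rw [← Finset.sum_sub_distrib, ← Finset.sum_sub_distrib, Finset.sum_mul,
        ← Finset.sum_sub_distrib]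
      exact Finset.sum_congr rfl fun i _ => by ring
    rw [hexp, hq'.2.1, hq.1.2.1] at hsum
    linarith
  · have h1 := h i j
    have h2 := h j i
    rw [hw] at h1
    rw [hw] at h2
    simp only [lt_self_iff_false, iff_false, not_lt] at h1 h2
    exact le_antisymm h2 h1

/-- With a positive penalty, the optimal allocation is a Lipschitz function of the gains. -/
theorem IsTieFreeMax.mul_sum_sq_sub_le {a c u : ℝ} (ha : 0 < a) {v w q p : ι → ℝ}
    (hq : IsTieFreeMax a c u v q) (hp : IsTieFreeMax a c u w p) :
    a ^ 2 * ∑ i, (p i - q i) ^ 2 ≤ ∑ i, (w i - v i) ^ 2 := by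
  have h1 := variational_inequality ha.le hq.1 hq.2.1 hp.1
  have h2 := variational_inequality ha.le hp.1 hp.2.1 hq.1
  -- The two variational inequalities, each tested with the other maximizer, have a nonpositive sum;
  -- completing the square turns this into the Lipschitz bound.
  have h3 : ∑ i, (w i - v i) ^ 2 - a ^ 2 * ∑ i, (p i - q i) ^ 2 =
      ∑ i, (w i - v i - a * (p i - q i)) ^ 2 -
      2 * a * (∑ i, (v i - a * (q i - c)) * (p i - q i) +
        ∑ i, (w i - a * (p i - c)) * (q i - p i)) := by
    simp only [Finset.mul_sum, ← Finset.sum_sub_distrib, ← Finset.sum_add_distrib]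
    exact Finset.sum_congr rfl fun i _ => by ring
  have h4 : 0 ≤ ∑ i, (w i - v i - a * (p i - q i)) ^ 2 := by positivity
  nlinarith

end Allocation

/-! ### CVaR and the `χ²` penalty as instances of the allocation problem. -/

namespace Objective

/-- The curvature of the penalty on samples of size `m`. -/
def curvature : Objective → ℝ → ℝ
  | cvar _, _ => 0
  | chiSqPen lam, m => lam * m

/-- The bound on the likelihood ratio; the inessential value `N` for the `χ²` penalty. -/
noncomputable def ratioCap (N : ℝ) : Objective → ℝ
  | cvar α => 1 / α
  | chiSqPen _ => N

/-- A bound on the divergence of optimal weights from the uniform ones. -/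
noncomputable def spread (B : ℝ) : Objective → ℝ
  | cvar α => α⁻¹
  | chiSqPen lam => B / lam

variable {obj : Objective}

theorem curvature_nonneg (h : obj.IsValid) {m : ℝ} (hm : 0 ≤ m) : 0 ≤ obj.curvature m := by
  cases obj with
  | cvar α => exact le_rfl
  | chiSqPen lam => exact mul_nonneg (le_of_lt h) hm

theorem curvature_mul (r m : ℝ) : obj.curvature (r * m) = r * obj.curvature m := by
  cases obj <;> simp [curvature]; ring

theorem spread_nonneg (h : obj.IsValid) {B : ℝ} (hB : 0 ≤ B) : 0 ≤ obj.spread B := by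
  cases obj with
  | cvar α => exact inv_nonneg.2 h.1.le
  | chiSqPen lam => exact div_nonneg hB (le_of_lt h)

theorem spread_le_kappa (h : obj.IsValid) {B : ℝ} : obj.spread B ≤ obj.kappa B := by
  cases obj with
  | cvar α => exact le_rfl
  | chiSqPen lam => simp [spread, kappa]

theorem one_le_kappa (h : obj.IsValid) {B : ℝ} (hB : 0 ≤ B) : 1 ≤ obj.kappa B := by
  cases obj with
  | cvar α => exact (one_le_inv₀ h.1).2 h.2
  | chiSqPen lam => exact le_add_of_nonneg_right (div_nonneg hB (le_of_lt h))

theorem secondMomentScale_eq (G B n n₀ : ℝ) :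
    obj.secondMomentScale G B n n₀ = G ^ 2 * (1 + obj.spread B * Real.log (n / n₀) / n₀) := by
  cases obj with
  | cvar α => simp only [secondMomentScale, spread]; ring
  | chiSqPen lam => simp only [secondMomentScale, spread]; ring

section Weights

variable {ι : Type*} [Fintype ι]

theorem value_eq [Nonempty ι] (v q : ι → ℝ) : obj.value v q =
    penalizedGain (obj.curvature (Fintype.card ι)) (1 / Fintype.card ι) v q := by
  have hm : (Fintype.card ι : ℝ) ≠ 0 := Nat.cast_ne_zero.2 Fintype.card_ne_zero
  cases obj with
  | cvar α => simp [value, penalizedGain, curvature]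
  | chiSqPen lam =>
    simp only [value, penalizedGain, curvature, Finset.mul_sum]
    congr 1
    refine Finset.sum_congr rfl fun i _ => ?_
    field_simp

/-- The comparison of a batch with its half needs caps that scale with the sample size. The `χ²`
penalty gets the inactive cap `N / m`, and `N ≥ m` is left free so that both batches can use the
same `N`. -/
theorem feasible_eq [Nonempty ι] {N : ℝ} (hN : Fintype.card ι ≤ N) :
    obj.feasible ι = cappedSimplex ι (obj.ratioCap N / Fintype.card ι) := by
  have hm : (0 : ℝ) < Fintype.card ι := Nat.cast_pos.2 Fintype.card_pos
  cases obj with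
  | cvar α =>
    ext q
    simp only [feasible, cappedSimplex, ratioCap, stdSimplex, Set.mem_ofPred_eq, and_assoc,
      div_div]
  | chiSqPen lam =>
    ext q
    simp only [feasible, cappedSimplex, ratioCap, stdSimplex, Set.mem_ofPred_eq]
    refine ⟨fun h => ⟨h.1, h.2, fun i => ?_⟩, fun h => ⟨h.1, h.2.1⟩⟩
    have h1 : q i ≤ ∑ j, q j := Finset.single_le_sum (fun j _ => h.1 j) (Finset.mem_univ i)
    rw [h.2] at h1
    exact h1.trans ((one_le_div hm).2 hN)

theorem isOptimalWeight_iff [Nonempty ι] {N : ℝ} (hN : Fintype.card ι ≤ N) (v q : ι → ℝ) :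
    obj.IsOptimalWeight v q ↔ IsTieFreeMax (obj.curvature (Fintype.card ι))
      (1 / Fintype.card ι) (obj.ratioCap N / Fintype.card ι) v q := by
  simp only [IsOptimalWeight, IsTieFreeMax, value_eq, feasible_eq hN]

theorem uniform_mem_feasible [Nonempty ι] (h : obj.IsValid) :
    (fun _ => 1 / (Fintype.card ι : ℝ)) ∈ obj.feasible ι := by
  have hm : (0 : ℝ) < Fintype.card ι := Nat.cast_pos.2 Fintype.card_pos
  have hs : (fun _ => 1 / (Fintype.card ι : ℝ)) ∈ stdSimplex ℝ ι :=
    ⟨fun i => by positivity, by simp [hm.ne']⟩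
  cases obj with
  | cvar α =>
    refine ⟨hs, fun i => ?_⟩
    have := h.1
    exact one_div_le_one_div_of_le (by positivity) (by nlinarith [h.2])
  | chiSqPen lam => exact hs

theorem isOptimalWeight_optimalWeight [Nonempty ι] (h : obj.IsValid) (v : ι → ℝ) :
    obj.IsOptimalWeight v (obj.optimalWeight v) := by
  refine Classical.epsilon_spec (p := obj.IsOptimalWeight v) ?_
  obtain ⟨q, hq⟩ := exists_isTieFreeMax (a := obj.curvature (Fintype.card ι))
    (c := 1 / Fintype.card ι) (u := obj.ratioCap (Fintype.card ι) / Fintype.card ι)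
    (curvature_nonneg h (Nat.cast_nonneg _))
    ⟨_, feasible_eq (ι := ι) le_rfl ▸ uniform_mem_feasible h⟩ v
  exact ⟨q, (isOptimalWeight_iff le_rfl v q).2 hq⟩

theorem isTieFreeMax_optimalWeight [Nonempty ι] (h : obj.IsValid) {N : ℝ}
    (hN : Fintype.card ι ≤ N) (v : ι → ℝ) :
    IsTieFreeMax (obj.curvature (Fintype.card ι)) (1 / Fintype.card ι)
      (obj.ratioCap N / Fintype.card ι) v (obj.optimalWeight v) :=
  (isOptimalWeight_iff hN _ _).1 (isOptimalWeight_optimalWeight h v)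

theorem IsOptimalWeight.eq_optimalWeight [Nonempty ι] (h : obj.IsValid) {v q : ι → ℝ}
    (hq : obj.IsOptimalWeight v q) : q = obj.optimalWeight v :=
  ((isOptimalWeight_iff le_rfl v q).1 hq).unique (curvature_nonneg h (Nat.cast_nonneg _))
    (isTieFreeMax_optimalWeight h le_rfl v)

theorem optimalWeight_comp_equiv {κ : Type*} [Fintype κ] [Nonempty ι] (h : obj.IsValid)
    (e : κ ≃ ι) (v : ι → ℝ) : obj.optimalWeight (v ∘ e) = obj.optimalWeight v ∘ e := by
  have : Nonempty κ := (Equiv.nonempty_congr e).2 ‹_›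
  refine (IsOptimalWeight.eq_optimalWeight h ?_).symm
  have hc : Fintype.card κ = Fintype.card ι := Fintype.card_congr e
  rw [isOptimalWeight_iff le_rfl, hc]
  exact (isTieFreeMax_optimalWeight h le_rfl v).comp_equiv e

/-- For CVaR the cap gives `q i ^ 2 ≤ q i / (α m)`, which is summed with total mass one. For the
penalty, the variational inequality against the uniform weights bounds `lam * m` times the sum by a
difference of mean losses, at most `B`. -/
theorem sum_sq_optimalWeight_sub_le [Nonempty ι] (h : obj.IsValid) {v : ι → ℝ} {B : ℝ}
    (h0 : ∀ i, 0 ≤ v i) (hB : ∀ i, v i ≤ B) :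
    ∑ i, (obj.optimalWeight v i - 1 / Fintype.card ι) ^ 2 ≤ obj.spread B / Fintype.card ι := by
  have hm : (0 : ℝ) < Fintype.card ι := Nat.cast_pos.2 Fintype.card_pos
  set q := obj.optimalWeight v
  set m : ℝ := (Fintype.card ι : ℝ)
  have hq := isTieFreeMax_optimalWeight h (le_refl m) v
  have hsum : ∑ i, q i = 1 := hq.1.2.1
  cases obj with
  | cvar α =>
    have h1 : ∀ i, (q i - 1 / m) ^ 2 ≤ α⁻¹ / m * q i - 2 / m * q i + (1 / m) ^ 2 := fun i => by
      have ha := hq.1.1 i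
      have hb : q i ≤ 1 / α / m := hq.1.2.2 i
      rw [one_div] at hb
      have e : 2 / m * q i = 2 * (q i * (1 / m)) := by ring
      nlinarith
    refine (Finset.sum_le_sum fun i _ => h1 i).trans ?_
    rw [Finset.sum_add_distrib, Finset.sum_sub_distrib, ← Finset.mul_sum, ← Finset.mul_sum, hsum]
    simp only [Finset.sum_const, Finset.card_univ, nsmul_eq_mul, spread]
    change α⁻¹ / m * 1 - 2 / m * 1 + m * (1 / m) ^ 2 ≤ α⁻¹ / m
    have : m * (1 / m) ^ 2 = 1 / m := by field_simp
    rw [this]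
    have : 0 < 1 / m := by positivity
    have e : 2 / m = 2 * (1 / m) := by ring
    linarith
  | chiSqPen lam =>
    have hl : 0 < lam := h
    have hu := uniform_mem_feasible (ι := ι) h
    rw [feasible_eq (le_refl m)] at hu
    have hvi := variational_inequality (curvature_nonneg h hm.le) hq.1 hq.2.1 hu
    have e : ∑ i, (v i - curvature (chiSqPen lam) m * (q i - 1 / m)) * (1 / m - q i) =
        lam * m * ∑ i, (q i - 1 / m) ^ 2 - ∑ i, v i * (q i - 1 / m) := by
      rw [Finset.mul_sum, ← Finset.sum_sub_distrib]
      exact Finset.sum_congr rfl fun i _ => by simp only [curvature]; ring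
    change ∑ i, (v i - curvature (chiSqPen lam) m * (q i - 1 / m)) * (1 / m - q i) ≤ 0 at hvi
    rw [e] at hvi
    have h2 : ∑ i, v i * (q i - 1 / m) ≤ ∑ i, B * q i := Finset.sum_le_sum fun i _ => by
      have := mul_nonneg (h0 i) (one_div_pos.2 hm).le
      nlinarith [mul_le_mul_of_nonneg_right (hB i) (hq.1.1 i)]
    rw [← Finset.mul_sum, hsum] at h2
    simp only [spread]
    rw [div_div, le_div_iff₀ (by positivity)]
    linarith

/-- For CVaR the weights depend only on the order pattern of the losses, which is a measurable
function with finitely many values. For the penalty they are a continuous function of the losses. -/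
theorem measurable_optimalWeight (h : obj.IsValid) :
    Measurable fun v : ι → ℝ => obj.optimalWeight v := by
  cases isEmpty_or_nonempty ι with
  | inl _ => exact measurable_of_subsingleton_codomain _
  | inr _ =>
  cases obj with
  | cvar α =>
    classical
    let pattern : (ι → ℝ) → ι → ι → Bool := fun v i j => decide (v i < v j)
    have hpm : Measurable pattern := by
      refine measurable_pi_lambda _ fun i => measurable_pi_lambda _ fun j => ?_
      refine measurable_to_bool ?_
      have : (fun v : ι → ℝ => pattern v i j) ⁻¹' {true} = {v | v i < v j} := by
        ext v; simp [pattern]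
      rw [this]
      exact measurableSet_lt (measurable_pi_apply i) (measurable_pi_apply j)
    have hfac : ∀ v w : ι → ℝ, pattern v = pattern w →
        (cvar α).optimalWeight v = (cvar α).optimalWeight w := by
      intro v w hvw
      refine IsOptimalWeight.eq_optimalWeight h ((isOptimalWeight_iff le_rfl _ _).2 ?_)
      refine (isTieFreeMax_optimalWeight h le_rfl v).of_same_order fun i j => ?_
      have := congrFun (congrFun hvw i) j
      simpa [pattern] using this
    let F : (ι → ι → Bool) → ι → ℝ := fun P =>
      if hP : ∃ v, pattern v = P then (cvar α).optimalWeight hP.choose else 0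
    have hF : (fun v : ι → ℝ => (cvar α).optimalWeight v) = F ∘ pattern := by
      funext v
      have hP : ∃ w, pattern w = pattern v := ⟨v, rfl⟩
      simp only [F, Function.comp_apply, dif_pos hP]
      exact hfac _ _ hP.choose_spec.symm
    rw [hF]
    exact (measurable_of_countable F).comp hpm
  | chiSqPen lam =>
    have hl : 0 < lam := h
    have hm : (0 : ℝ) < Fintype.card ι := Nat.cast_pos.2 Fintype.card_pos
    set a := curvature (chiSqPen lam) (Fintype.card ι) with ha'
    have ha : 0 < a := mul_pos hl hm
    refine Continuous.measurable (continuous_pi fun i => continuous_iff_continuousAt.2 fun v => ?_)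
    rw [ContinuousAt, tendsto_iff_dist_tendsto_zero]
    have hb : ∀ w : ι → ℝ, dist ((chiSqPen lam).optimalWeight w i)
        ((chiSqPen lam).optimalWeight v i) ≤ √(∑ i, (w i - v i) ^ 2) / a := by
      intro w
      have hlip := (isTieFreeMax_optimalWeight h le_rfl v).mul_sum_sq_sub_le ha
        (isTieFreeMax_optimalWeight h le_rfl w)
      rw [Real.dist_eq, le_div_iff₀ ha, ← abs_of_pos ha, ← abs_mul]
      refine Real.abs_le_sqrt (le_trans ?_ hlip)
      rw [mul_pow, mul_comm]
      gcongr
      exact Finset.single_le_sum (f := fun j => ((chiSqPen lam).optimalWeight w j -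
        (chiSqPen lam).optimalWeight v j) ^ 2) (fun j _ => sq_nonneg _) (Finset.mem_univ i)
    refine squeeze_zero (fun _ => dist_nonneg) hb ?_
    have hcont : Continuous fun w : ι → ℝ => √(∑ i, (w i - v i) ^ 2) / a := by fun_prop
    simpa using hcont.tendsto v

end Weights

end Objective

/-! ### Optimal weights and robust losses of batches of sample indices. -/

section Batch

variable {obj : Objective}

/-- The optimal weights of the batch `I`, extended by zero. -/
noncomputable def batchWeight (obj : Objective) (v : ℕ → ℝ) (I : Finset ℕ) (i : ℕ) : ℝ :=
  if h : i ∈ I then obj.optimalWeight (fun i : I => v i) ⟨i, h⟩ else 0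

/-- The value of the weights `w` on the batch `I`. -/
noncomputable def weightGain (obj : Objective) (v : ℕ → ℝ) (I : Finset ℕ) (w : ℕ → ℝ) : ℝ :=
  ∑ i ∈ I, w i * v i - obj.curvature I.card / 2 * ∑ i ∈ I, (w i - 1 / I.card) ^ 2

/-- The robust loss of the batch `I`. -/
noncomputable def batchLoss (obj : Objective) (v : ℕ → ℝ) (I : Finset ℕ) : ℝ :=
  weightGain obj v I (batchWeight obj v I)

theorem batchWeight_coe (v : ℕ → ℝ) (I : Finset ℕ) (i : I) :
    batchWeight obj v I i = obj.optimalWeight (fun i : I => v i) i := by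
  simp [batchWeight]

theorem sum_batch {M : Type*} [AddCommMonoid M] (I : Finset ℕ) (f : ℕ → M) :
    ∑ i ∈ I, f i = ∑ i : I, f i :=
  (Finset.sum_coe_sort I f).symm

theorem isTieFreeMax_batchWeight (h : obj.IsValid) {I : Finset ℕ} (hI : I.Nonempty) {N : ℝ}
    (hN : I.card ≤ N) (v : ℕ → ℝ) :
    IsTieFreeMax (obj.curvature I.card) (1 / I.card) (obj.ratioCap N / I.card)
      (fun i : I => v i) (fun i : I => batchWeight obj v I i) := by
  have := hI.to_subtype
  simp only [batchWeight_coe]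
  have := Objective.isTieFreeMax_optimalWeight h (ι := I) (N := N) (by simpa using hN)
    (fun i : I => v i)
  simpa using this

theorem batchWeight_nonneg (h : obj.IsValid) (v : ℕ → ℝ) (I : Finset ℕ) (i : ℕ) :
    0 ≤ batchWeight obj v I i := by
  by_cases hi : i ∈ I
  · exact (isTieFreeMax_batchWeight h ⟨i, hi⟩ le_rfl v).1.1 ⟨i, hi⟩
  · simp [batchWeight, hi]

theorem sum_batchWeight (h : obj.IsValid) {I : Finset ℕ} (hI : I.Nonempty) (v : ℕ → ℝ) :
    ∑ i ∈ I, batchWeight obj v I i = 1 := by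
  rw [sum_batch]
  exact (isTieFreeMax_batchWeight h hI le_rfl v).1.2.1

theorem batchWeight_le_one (h : obj.IsValid) (v : ℕ → ℝ) (I : Finset ℕ) (i : ℕ) :
    batchWeight obj v I i ≤ 1 := by
  by_cases hi : i ∈ I
  · rw [← sum_batchWeight h ⟨i, hi⟩ v]
    exact Finset.single_le_sum (fun j _ => batchWeight_nonneg h v I j) hi
  · simp [batchWeight, hi]

theorem batchWeight_le {α : ℝ} (h : (Objective.cvar α).IsValid) (v : ℕ → ℝ)
    (I : Finset ℕ) {i : ℕ} (hi : i ∈ I) :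
    batchWeight (Objective.cvar α) v I i ≤ 1 / (α * I.card) := by
  have := (isTieFreeMax_batchWeight h ⟨i, hi⟩ le_rfl v).1.2.2 ⟨i, hi⟩
  rw [← div_div]
  exact this

theorem sum_sq_batchWeight_sub_le (h : obj.IsValid) {I : Finset ℕ} (hI : I.Nonempty) {v : ℕ → ℝ}
    {B : ℝ} (h0 : ∀ i, 0 ≤ v i) (hB : ∀ i, v i ≤ B) :
    ∑ i ∈ I, (batchWeight obj v I i - 1 / I.card) ^ 2 ≤ obj.spread B / I.card := by
  have := hI.to_subtype
  rw [sum_batch I fun i => (batchWeight obj v I i - 1 / I.card) ^ 2]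
  have := Objective.sum_sq_optimalWeight_sub_le h (v := fun i : I => v i) (fun i => h0 i)
    (fun i => hB i)
  simpa [batchWeight_coe] using this

theorem weightGain_le_batchLoss (h : obj.IsValid) {I : Finset ℕ} (hI : I.Nonempty) (v : ℕ → ℝ)
    {w : ℕ → ℝ} (h0 : ∀ i ∈ I, 0 ≤ w i) (h1 : ∑ i ∈ I, w i = 1)
    (hcap : ∀ α, obj = .cvar α → ∀ i ∈ I, w i ≤ 1 / (α * I.card)) :
    weightGain obj v I w ≤ batchLoss obj v I := by
  have hm : (0 : ℝ) < I.card := Nat.cast_pos.2 hI.card_pos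
  have hopt := (isTieFreeMax_batchWeight h hI le_rfl v).2.1 (fun i : I => w i)
    ⟨fun i => h0 i i.2, by rw [← sum_batch I w, h1], fun i => ?_⟩
  · simp only [penalizedGain] at hopt
    rwa [← sum_batch I fun i => w i * v i, ← sum_batch I fun i => (w i - 1 / I.card) ^ 2,
      ← sum_batch I fun i => batchWeight obj v I i * v i,
      ← sum_batch I fun i => (batchWeight obj v I i - 1 / I.card) ^ 2] at hopt
  · cases obj with
    | cvar α =>
      rw [Objective.ratioCap, div_div]
      exact hcap α rfl i i.2
    | chiSqPen lam =>
      rw [Objective.ratioCap, div_self hm.ne', ← h1]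
      exact Finset.single_le_sum h0 i.2

/-- By uniqueness the weights follow a relabelling of the samples; this transfers exchangeability
from the samples to the weights. -/
theorem batchWeight_comp_perm (h : obj.IsValid) (σ : Equiv.Perm ℕ) (v : ℕ → ℝ) (I : Finset ℕ)
    (i : ℕ) : batchWeight obj (v ∘ σ) I i =
      batchWeight obj v (I.map σ.toEmbedding) (σ i) := by
  by_cases hi : i ∈ I
  · have hi' : σ i ∈ I.map σ.toEmbedding := Finset.mem_map_of_mem _ hi
    have : Nonempty (I.map σ.toEmbedding) := ⟨⟨_, hi'⟩⟩
    let e : I ≃ I.map σ.toEmbedding := 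
      σ.subtypeEquiv fun a => by simp
    have := Objective.optimalWeight_comp_equiv h e fun i : I.map σ.toEmbedding => v i
    simp only [batchWeight, hi, hi', dif_pos]
    exact congrFun this ⟨i, hi⟩
  · simp [batchWeight, hi]

/-- On half of a batch, the weights of the batch are above, or below, the rescaled weights of the
half throughout. -/
theorem sum_abs_batchWeight_sub (h : obj.IsValid) {I J : Finset ℕ} (hJ : J.Nonempty)
    (hJI : J ⊆ I) (hcard : I.card = 2 * J.card) (v : ℕ → ℝ) :
    ∑ i ∈ J, |batchWeight obj v I i - 1 / 2 * batchWeight obj v J i| =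
      |∑ i ∈ J, batchWeight obj v I i - 1 / 2| := by
  have hm : (0 : ℝ) < J.card := Nat.cast_pos.2 hJ.card_pos
  have hc : (I.card : ℝ) = 2 * J.card := by exact_mod_cast hcard
  have hJ' : (J.card : ℝ) = 1 / 2 * I.card := by rw [hc]; ring
  have hI := isTieFreeMax_batchWeight h (hJ.mono hJI) (le_refl (I.card : ℝ)) v
  -- Using `N = I.card` for the half as well makes the caps, like the centres and the curvatures,
  -- stand in the ratio `1 / 2`.
  have hJm := isTieFreeMax_batchWeight h hJ (N := I.card) (by linarith) v
  rw [sum_batch J fun i => |batchWeight obj v I i - 1 / 2 * batchWeight obj v J i|, sum_batch J]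
  refine IsTieFreeMax.sum_abs_sub (Objective.curvature_nonneg h (Nat.cast_nonneg _)) one_half_pos
    ?_ ?_ ?_ (fun i : J => (⟨i, hJI i.2⟩ : I)) hI hJm
  · rw [hJ', Objective.curvature_mul]
  · rw [hJ', mul_comm (1 / 2 : ℝ), ← div_div]; ring
  · rw [hJ', mul_comm (1 / 2 : ℝ), ← div_div]; ring

theorem measurable_batchWeight {Ω : Type*} [MeasurableSpace Ω] (h : obj.IsValid)
    {v : Ω → ℕ → ℝ} (hv : ∀ i, Measurable fun ω => v ω i) (I : Finset ℕ) (i : ℕ) :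
    Measurable fun ω => batchWeight obj (v ω) I i := by
  unfold batchWeight
  split_ifs with hi
  · exact (measurable_pi_apply _).comp ((Objective.measurable_optimalWeight h).comp
      (measurable_pi_lambda (fun ω (i : I) => v ω i) fun i => hv i))
  · exact measurable_const

theorem measurable_batchLoss {Ω : Type*} [MeasurableSpace Ω] (h : obj.IsValid)
    {v : Ω → ℕ → ℝ} (hv : ∀ i, Measurable fun ω => v ω i) (I : Finset ℕ) :
    Measurable fun ω => batchLoss obj (v ω) I := by
  have := measurable_batchWeight h hv I
  unfold batchLoss weightGain
  fun_prop

theorem batchLoss_nonneg (h : obj.IsValid) {I : Finset ℕ} (hI : I.Nonempty) {v : ℕ → ℝ}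
    (h0 : ∀ i, 0 ≤ v i) : 0 ≤ batchLoss obj v I := by
  have hm : (0 : ℝ) < I.card := Nat.cast_pos.2 hI.card_pos
  refine le_trans ?_ (weightGain_le_batchLoss h hI v (w := fun _ => 1 / I.card)
    (fun _ _ => by positivity) (by simp [hm.ne']) ?_)
  · simp only [weightGain, sub_self]
    have : 0 ≤ ∑ i ∈ I, 1 / (I.card : ℝ) * v i :=
      Finset.sum_nonneg fun i _ => mul_nonneg (by positivity) (h0 i)
    simpa using this
  · rintro α rfl i _
    have := h.1
    exact one_div_le_one_div_of_le (by positivity) (by nlinarith [h.2])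

theorem batchLoss_le (h : obj.IsValid) {I : Finset ℕ} (hI : I.Nonempty) {v : ℕ → ℝ} {B : ℝ}
    (hB : ∀ i, v i ≤ B) : batchLoss obj v I ≤ B := by
  have h1 : ∑ i ∈ I, batchWeight obj v I i * v i ≤ ∑ i ∈ I, batchWeight obj v I i * B :=
    Finset.sum_le_sum fun i _ => mul_le_mul_of_nonneg_left (hB i) (batchWeight_nonneg h v I i)
  rw [← Finset.sum_mul, sum_batchWeight h hI, one_mul] at h1
  have h2 : 0 ≤ obj.curvature I.card / 2 *
      ∑ i ∈ I, (batchWeight obj v I i - 1 / I.card) ^ 2 :=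
    mul_nonneg (div_nonneg (Objective.curvature_nonneg h (Nat.cast_nonneg _)) zero_le_two)
      (Finset.sum_nonneg fun _ _ => sq_nonneg _)
  simp only [batchLoss, weightGain]
  linarith

end Batch

/-! ### Loss models and mini-batch gradients. -/

/-- A convex, Lipschitz loss with values in `[0, B]` on a closed convex set `X`, with a measurable
choice of subgradients of norm at most `G`. -/
structure IsLossModel {E S : Type*} [NormedAddCommGroup E] [InnerProductSpace ℝ E]
    [MeasurableSpace E] [MeasurableSpace S] (X : Set E) (G B : ℝ) (l : E → S → ℝ)
    (g : E → S → E) : Prop where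
  isClosed : IsClosed X
  convex : Convex ℝ X
  nonneg : ∀ x ∈ X, ∀ s, 0 ≤ l x s
  le : ∀ x ∈ X, ∀ s, l x s ≤ B
  lipschitz : ∀ s, ∀ x ∈ X, ∀ y ∈ X, |l x s - l y s| ≤ G * ‖x - y‖
  measurable_loss : ∀ x ∈ X, Measurable (l x)
  norm_le : ∀ s, ∀ x ∈ X, ‖g x s‖ ≤ G
  subgradient : ∀ s, ∀ x ∈ X, ∀ y ∈ X, l x s + inner ℝ (g x s) (y - x) ≤ l y s
  measurable_grad : Measurable (Function.uncurry g)

section Gradient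

variable {obj : Objective} {E S : Type*} [NormedAddCommGroup E] [InnerProductSpace ℝ E]
  {X : Set E} {G B : ℝ} {l : E → S → ℝ} {g : E → S → E}

theorem batchGrad_eq (s : ℕ → S) (I : Finset ℕ) (x : E) : batchGrad obj l g s I x =
    ∑ i ∈ I, batchWeight obj (fun i => l x (s i)) I i • g x (s i) := by
  rw [sum_batch I fun i => batchWeight obj (fun i => l x (s i)) I i • g x (s i)]
  simp [batchGrad, batchWeight_coe]

theorem batchGrad_comp_perm (h : obj.IsValid) (σ : Equiv.Perm ℕ) (s : ℕ → S) (I : Finset ℕ)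
    (x : E) : batchGrad obj l g (s ∘ σ) I x =
      batchGrad obj l g s (I.map σ.toEmbedding) x := by
  have := batchWeight_comp_perm h σ (fun i => l x (s i)) I
  simp only [Function.comp_def] at this
  simp [batchGrad_eq, this]

namespace IsLossModel

variable [MeasurableSpace E] [MeasurableSpace S] (hl : IsLossModel X G B l g)
include hl

theorem norm_batchGrad_le (h : obj.IsValid) {I : Finset ℕ} (hI : I.Nonempty) (s : ℕ → S) {x : E}
    (hx : x ∈ X) : ‖batchGrad obj l g s I x‖ ≤ G := by
  rw [batchGrad_eq]
  refine (norm_sum_le _ _).trans ?_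
  have : ∑ i ∈ I, batchWeight obj (fun i => l x (s i)) I i * G = G := by
    rw [← Finset.sum_mul, sum_batchWeight h hI, one_mul]
  refine le_trans (Finset.sum_le_sum fun i _ => ?_) this.le
  rw [norm_smul, Real.norm_of_nonneg (batchWeight_nonneg h _ I i)]
  exact mul_le_mul_of_nonneg_left (hl.norm_le _ x hx) (batchWeight_nonneg h _ I i)

/-- The weights that are optimal at `x` remain feasible at `y`, and the penalty does not involve the
losses. So the subgradient inequalities of the single losses, averaged with these weights, bound the
loss at `y` from below. -/
theorem batchLoss_add_inner_le (h : obj.IsValid) {I : Finset ℕ} (hI : I.Nonempty) (s : ℕ → S)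
    {x y : E} (hx : x ∈ X) (hy : y ∈ X) :
    batchLoss obj (fun i => l x (s i)) I + inner ℝ (batchGrad obj l g s I x) (y - x) ≤
      batchLoss obj (fun i => l y (s i)) I := by
  refine le_trans ?_ (weightGain_le_batchLoss h hI (fun i => l y (s i))
    (w := batchWeight obj (fun i => l x (s i)) I) (fun i _ => batchWeight_nonneg h _ I i)
    (sum_batchWeight h hI _) (by rintro α rfl i hi; exact batchWeight_le h _ I hi))
  rw [batchGrad_eq, sum_inner, batchLoss, weightGain, weightGain, sub_add_eq_add_sub,
    ← Finset.sum_add_distrib]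
  gcongr with i
  rw [inner_smul_left, RCLike.conj_to_real, ← mul_add]
  exact mul_le_mul_of_nonneg_left (hl.subgradient _ x hx y hy) (batchWeight_nonneg h _ I i)

/-- The bias increment is controlled by the imbalance of the weights between the halves. -/
theorem norm_biasIncrement_le (h : obj.IsValid) (s : ℕ → S) {m : ℕ} (hm : 0 < m) {x : E}
    (hx : x ∈ X) : ‖biasIncrement obj l g s (2 * m) x‖ ≤
      G * |∑ i ∈ Finset.range m, (batchWeight obj (fun i => l x (s i)) (Finset.range (2 * m)) i -
        batchWeight obj (fun i => l x (s i)) (Finset.range (2 * m)) (m + i))| := by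
  set v : ℕ → ℝ := fun i => l x (s i)
  set I := Finset.range (2 * m)
  set J := Finset.range m
  set K := Finset.Ico m (2 * m)
  set w := batchWeight obj v I
  have hsplit : ∀ f : ℕ → E,
      ∑ i ∈ I, f i = ∑ i ∈ J, f i + ∑ i ∈ K, f i := fun f =>
    (Finset.sum_range_add_sum_Ico f (by omega)).symm
  have hJ : J.Nonempty := ⟨0, by simp [J, hm]⟩
  have hK : K.Nonempty := ⟨m, by simp [K, hm]⟩
  have hJI : J ⊆ I := Finset.range_subset_range.2 (by omega)
  have hKI : K ⊆ I := fun i hi => by simp [K, I] at hi ⊢; omega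
  have hincr : biasIncrement obj l g s (2 * m) x =
      ∑ i ∈ J, (w i - 1 / 2 * batchWeight obj v J i) • g x (s i) +
        ∑ i ∈ K, (w i - 1 / 2 * batchWeight obj v K i) • g x (s i) := by
    have h2 : 2 * m / 2 = m := by omega
    simp only [biasIncrement, h2, batchGrad_eq, sub_smul, mul_smul, Finset.sum_sub_distrib,
      ← Finset.smul_sum]
    change ∑ i ∈ I, w i • g x (s i) - (1 / 2 : ℝ) • (∑ i ∈ J, batchWeight obj v J i • g x (s i) +
      ∑ i ∈ K, batchWeight obj v K i • g x (s i)) = _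
    rw [hsplit, smul_add]
    abel
  have hsum : ∑ i ∈ J, w i + ∑ i ∈ K, w i = 1 :=
    (Finset.sum_range_add_sum_Ico w (by omega)).trans (sum_batchWeight h (hJ.mono hJI) v)
  have hnorm : ∀ (L : Finset ℕ) (c : ℕ → ℝ), ‖∑ i ∈ L, c i • g x (s i)‖ ≤ G * ∑ i ∈ L, |c i| := by
    intro L c
    refine (norm_sum_le _ _).trans ?_
    rw [Finset.mul_sum]
    refine Finset.sum_le_sum fun i _ => ?_
    rw [norm_smul, Real.norm_eq_abs, mul_comm]
    exact mul_le_mul_of_nonneg_right (hl.norm_le _ x hx) (abs_nonneg _)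
  have hKsum : ∑ i ∈ J, w (m + i) = ∑ i ∈ K, w i := by
    rw [Finset.sum_Ico_eq_sum_range, show 2 * m - m = m by omega]
  rw [hincr, Finset.sum_sub_distrib, hKsum]
  refine (norm_add_le _ _).trans ((add_le_add (hnorm _ _) (hnorm _ _)).trans_eq ?_)
  rw [sum_abs_batchWeight_sub h hJ hJI (by simp [I, J]),
    sum_abs_batchWeight_sub h hK hKI (by simp [I, K]; omega), ← mul_add]
  congr 1
  change |∑ i ∈ J, w i - 1 / 2| + |∑ i ∈ K, w i - 1 / 2| = _
  -- The halves share total mass one, so their deviations from `1 / 2` are opposite and together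
  -- amount to the imbalance.
  have e1 : ∑ i ∈ K, w i - 1 / 2 = -(∑ i ∈ J, w i - 1 / 2) := by linarith
  have e2 : ∑ i ∈ J, w i - ∑ i ∈ K, w i = 2 * (∑ i ∈ J, w i - 1 / 2) := by linarith
  rw [e1, e2, abs_neg, abs_mul, abs_two]
  ring

end IsLossModel

end Gradient

/-! ### Exchangeability of the i.i.d. samples. -/

section Exchangeability

variable {S : Type*} [MeasurableSpace S] (P₀ : Measure S) [IsProbabilityMeasure P₀]

theorem measurePreserving_comp_perm (σ : Equiv.Perm ℕ) :
    MeasurePreserving (fun s : ℕ → S => s ∘ σ) (Measure.infinitePi fun _ : ℕ => P₀)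
      (Measure.infinitePi fun _ : ℕ => P₀) where
  measurable := measurable_pi_lambda _ fun i => measurable_pi_apply (σ i)
  map_eq := Measure.map_infinitePi_infinitePi_of_inj σ.injective

theorem integral_comp_perm (σ : Equiv.Perm ℕ) {f : (ℕ → S) → ℝ} (hf : Measurable f) :
    ∫ s, f (s ∘ σ) ∂(Measure.infinitePi fun _ : ℕ => P₀) =
      ∫ s, f s ∂(Measure.infinitePi fun _ : ℕ => P₀) := by
  have h := measurePreserving_comp_perm P₀ σ
  have h2 := integral_map (μ := Measure.infinitePi fun _ : ℕ => P₀) h.measurable.aemeasurable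
    (f := f) hf.aestronglyMeasurable
  rw [h.map_eq] at h2
  exact h2.symm

/-- The permutation that exchanges `{0, …, m - 1}` and `{m, …, 2 m - 1}`. -/
def blockSwap (m : ℕ) : Equiv.Perm ℕ where
  toFun i := if i < m then i + m else if i < 2 * m then i - m else i
  invFun i := if i < m then i + m else if i < 2 * m then i - m else i
  left_inv i := by dsimp only; split_ifs <;> omega
  right_inv i := by dsimp only; split_ifs <;> omega

theorem range_map_blockSwap (m : ℕ) :
    (Finset.range m).map (blockSwap m).toEmbedding = Finset.Ico m (2 * m) := by
  ext j
  rw [Finset.mem_map_equiv]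
  simp only [Finset.mem_range, Finset.mem_Ico, blockSwap, Equiv.coe_fn_symm_mk]
  split_ifs <;> omega

theorem range_map_swap {m i : ℕ} (hi : i < m) :
    (Finset.range (2 * m)).map (Equiv.swap i (m + i)).toEmbedding = Finset.range (2 * m) := by
  ext j
  rw [Finset.mem_map_equiv, Equiv.symm_swap, Finset.mem_range, Finset.mem_range,
    Equiv.swap_apply_def]
  split_ifs <;> omega

end Exchangeability

/-! ### Joint measurability of losses, gradients and estimators. -/

section Measurability

theorem measurable_apply_countable {Ω F : Type*} [MeasurableSpace Ω] [MeasurableSpace F]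
    {J : Ω → ℕ} {f : ℕ → Ω → F} (hJ : Measurable J) (hf : ∀ j, Measurable (f j)) :
    Measurable fun ω => f (J ω) ω :=
  (measurable_from_prod_countable_right (f := fun p : ℕ × Ω => f p.1 p.2) hf).comp
    (hJ.prodMk measurable_id)

variable {obj : Objective} {E S Ω : Type*} [NormedAddCommGroup E] [InnerProductSpace ℝ E]
  [MeasurableSpace E] [BorelSpace E] [SecondCountableTopology E] [MeasurableSpace S]
  [MeasurableSpace Ω] {X : Set E} {G B : ℝ} {l : E → S → ℝ} {g : E → S → E}

namespace IsLossModel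

variable (hl : IsLossModel X G B l g)
include hl

/-- On `X` the loss is continuous in the point and measurable in the sample, hence jointly
measurable. Outside `X` nothing is known about it, which is why the points are required to stay in
`X`. -/
theorem measurable_loss_comp {a : Ω → E} {b : Ω → S} (ha : Measurable a) (haX : ∀ ω, a ω ∈ X)
    (hb : Measurable b) : Measurable fun ω => l (a ω) (b ω) := by
  have hu : Measurable (Function.uncurry fun (x : X) s => l x s) := by
    refine measurable_uncurry_of_continuous_of_measurable (fun s => ?_)
      fun x => hl.measurable_loss x x.2
    refine (LipschitzWith.of_dist_le_mul (K := G.toNNReal) fun x y => ?_).continuous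
    rw [Real.dist_eq, Subtype.dist_eq, dist_eq_norm]
    exact (hl.lipschitz s x x.2 y y.2).trans
      (mul_le_mul_of_nonneg_right (Real.le_coe_toNNReal G) (norm_nonneg _))
  exact hu.comp ((ha.subtype_mk (h := haX)).prodMk hb)

theorem measurable_batchGrad_comp (h : obj.IsValid) {a : Ω → E} {b : Ω → ℕ → S}
    (ha : Measurable a) (haX : ∀ ω, a ω ∈ X) (hb : Measurable b) (I : Finset ℕ) :
    Measurable fun ω => batchGrad obj l g (b ω) I (a ω) := by
  simp only [batchGrad_eq]
  have hbi : ∀ i, Measurable fun ω => b ω i := fun i => (measurable_pi_apply i).comp hb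
  refine Finset.measurable_fun_sum _ fun i _ => Measurable.smul
    (measurable_batchWeight h (fun i => hl.measurable_loss_comp ha haX (hbi i)) I i)
    (hl.measurable_grad.comp (ha.prodMk (hbi i)))

theorem measurable_biasIncrement_comp (h : obj.IsValid) {a : Ω → E} {b : Ω → ℕ → S}
    (ha : Measurable a) (haX : ∀ ω, a ω ∈ X) (hb : Measurable b) (k : ℕ) :
    Measurable fun ω => biasIncrement obj l g (b ω) k (a ω) :=
  (hl.measurable_batchGrad_comp h ha haX hb _).sub
    (((hl.measurable_batchGrad_comp h ha haX hb _).add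
      (hl.measurable_batchGrad_comp h ha haX hb _)).const_smul _)

theorem measurable_mlmcGrad_comp (h : obj.IsValid) {a : Ω → E} {w : Ω → ℕ × (ℕ → S)}
    (ha : Measurable a) (haX : ∀ ω, a ω ∈ X) (hw : Measurable w) (jmax n₀ : ℕ) :
    Measurable fun ω => mlmcGrad obj l g jmax n₀ (w ω) (a ω) := by
  have h2 : ∀ j, Measurable fun ω => (levelProb jmax j)⁻¹ •
      biasIncrement obj l g (w ω).2 (2 ^ j * n₀) (a ω) := fun j =>
    (hl.measurable_biasIncrement_comp h ha haX hw.snd (2 ^ j * n₀)).const_smul (levelProb jmax j)⁻¹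
  exact (hl.measurable_batchGrad_comp h ha haX hw.snd (Finset.range n₀)).add
    (measurable_apply_countable hw.fst h2)

omit [BorelSpace E] [SecondCountableTopology E] in
theorem measurable_loss_sample {x : E} (hx : x ∈ X) (i : ℕ) :
    Measurable fun s : ℕ → S => l x (s i) :=
  (hl.measurable_loss x hx).comp (measurable_pi_apply i)

omit [BorelSpace E] [SecondCountableTopology E] in
theorem measurable_batchLoss_sample (h : obj.IsValid) {x : E} (hx : x ∈ X) (I : Finset ℕ) :
    Measurable fun s : ℕ → S => batchLoss obj (fun i => l x (s i)) I :=
  measurable_batchLoss h (hl.measurable_loss_sample hx) I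

omit [BorelSpace E] [SecondCountableTopology E] in
theorem measurable_batchWeight_sample (h : obj.IsValid) {x : E} (hx : x ∈ X) (I : Finset ℕ)
    (i : ℕ) : Measurable fun s : ℕ → S => batchWeight obj (fun i => l x (s i)) I i :=
  measurable_batchWeight h (hl.measurable_loss_sample hx) I i

theorem measurable_batchGrad_sample (h : obj.IsValid) {x : E} (hx : x ∈ X) (I : Finset ℕ) :
    Measurable fun s : ℕ → S => batchGrad obj l g s I x :=
  hl.measurable_batchGrad_comp h measurable_const (fun _ => hx) measurable_id I

theorem measurable_biasIncrement_sample (h : obj.IsValid) {x : E} (hx : x ∈ X) (k : ℕ) :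
    Measurable fun s : ℕ → S => biasIncrement obj l g s k x :=
  hl.measurable_biasIncrement_comp h measurable_const (fun _ => hx) measurable_id k

end IsLossModel

end Measurability

/-! ### The truncated geometric law of the level and its moments. -/

section Level

theorem levelProb_pos (jmax j : ℕ) : 0 < levelProb jmax j := by
  unfold levelProb; positivity

theorem levelProb_eq (jmax j : ℕ) :
    levelProb jmax j = 1 / 2 ^ j + if j = jmax then 1 / 2 ^ j else 0 := by
  unfold levelProb
  split_ifs
  · rw [zpow_add₀ two_ne_zero, zpow_neg, zpow_natCast, zpow_one]; ring
  · rw [add_zero, zpow_neg, zpow_natCast]; ring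

theorem inv_levelProb_le (jmax j : ℕ) : (levelProb jmax j)⁻¹ ≤ 2 ^ j := by
  rw [inv_le_comm₀ (levelProb_pos _ _) (by positivity), levelProb_eq, ← one_div]
  split_ifs
  · have : (0 : ℝ) < 1 / 2 ^ j := by positivity
    linarith
  · simp

theorem sum_levelProb_mul {jmax : ℕ} (hj : 1 ≤ jmax) (f : ℕ → ℝ) :
    ∑ j ∈ Finset.Icc 1 jmax, levelProb jmax j * f j =
      ∑ j ∈ Finset.Icc 1 jmax, f j / 2 ^ j + f jmax / 2 ^ jmax := by
  simp only [levelProb_eq, add_mul, Finset.sum_add_distrib, ite_mul, zero_mul,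
    Finset.sum_ite_eq', Finset.mem_Icc, hj, le_refl, and_self, if_true]
  congr 1
  · exact Finset.sum_congr rfl fun j _ => by ring
  · ring

theorem sum_levelProb {jmax : ℕ} (hj : 1 ≤ jmax) :
    ∑ j ∈ Finset.Icc 1 jmax, levelProb jmax j = 1 := by
  have h := sum_levelProb_mul hj fun _ => 1
  simp only [mul_one] at h
  rw [h]
  clear h
  induction jmax, hj using Nat.le_induction with
  | base => norm_num
  | succ k hk ih =>
    have e : (1 : ℝ) / 2 ^ (k + 1) + 1 / 2 ^ (k + 1) = 1 / 2 ^ k := by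
      rw [pow_succ]; field_simp; norm_num
    rw [Finset.sum_Icc_succ_top (by omega), add_assoc, e, ih]

theorem sum_levelProb_mul_two_pow {jmax : ℕ} (hj : 1 ≤ jmax) :
    ∑ j ∈ Finset.Icc 1 jmax, levelProb jmax j * 2 ^ j = jmax + 1 := by
  rw [sum_levelProb_mul hj]
  simp

theorem sum_levelProb_mul_four_pow_le {jmax : ℕ} (hj : 1 ≤ jmax) :
    ∑ j ∈ Finset.Icc 1 jmax, levelProb jmax j * (2 ^ j) ^ 2 ≤ 3 * 2 ^ jmax := by
  rw [sum_levelProb_mul hj]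
  have e : ∀ j : ℕ, ((2 : ℝ) ^ j) ^ 2 / 2 ^ j = 2 ^ j := fun j => by field_simp
  simp only [e]
  have : ∑ j ∈ Finset.Icc 1 jmax, (2 : ℝ) ^ j ≤ 2 * 2 ^ jmax := by
    clear hj
    induction jmax with
    | zero => norm_num
    | succ k ih =>
      rw [Finset.sum_Icc_succ_top (by omega), pow_succ]
      linarith
  linarith

theorem isProbabilityMeasure_levelLaw {jmax : ℕ} (hj : 1 ≤ jmax) :
    IsProbabilityMeasure (levelLaw jmax) := by
  constructor
  simp only [levelLaw, Measure.coe_finsetSum, Finset.sum_apply, Measure.smul_apply,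
    measure_univ, smul_eq_mul, mul_one]
  rw [← ENNReal.ofReal_sum_of_nonneg fun j _ => (levelProb_pos jmax j).le, sum_levelProb hj,
    ENNReal.ofReal_one]

theorem ae_mem_Icc_levelLaw (jmax : ℕ) : ∀ᵐ j ∂levelLaw jmax, j ∈ Finset.Icc 1 jmax := by
  rw [ae_iff]
  simp only [levelLaw, Measure.coe_finsetSum, Finset.sum_apply, Measure.smul_apply, smul_eq_mul]
  refine Finset.sum_eq_zero fun j hj => ?_
  rw [Measure.dirac_apply' _ (MeasurableSet.of_discrete)]
  have : j ∈ Finset.Icc 1 jmax := hj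
  simp_all

theorem integral_levelLaw (jmax : ℕ) (f : ℕ → ℝ) :
    ∫ j, f j ∂levelLaw jmax = ∑ j ∈ Finset.Icc 1 jmax, levelProb jmax j * f j := by
  unfold levelLaw
  rw [integral_finsetSum_measure fun j _ =>
    (integrable_dirac (by simp)).smul_measure ENNReal.ofReal_ne_top]
  refine Finset.sum_congr rfl fun j _ => ?_
  rw [integral_smul_measure, integral_dirac, ENNReal.toReal_ofReal (levelProb_pos _ _).le,
    smul_eq_mul]

variable {S : Type*} [MeasurableSpace S] (P₀ : Measure S) [IsProbabilityMeasure P₀]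

theorem isProbabilityMeasure_drawLaw {jmax : ℕ} (hj : 1 ≤ jmax) :
    IsProbabilityMeasure (drawLaw jmax P₀) := by
  have := isProbabilityMeasure_levelLaw hj
  unfold drawLaw
  infer_instance

theorem ae_mem_Icc_drawLaw (jmax : ℕ) : ∀ᵐ w ∂drawLaw jmax P₀, w.1 ∈ Finset.Icc 1 jmax :=
  Measure.quasiMeasurePreserving_fst.ae (ae_mem_Icc_levelLaw jmax)

theorem integral_drawLaw {jmax : ℕ} (hj : 1 ≤ jmax) {f : ℕ × (ℕ → S) → ℝ}
    (hf : Integrable f (drawLaw jmax P₀)) :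
    ∫ w, f w ∂drawLaw jmax P₀ = ∑ j ∈ Finset.Icc 1 jmax,
      levelProb jmax j * ∫ s, f (j, s) ∂(Measure.infinitePi fun _ : ℕ => P₀) := by
  have := isProbabilityMeasure_levelLaw hj
  rw [drawLaw, integral_prod f hf, integral_levelLaw]

end Level

theorem integrable_of_abs_le {Ω : Type*} [MeasurableSpace Ω] {μ : Measure Ω} [IsFiniteMeasure μ]
    {f : Ω → ℝ} (hf : Measurable f) {C : ℝ} (h : ∀ᵐ ω ∂μ, |f ω| ≤ C) : Integrable f μ :=
  Integrable.of_bound hf.aestronglyMeasurable C h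

/-! ### Second moments of the bias increment and of the multilevel estimator. -/

section Moments

theorem abs_batchWeight_sub_le_one {obj : Objective} (h : obj.IsValid) (v : ℕ → ℝ)
    (I : Finset ℕ) (i j : ℕ) : |batchWeight obj v I i - batchWeight obj v I j| ≤ 1 := by
  have h1 := batchWeight_nonneg h v I i
  have h2 := batchWeight_nonneg h v I j
  have h3 := batchWeight_le_one h v I i
  have h4 := batchWeight_le_one h v I j
  rw [abs_le]
  constructor <;> linarith

variable {obj : Objective} {E S : Type*} [NormedAddCommGroup E] [InnerProductSpace ℝ E]
  [MeasurableSpace E] [MeasurableSpace S] {X : Set E} {G B : ℝ} {l : E → S → ℝ} {g : E → S → E}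

namespace IsLossModel

variable (hl : IsLossModel X G B l g) (P₀ : Measure S) [IsProbabilityMeasure P₀]
include hl

/-- The optimal weights are evenly distributed over the halves of a sample, up to a small variance:
exchanging two samples shows that the differences of paired weights are uncorrelated. -/
theorem integral_sq_imbalance_le (h : obj.IsValid) {x : E} (hx : x ∈ X) {m : ℕ} (hm : 0 < m) :
    ∫ s : ℕ → S, (∑ i ∈ Finset.range m,
      (batchWeight obj (fun i => l x (s i)) (Finset.range (2 * m)) i -
        batchWeight obj (fun i => l x (s i)) (Finset.range (2 * m)) (m + i))) ^ 2
      ∂(Measure.infinitePi fun _ : ℕ => P₀) ≤ obj.spread B / m := by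
  set ν := Measure.infinitePi fun _ : ℕ => P₀
  set I := Finset.range (2 * m) with hI
  set w : (ℕ → S) → ℕ → ℝ := fun s => batchWeight obj (fun i => l x (s i)) I
  set D : ℕ → (ℕ → S) → ℝ := fun i s => w s i - w s (m + i)
  have hD : ∀ i, Measurable (D i) := fun i =>
    (hl.measurable_batchWeight_sample h hx I i).sub (hl.measurable_batchWeight_sample h hx I (m + i))
  have hD1 : ∀ i s, |D i s| ≤ 1 := fun i s =>
    abs_batchWeight_sub_le_one h _ I i (m + i)
  have hint : ∀ i j, Integrable (fun s => D i s * D j s) ν := fun i j =>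
    integrable_of_abs_le ((hD i).mul (hD j)) (C := 1) (ae_of_all _ fun s => by
      rw [abs_mul]; exact mul_le_one₀ (hD1 i s) (abs_nonneg _) (hD1 j s))
  have hw : ∀ (i : ℕ), i < m → ∀ s a,
      w (s ∘ Equiv.swap i (m + i)) a = w s (Equiv.swap i (m + i) a) := fun i hi s a => by
    have := batchWeight_comp_perm h (Equiv.swap i (m + i)) (fun i => l x (s i)) I a
    rw [hI, range_map_swap hi] at this
    exact this
  have hcross : ∀ i ∈ Finset.range m, ∀ j ∈ Finset.range m, j ≠ i →
      ∫ s, D i s * D j s ∂ν = 0 := by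
    intro i hi j hj hji
    rw [Finset.mem_range] at hi hj
    have hperm := integral_comp_perm P₀ (Equiv.swap i (m + i)) ((hD i).mul (hD j))
    -- The swap of `i` and `m + i` preserves the law of the samples and the full batch; it reverses
    -- `D i` and fixes `D j` for `j ≠ i` below `m`.
    have hneg : ∀ s : ℕ → S, D i (s ∘ Equiv.swap i (m + i)) * D j (s ∘ Equiv.swap i (m + i)) =
        -(D i s * D j s) := fun s => by
      simp only [D, hw i hi, Equiv.swap_apply_left, Equiv.swap_apply_right]
      rw [Equiv.swap_apply_of_ne_of_ne hji (by omega),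
        Equiv.swap_apply_of_ne_of_ne (show m + j ≠ i by omega) (by omega)]
      ring
    simp only [Pi.mul_apply, hneg, integral_neg] at hperm
    change -∫ s, D i s * D j s ∂ν = ∫ s, D i s * D j s ∂ν at hperm
    linarith
  have hexp : ∀ s, (∑ i ∈ Finset.range m, D i s) ^ 2 =
      ∑ i ∈ Finset.range m, ∑ j ∈ Finset.range m, D i s * D j s := fun s => by
    rw [sq, Finset.sum_mul_sum]
  have hpt : ∀ s, ∑ i ∈ Finset.range m, D i s * D i s ≤ obj.spread B / m := by
    intro s
    set c : ℝ := 1 / I.card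
    have hI0 : I.Nonempty := ⟨0, by simp [I, hm]⟩
    have hsq := sum_sq_batchWeight_sub_le h hI0 (v := fun i => l x (s i))
      (fun i => hl.nonneg x hx _) (fun i => hl.le x hx _)
    have hsplit := Finset.sum_range_add (fun i => (w s i - c) ^ 2) m m
    rw [← two_mul] at hsplit
    change ∑ i ∈ I, (w s i - c) ^ 2 ≤ _ at hsq
    rw [hsplit] at hsq
    -- Each `D i` is a difference of two deviations from the uniform weight, so `(a - b)² ≤ 2 a² + 2
    -- b²` applies. The factor two cancels against the batch size `2 * m` in the bound on the
    -- spread.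
    have hterm : ∑ i ∈ Finset.range m, D i s * D i s ≤
        2 * (∑ i ∈ Finset.range m, (w s i - c) ^ 2 +
          ∑ i ∈ Finset.range m, (w s (m + i) - c) ^ 2) := by
      rw [← Finset.sum_add_distrib, Finset.mul_sum]
      refine Finset.sum_le_sum fun i _ => ?_
      simp only [D]
      nlinarith [sq_nonneg ((w s i - c) + (w s (m + i) - c))]
    refine hterm.trans ((mul_le_mul_of_nonneg_left hsq zero_le_two).trans_eq ?_)
    have hm' : (m : ℝ) ≠ 0 := by positivity
    simp only [I, Finset.card_range, Nat.cast_mul, Nat.cast_ofNat]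
    field_simp
  change ∫ s, (∑ i ∈ Finset.range m, D i s) ^ 2 ∂ν ≤ _
  simp only [hexp]
  rw [integral_finsetSum _ fun i _ => integrable_finsetSum _ fun j _ => hint i j]
  have hdiag : ∀ i ∈ Finset.range m, ∫ s, ∑ j ∈ Finset.range m, D i s * D j s ∂ν =
      ∫ s, D i s * D i s ∂ν := fun i hi => by
    rw [integral_finsetSum _ fun j _ => hint i j]
    exact Finset.sum_eq_single_of_mem i hi fun j hj hji => hcross i hi j hj hji
  rw [Finset.sum_congr rfl hdiag, ← integral_finsetSum _ fun i _ => hint i i]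
  refine (integral_mono (integrable_finsetSum _ fun i _ => hint i i)
    (integrable_const (obj.spread B / m)) hpt).trans_eq ?_
  simp

variable [BorelSpace E] [SecondCountableTopology E]

/-- A crude bound that serves integrability; the decay in `m` holds only in mean square. -/
theorem norm_biasIncrement_le_const (h : obj.IsValid) (s : ℕ → S) {m : ℕ} (hm : 0 < m) {x : E}
    (hx : x ∈ X) : ‖biasIncrement obj l g s (2 * m) x‖ ≤ 2 * G := by
  have h2 : 2 * m / 2 = m := by omega
  have h1 : ∀ I : Finset ℕ, I.Nonempty → ‖batchGrad obj l g s I x‖ ≤ G :=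
    fun I hI => hl.norm_batchGrad_le h hI s hx
  unfold biasIncrement
  rw [h2]
  refine (norm_sub_le _ _).trans ?_
  rw [norm_smul, Real.norm_of_nonneg (by norm_num)]
  have := norm_add_le (batchGrad obj l g s (Finset.range m) x)
    (batchGrad obj l g s (Finset.Ico m (2 * m)) x)
  have := h1 (Finset.range (2 * m)) ⟨0, by simp [hm]⟩
  have := h1 (Finset.range m) ⟨0, by simp [hm]⟩
  have := h1 (Finset.Ico m (2 * m)) ⟨m, by simp [hm]⟩
  linarith

theorem integral_norm_sq_biasIncrement_le (h : obj.IsValid) {x : E} (hx : x ∈ X) {m : ℕ}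
    (hm : 0 < m) :
    ∫ s : ℕ → S, ‖biasIncrement obj l g s (2 * m) x‖ ^ 2
      ∂(Measure.infinitePi fun _ : ℕ => P₀) ≤ G ^ 2 * (obj.spread B / m) := by
  refine le_trans ?_ (mul_le_mul_of_nonneg_left (hl.integral_sq_imbalance_le P₀ h hx hm)
    (sq_nonneg G))
  rw [← integral_const_mul]
  refine integral_mono_of_nonneg (ae_of_all _ fun s => sq_nonneg _) ?_ (ae_of_all _ fun s => ?_)
  · refine Integrable.const_mul (integrable_of_abs_le (C := (∑ i ∈ Finset.range m, (1 : ℝ)) ^ 2)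
      (Measurable.pow_const (Finset.measurable_fun_sum _ fun i _ =>
        (hl.measurable_batchWeight_sample h hx _ _).sub
          (hl.measurable_batchWeight_sample h hx _ _)) 2) (ae_of_all _ fun s => ?_)) _
    rw [abs_pow]
    refine pow_le_pow_left₀ (abs_nonneg _) ((Finset.abs_sum_le_sum_abs _ _).trans
      (Finset.sum_le_sum fun i _ => ?_)) 2
    exact abs_batchWeight_sub_le_one h _ _ _ _
  · have := pow_le_pow_left₀ (norm_nonneg _) (hl.norm_biasIncrement_le h s hm hx) 2
    rwa [mul_pow, sq_abs] at this

theorem norm_mlmcGrad_le (h : obj.IsValid) (hG : 0 ≤ G) {x : E} (hx : x ∈ X) {jmax n₀ : ℕ}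
    (hn₀ : 1 ≤ n₀) {w : ℕ × (ℕ → S)} (hw : w.1 ∈ Finset.Icc 1 jmax) :
    ‖mlmcGrad obj l g jmax n₀ w x‖ ≤ G + 2 ^ jmax * (2 * G) := by
  rw [Finset.mem_Icc] at hw
  obtain ⟨j, hj⟩ : ∃ j, w.1 = j + 1 := ⟨w.1 - 1, by omega⟩
  have hk : 2 ^ w.1 * n₀ = 2 * (2 ^ j * n₀) := by rw [hj, pow_succ]; ring
  unfold mlmcGrad
  refine (norm_add_le _ _).trans (add_le_add
    (hl.norm_batchGrad_le h ⟨0, by simp; omega⟩ _ hx) ?_)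
  rw [norm_smul, Real.norm_of_nonneg (inv_nonneg.2 (levelProb_pos _ _).le), hk]
  refine mul_le_mul ?_ (hl.norm_biasIncrement_le_const h _ (by positivity) hx) (norm_nonneg _)
    (by positivity)
  exact (inv_levelProb_le _ _).trans (pow_le_pow_right₀ one_le_two hw.2)

theorem measurable_mlmcGrad (h : obj.IsValid) {x : E} (hx : x ∈ X) (jmax n₀ : ℕ) :
    Measurable fun w : ℕ × (ℕ → S) => mlmcGrad obj l g jmax n₀ w x :=
  hl.measurable_mlmcGrad_comp h measurable_const (fun _ => hx) measurable_id jmax n₀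

/-- The second moment of the multilevel estimator. -/
theorem integral_norm_sq_mlmcGrad_le (h : obj.IsValid) (hG : 0 ≤ G) (hB : 0 ≤ B) {x : E}
    (hx : x ∈ X) {jmax n₀ : ℕ} (hj : 1 ≤ jmax) (hn₀ : 1 ≤ n₀) :
    ∫ w, ‖mlmcGrad obj l g jmax n₀ w x‖ ^ 2 ∂drawLaw jmax P₀ ≤
      2 * G ^ 2 + 4 * G ^ 2 * obj.spread B * jmax / n₀ := by
  have := isProbabilityMeasure_drawLaw P₀ hj
  have hn : (0 : ℝ) < n₀ := by positivity
  have hmeas := hl.measurable_mlmcGrad h hx jmax n₀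
  have hint : Integrable (fun w => ‖mlmcGrad obj l g jmax n₀ w x‖ ^ 2) (drawLaw jmax P₀) := by
    refine integrable_of_abs_le (hmeas.norm.pow_const 2) (C := (G + 2 ^ jmax * (2 * G)) ^ 2) ?_
    filter_upwards [ae_mem_Icc_drawLaw P₀ jmax] with w hw
    rw [abs_of_nonneg (by positivity)]
    exact pow_le_pow_left₀ (norm_nonneg _) (hl.norm_mlmcGrad_le h hG hx hn₀ hw) 2
  rw [integral_drawLaw P₀ hj hint]
  have hterm : ∀ j ∈ Finset.Icc 1 jmax, levelProb jmax j *
      ∫ s, ‖mlmcGrad obj l g jmax n₀ (j, s) x‖ ^ 2 ∂(Measure.infinitePi fun _ : ℕ => P₀) ≤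
      levelProb jmax j * (2 * G ^ 2) + 4 * G ^ 2 * obj.spread B / n₀ := by
    intro j hj'
    rw [Finset.mem_Icc] at hj'
    obtain ⟨i, rfl⟩ : ∃ i, j = i + 1 := ⟨j - 1, by omega⟩
    have hk : 2 ^ (i + 1) * n₀ = 2 * (2 ^ i * n₀) := by rw [pow_succ]; ring
    set p := levelProb jmax (i + 1)
    have hp : 0 < p := levelProb_pos _ _
    have hbias := hl.integral_norm_sq_biasIncrement_le P₀ h hx (m := 2 ^ i * n₀) (by positivity)
    have hbint : Integrable (fun s : ℕ → S => ‖biasIncrement obj l g s (2 * (2 ^ i * n₀)) x‖ ^ 2)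
        (Measure.infinitePi fun _ : ℕ => P₀) := by
      refine integrable_of_abs_le ((hl.measurable_biasIncrement_sample h hx _).norm.pow_const 2)
        (C := (2 * G) ^ 2) (ae_of_all _ fun s => ?_)
      rw [abs_of_nonneg (by positivity)]
      exact pow_le_pow_left₀ (norm_nonneg _)
        (hl.norm_biasIncrement_le_const h s (by positivity) hx) 2
    have h1 : ∫ s, ‖mlmcGrad obj l g jmax n₀ (i + 1, s) x‖ ^ 2
        ∂(Measure.infinitePi fun _ : ℕ => P₀) ≤
        ∫ s, (2 * G ^ 2 + 2 * p⁻¹ ^ 2 * ‖biasIncrement obj l g s (2 * (2 ^ i * n₀)) x‖ ^ 2)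
        ∂(Measure.infinitePi fun _ : ℕ => P₀) := by
      refine integral_mono_of_nonneg (ae_of_all _ fun s => sq_nonneg _)
        ((integrable_const _).add (hbint.const_mul _)) (ae_of_all _ fun s => ?_)
      have hb := hl.norm_batchGrad_le h (I := Finset.range n₀) ⟨0, by simp; omega⟩ s hx
      simp only [mlmcGrad, hk]
      have hnorm := norm_add_le (batchGrad obj l g s (Finset.range n₀) x)
        (p⁻¹ • biasIncrement obj l g s (2 * (2 ^ i * n₀)) x)
      rw [norm_smul, Real.norm_of_nonneg (inv_nonneg.2 hp.le)] at hnorm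
      refine (pow_le_pow_left₀ (norm_nonneg _) hnorm 2).trans ?_
      have := pow_le_pow_left₀ (norm_nonneg _) hb 2
      nlinarith [sq_nonneg (‖batchGrad obj l g s (Finset.range n₀) x‖ -
        p⁻¹ * ‖biasIncrement obj l g s (2 * (2 ^ i * n₀)) x‖)]
    rw [integral_add (integrable_const _) (hbint.const_mul _),
      integral_const_mul (2 * p⁻¹ ^ 2)] at h1
    simp only [integral_const, probReal_univ, one_smul] at h1
    have h2 := mul_le_mul_of_nonneg_left (h1.trans (add_le_add_right
      (mul_le_mul_of_nonneg_left hbias (by positivity : (0 : ℝ) ≤ 2 * p⁻¹ ^ 2)) _)) hp.le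
    refine h2.trans ?_
    rw [mul_add]
    refine add_le_add_right ?_ _
    have hs := Objective.spread_nonneg h hB
    have e : p * (2 * p⁻¹ ^ 2 * (G ^ 2 * (obj.spread B / ((2 ^ i * n₀ : ℕ) : ℝ)))) =
        p⁻¹ * (2 * G ^ 2 * (obj.spread B / (2 ^ i * n₀))) := by
      push_cast
      field_simp
    rw [e]
    -- The factor `p⁻¹ ≤ 2 ^ (i + 1)` cancels the `2 ^ i` of the batch size, so every level
    -- contributes the same amount and the sum over levels yields the factor `jmax`.
    refine (mul_le_mul_of_nonneg_right (inv_levelProb_le jmax (i + 1)) (by positivity)).trans_eq ?_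
    rw [pow_succ]
    field_simp
    ring
  refine (Finset.sum_le_sum hterm).trans_eq ?_
  rw [Finset.sum_add_distrib, ← Finset.sum_mul, sum_levelProb hj]
  simp
  ring

end IsLossModel

end Moments

/-! ### The surrogate objective and the mean of the multilevel estimator. -/

/-- The expected robust loss of a sample of size `n`. -/
noncomputable def surrogate {S E : Type*} [MeasurableSpace S] (obj : Objective) (P₀ : Measure S)
    [IsProbabilityMeasure P₀] (l : E → S → ℝ) (n : ℕ) (x : E) : ℝ :=
  ∫ s : ℕ → S, batchLoss obj (fun i => l x (s i)) (Finset.range n)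
    ∂(Measure.infinitePi fun _ : ℕ => P₀)

namespace IsLossModel

variable {obj : Objective} {E S : Type*} [NormedAddCommGroup E] [InnerProductSpace ℝ E]
  [MeasurableSpace E] [MeasurableSpace S] {X : Set E} {G B : ℝ} {l : E → S → ℝ} {g : E → S → E}
  (hl : IsLossModel X G B l g) (P₀ : Measure S) [IsProbabilityMeasure P₀]
include hl

theorem integrable_batchLoss (h : obj.IsValid) {x : E} (hx : x ∈ X) {I : Finset ℕ}
    (hI : I.Nonempty) : Integrable (fun s : ℕ → S => batchLoss obj (fun i => l x (s i)) I)
      (Measure.infinitePi fun _ : ℕ => P₀) := by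
  refine integrable_of_abs_le (hl.measurable_batchLoss_sample h hx I) (C := B)
    (ae_of_all _ fun s => ?_)
  rw [abs_of_nonneg (batchLoss_nonneg h hI fun i => hl.nonneg x hx _)]
  exact batchLoss_le h hI fun i => hl.le x hx _

variable [BorelSpace E] [SecondCountableTopology E]

theorem abs_inner_batchGrad_le (h : obj.IsValid) {x : E} (hx : x ∈ X) (z : E) {I : Finset ℕ}
    (hI : I.Nonempty) (s : ℕ → S) : |inner ℝ (batchGrad obj l g s I x) z| ≤ G * ‖z‖ :=
  (abs_real_inner_le_norm _ _).trans
    (mul_le_mul_of_nonneg_right (hl.norm_batchGrad_le h hI s hx) (norm_nonneg _))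

theorem integrable_inner_batchGrad (h : obj.IsValid) {x : E} (hx : x ∈ X) (z : E) {I : Finset ℕ}
    (hI : I.Nonempty) : Integrable (fun s : ℕ → S => inner ℝ (batchGrad obj l g s I x) z)
      (Measure.infinitePi fun _ : ℕ => P₀) :=
  integrable_of_abs_le ((hl.measurable_batchGrad_sample h hx I).inner_const)
    (ae_of_all _ (hl.abs_inner_batchGrad_le h hx z hI))

/-- Exchanging the two blocks of samples preserves their law and maps the first half to the second.
-/
theorem integral_inner_batchGrad_Ico (h : obj.IsValid) {x : E} (hx : x ∈ X) (z : E) (m : ℕ) :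
    ∫ s : ℕ → S, inner ℝ (batchGrad obj l g s (Finset.Ico m (2 * m)) x) z
      ∂(Measure.infinitePi fun _ : ℕ => P₀) =
    ∫ s : ℕ → S, inner ℝ (batchGrad obj l g s (Finset.range m) x) z
      ∂(Measure.infinitePi fun _ : ℕ => P₀) := by
  rw [← integral_comp_perm P₀ (blockSwap m)
    ((hl.measurable_batchGrad_sample h hx (Finset.range m)).inner_const)]
  simp only [batchGrad_comp_perm h, range_map_blockSwap]

theorem integral_inner_biasIncrement (h : obj.IsValid) {x : E} (hx : x ∈ X) (z : E) {m : ℕ}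
    (hm : 0 < m) :
    ∫ s : ℕ → S, inner ℝ (biasIncrement obj l g s (2 * m) x) z
      ∂(Measure.infinitePi fun _ : ℕ => P₀) =
    ∫ s : ℕ → S, inner ℝ (batchGrad obj l g s (Finset.range (2 * m)) x) z
      ∂(Measure.infinitePi fun _ : ℕ => P₀) -
    ∫ s : ℕ → S, inner ℝ (batchGrad obj l g s (Finset.range m) x) z
      ∂(Measure.infinitePi fun _ : ℕ => P₀) := by
  have h2 : 2 * m / 2 = m := by omega
  have i1 := hl.integrable_inner_batchGrad P₀ h hx z (I := Finset.range (2 * m)) ⟨0, by simp [hm]⟩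
  have i2 := hl.integrable_inner_batchGrad P₀ h hx z (I := Finset.range m) ⟨0, by simp [hm]⟩
  have i3 := hl.integrable_inner_batchGrad P₀ h hx z (I := Finset.Ico m (2 * m)) ⟨m, by simp [hm]⟩
  simp only [biasIncrement, h2, inner_sub_left, inner_smul_left, inner_add_left,
    RCLike.conj_to_real]
  rw [integral_sub i1 ((i2.fun_add i3).const_mul _), integral_const_mul, integral_add i2 i3,
    hl.integral_inner_batchGrad_Ico P₀ h hx z m]
  ring

/-- The multilevel estimator has the same mean as the gradient estimator on the largest batch. -/
theorem integral_inner_mlmcGrad (h : obj.IsValid) (hG : 0 ≤ G) {x : E} (hx : x ∈ X) (z : E)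
    {jmax n₀ : ℕ} (hj : 1 ≤ jmax) (hn₀ : 1 ≤ n₀) :
    ∫ w, inner ℝ (mlmcGrad obj l g jmax n₀ w x) z ∂drawLaw jmax P₀ =
    ∫ s : ℕ → S, inner ℝ (batchGrad obj l g s (Finset.range (2 ^ jmax * n₀)) x) z
      ∂(Measure.infinitePi fun _ : ℕ => P₀) := by
  have := isProbabilityMeasure_drawLaw P₀ hj
  set A : ℕ → ℝ := fun m => ∫ s : ℕ → S, inner ℝ (batchGrad obj l g s (Finset.range m) x) z
      ∂(Measure.infinitePi fun _ : ℕ => P₀)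
  have hint : Integrable (fun w => inner ℝ (mlmcGrad obj l g jmax n₀ w x) z)
      (drawLaw jmax P₀) := by
    refine integrable_of_abs_le ((hl.measurable_mlmcGrad h hx jmax n₀).inner_const)
      (C := (G + 2 ^ jmax * (2 * G)) * ‖z‖) ?_
    filter_upwards [ae_mem_Icc_drawLaw P₀ jmax] with w hw
    exact (abs_real_inner_le_norm _ _).trans
      (mul_le_mul_of_nonneg_right (hl.norm_mlmcGrad_le h hG hx hn₀ hw) (norm_nonneg _))
  rw [integral_drawLaw P₀ hj hint]
  -- The probability of the level cancels the importance factor `1 / q(j)`; what is left telescopes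
  -- in `j`.
  have hterm : ∀ j ∈ Finset.Icc 1 jmax, levelProb jmax j *
      ∫ s, inner ℝ (mlmcGrad obj l g jmax n₀ (j, s) x) z ∂(Measure.infinitePi fun _ : ℕ => P₀) =
      levelProb jmax j * A n₀ + (A (2 ^ j * n₀) - A (2 ^ (j - 1) * n₀)) := by
    intro j hj'
    rw [Finset.mem_Icc] at hj'
    obtain ⟨i, rfl⟩ : ∃ i, j = i + 1 := ⟨j - 1, by omega⟩
    have hk : 2 ^ (i + 1) * n₀ = 2 * (2 ^ i * n₀) := by rw [pow_succ]; ring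
    have hp : levelProb jmax (i + 1) ≠ 0 := (levelProb_pos _ _).ne'
    have hb := hl.integral_inner_biasIncrement P₀ h hx z (m := 2 ^ i * n₀) (by positivity)
    have hbi : Integrable (fun s : ℕ → S => inner ℝ (biasIncrement obj l g s (2 * (2 ^ i * n₀)) x) z)
        (Measure.infinitePi fun _ : ℕ => P₀) :=
      integrable_of_abs_le ((hl.measurable_biasIncrement_sample h hx _).inner_const)
        (C := 2 * G * ‖z‖) (ae_of_all _ fun s => (abs_real_inner_le_norm _ _).trans
          (mul_le_mul_of_nonneg_right (hl.norm_biasIncrement_le_const h s (by positivity) hx)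
            (norm_nonneg _)))
    simp only [mlmcGrad, hk, inner_add_left, inner_smul_left, RCLike.conj_to_real,
      Nat.add_sub_cancel]
    rw [integral_add (hl.integrable_inner_batchGrad P₀ h hx z ⟨0, by simp; omega⟩)
      (hbi.const_mul _), integral_const_mul, hb, mul_add, mul_inv_cancel_left₀ hp]
  rw [Finset.sum_congr rfl hterm, Finset.sum_add_distrib, ← Finset.sum_mul, sum_levelProb hj,
    one_mul]
  have htel : ∀ j : ℕ, ∑ i ∈ Finset.Icc 1 j, (A (2 ^ i * n₀) - A (2 ^ (i - 1) * n₀)) =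
      A (2 ^ j * n₀) - A n₀ := by
    intro j
    induction j with
    | zero => simp
    | succ k ih => rw [Finset.sum_Icc_succ_top (by omega), ih, Nat.add_sub_cancel]; ring
  rw [htel]
  ring

/-- In mean the estimator is a subgradient of the surrogate at `x`, since this holds sample by
sample for the gradient on the largest batch. -/
theorem surrogate_sub_le (h : obj.IsValid) (hG : 0 ≤ G) {x y : E} (hx : x ∈ X) (hy : y ∈ X)
    {jmax n₀ : ℕ} (hj : 1 ≤ jmax) (hn₀ : 1 ≤ n₀) :
    surrogate obj P₀ l (2 ^ jmax * n₀) x - surrogate obj P₀ l (2 ^ jmax * n₀) y ≤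
      ∫ w, inner ℝ (mlmcGrad obj l g jmax n₀ w x) (x - y) ∂drawLaw jmax P₀ := by
  have hI : (Finset.range (2 ^ jmax * n₀)).Nonempty := ⟨0, by simp; omega⟩
  rw [hl.integral_inner_mlmcGrad P₀ h hG hx _ hj hn₀, surrogate, surrogate,
    ← integral_sub (hl.integrable_batchLoss P₀ h hx hI) (hl.integrable_batchLoss P₀ h hy hI)]
  refine integral_mono ((hl.integrable_batchLoss P₀ h hx hI).sub
    (hl.integrable_batchLoss P₀ h hy hI)) (hl.integrable_inner_batchGrad P₀ h hx _ hI) fun s => ?_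
  have h1 := hl.batchLoss_add_inner_le h hI s hx hy
  rw [← neg_sub x y, inner_neg_right] at h1
  dsimp only
  linarith

/-- Jensen's inequality for the surrogate. -/
theorem surrogate_average_le (h : obj.IsValid) {n T : ℕ} (hn : 1 ≤ n) (hT : 1 ≤ T) {a : ℕ → E}
    (ha : ∀ t, a t ∈ X) (hbar : (1 / (T : ℝ)) • ∑ t ∈ Finset.Icc 1 T, a t ∈ X) :
    surrogate obj P₀ l n ((1 / (T : ℝ)) • ∑ t ∈ Finset.Icc 1 T, a t) ≤
      1 / (T : ℝ) * ∑ t ∈ Finset.Icc 1 T, surrogate obj P₀ l n (a t) := by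
  have hI : (Finset.range n).Nonempty := ⟨0, by simp; omega⟩
  have hT' : (T : ℝ) ≠ 0 := by positivity
  set b := (1 / (T : ℝ)) • ∑ t ∈ Finset.Icc 1 T, a t with hb
  have hsum : ∑ t ∈ Finset.Icc 1 T, (a t - b) = 0 := by
    rw [Finset.sum_sub_distrib, Finset.sum_const, Nat.card_Icc, Nat.add_sub_cancel, hb,
      ← Nat.cast_smul_eq_nsmul ℝ, smul_smul, mul_one_div_cancel hT', one_smul, sub_self]
  unfold surrogate
  rw [← integral_finsetSum _ fun t _ => hl.integrable_batchLoss P₀ h (ha t) hI,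
    ← integral_const_mul]
  refine integral_mono (hl.integrable_batchLoss P₀ h hbar hI)
    ((integrable_finsetSum _ fun t _ => hl.integrable_batchLoss P₀ h (ha t) hI).const_mul _)
    fun s => ?_
  -- The subgradient inequalities are all taken at the average, so their linear terms cancel in the
  -- sum.
  have h1 := Finset.sum_le_sum fun t (_ : t ∈ Finset.Icc 1 T) =>
    hl.batchLoss_add_inner_le (obj := obj) h hI s hbar (ha t)
  rw [Finset.sum_add_distrib, ← inner_sum, hsum, inner_zero_right, add_zero, Finset.sum_const,
    Nat.card_Icc, Nat.add_sub_cancel, nsmul_eq_mul] at h1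
  dsimp only
  rw [one_div, inv_mul_eq_div, le_div_iff₀ (by positivity), mul_comm]
  exact h1

end IsLossModel

/-! ### From approximately normalized weights to feasible ones. -/

section Normalization

variable {obj : Objective}

/-- Weights `ρ / m` of total mass `r` can be turned into feasible ones at the price `B * |r - 1|`. -/
theorem weightGain_sub_le_batchLoss (h : obj.IsValid) {I : Finset ℕ} (hI : I.Nonempty)
    {v ρ : ℕ → ℝ} {B : ℝ} (hv0 : ∀ i, 0 ≤ v i) (hvB : ∀ i, v i ≤ B) (hρ0 : ∀ i, 0 ≤ ρ i)
    (hcap : ∀ α, obj = .cvar α → ∀ i, ρ i ≤ 1 / α) :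
    weightGain obj v I (fun i => ρ i / I.card) - B * |∑ i ∈ I, ρ i / I.card - 1| ≤
      batchLoss obj v I := by
  have hm : (0 : ℝ) < I.card := Nat.cast_pos.2 hI.card_pos
  have ha := Objective.curvature_nonneg h hm.le
  set m : ℝ := (I.card : ℝ)
  set a := obj.curvature m
  set r := ∑ i ∈ I, ρ i / m with hr
  clear_value r
  have hB : 0 ≤ B := (hv0 0).trans (hvB 0)
  suffices ∃ w : ℕ → ℝ, (∀ i ∈ I, 0 ≤ w i) ∧ ∑ i ∈ I, w i = 1 ∧
      (∀ α, obj = .cvar α → ∀ i ∈ I, w i ≤ 1 / (α * m)) ∧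
      ∑ i ∈ I, ρ i / m * v i - B * |r - 1| ≤ ∑ i ∈ I, w i * v i ∧
      a * ∑ i ∈ I, (w i - 1 / m) ^ 2 ≤ a * ∑ i ∈ I, (ρ i / m - 1 / m) ^ 2 by
    obtain ⟨w, h0, h1, h2, h3, h4⟩ := this
    refine le_trans ?_ (weightGain_le_batchLoss h hI v h0 h1 h2)
    change ∑ i ∈ I, ρ i / m * v i - a / 2 * ∑ i ∈ I, (ρ i / m - 1 / m) ^ 2 - B * |r - 1| ≤
      ∑ i ∈ I, w i * v i - a / 2 * ∑ i ∈ I, (w i - 1 / m) ^ 2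
    linarith
  have hsum1 : ∑ _i ∈ I, 1 / m = 1 := by
    rw [Finset.sum_const, nsmul_eq_mul, mul_one_div_cancel hm.ne']
  -- Excess mass is removed by dividing by `r`, which loses the fraction `(r - 1) / r` of a gain of
  -- at most `r * B`. Missing mass is added, which cannot decrease the gain because losses are
  -- nonnegative.
  rcases le_or_gt 1 r with hr1 | hr1
  · have hr0 : 0 < r := by linarith
    have hws : ∑ i ∈ I, ρ i / m / r = 1 := by
      rw [← Finset.sum_div, ← hr, div_self hr0.ne']
    refine ⟨fun i => ρ i / m / r, fun i _ => div_nonneg (div_nonneg (hρ0 i) hm.le) hr0.le, hws,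
      fun α hα i _ => ?_, ?_, ?_⟩
    · rw [← div_div]
      refine (div_le_self (div_nonneg (hρ0 i) hm.le) hr1).trans ?_
      exact div_le_div_of_nonneg_right (hcap α hα i) hm.le
    · rw [abs_of_nonneg (by linarith)]
      have h1 : ∑ i ∈ I, ρ i / m / r * v i = (∑ i ∈ I, ρ i / m * v i) / r := by
        rw [Finset.sum_div]
        exact Finset.sum_congr rfl fun i _ => by ring
      have h2 : ∑ i ∈ I, ρ i / m * v i ≤ r * B := by
        rw [hr, Finset.sum_mul]
        exact Finset.sum_le_sum fun i _ =>
          mul_le_mul_of_nonneg_left (hvB i) (div_nonneg (hρ0 i) hm.le)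
      rw [h1, le_div_iff₀ hr0]
      nlinarith [mul_le_mul_of_nonneg_right h2 (sub_nonneg.2 hr1)]
    · refine mul_le_mul_of_nonneg_left ?_ ha
      have h1 : ∑ i ∈ I, (ρ i / m - 1 / m) ^ 2 = r ^ 2 * ∑ i ∈ I, (ρ i / m / r - 1 / m) ^ 2 +
          2 * r * (r - 1) / m * (∑ i ∈ I, ρ i / m / r - ∑ _i ∈ I, 1 / m) +
          (r - 1) ^ 2 / m * ∑ _i ∈ I, 1 / m := by
        rw [← Finset.sum_sub_distrib, Finset.mul_sum, Finset.mul_sum, Finset.mul_sum,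
          ← Finset.sum_add_distrib, ← Finset.sum_add_distrib]
        refine Finset.sum_congr rfl fun i _ => ?_
        field_simp
        ring
      rw [h1, hws, hsum1]
      have h2 : 0 ≤ ∑ i ∈ I, (ρ i / m / r - 1 / m) ^ 2 := Finset.sum_nonneg fun _ _ => sq_nonneg _
      have h3 : 0 ≤ (r - 1) ^ 2 / m := by positivity
      nlinarith [mul_le_mul_of_nonneg_right (one_le_pow₀ hr1 (n := 2)) h2]
  · have hgain : ∀ w : ℕ → ℝ, (∀ i ∈ I, ρ i / m ≤ w i) →
        ∑ i ∈ I, ρ i / m * v i - B * |r - 1| ≤ ∑ i ∈ I, w i * v i := fun w hw => by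
      have : ∑ i ∈ I, ρ i / m * v i ≤ ∑ i ∈ I, w i * v i :=
        Finset.sum_le_sum fun i hi => mul_le_mul_of_nonneg_right (hw i hi) (hv0 i)
      have := mul_nonneg hB (abs_nonneg (r - 1))
      linarith
    cases obj with
    | cvar α =>
      have hα : 0 < α := h.1
      have hα1 : 1 ≤ 1 / α := (one_le_div hα).2 h.2
      -- Each weight moves the same fraction `t` of the way to its cap. The caps leave total room `1
      -- / α - r`, so this choice restores mass one without exceeding them.
      set t := (1 - r) / (1 / α - r) with ht
      have hd : 0 < 1 / α - r := by linarith
      have ht0 : 0 ≤ t := div_nonneg (by linarith) hd.le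
      have ht1 : t ≤ 1 := (div_le_one hd).2 (by linarith)
      have hle : ∀ i, ρ i / m ≤ 1 / (α * m) := fun i => by
        rw [← div_div]; exact div_le_div_of_nonneg_right (hcap α rfl i) hm.le
      have hge : ∀ i, ρ i / m ≤ ρ i / m + t * (1 / (α * m) - ρ i / m) := fun i =>
        le_add_of_nonneg_right (mul_nonneg ht0 (sub_nonneg.2 (hle i)))
      refine ⟨fun i => ρ i / m + t * (1 / (α * m) - ρ i / m),
        fun i _ => (div_nonneg (hρ0 i) hm.le).trans (hge i), ?_, fun β hβ i _ => ?_,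
        hgain _ fun i _ => hge i, ?_⟩
      · rw [Finset.sum_add_distrib, ← Finset.mul_sum, Finset.sum_sub_distrib, ← hr,
          Finset.sum_const, nsmul_eq_mul]
        change r + t * (m * (1 / (α * m)) - r) = 1
        have : m * (1 / (α * m)) = 1 / α := by field_simp
        rw [this, ht, div_mul_cancel₀ _ hd.ne']
        ring
      · obtain rfl : α = β := by simpa using hβ
        nlinarith [hle i]
      · simp [a, Objective.curvature]
    | chiSqPen lam =>
      -- Spreading the missing mass evenly lowers the sum of squared deviations by `(1 - r) ^ 2 /
      -- m`.
      have hge : ∀ i, ρ i / m ≤ ρ i / m + (1 - r) / m := fun i =>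
        le_add_of_nonneg_right (div_nonneg (by linarith) hm.le)
      have hsum2 : ∑ _i ∈ I, (1 - r) / m = 1 - r := by
        rw [Finset.sum_const, nsmul_eq_mul]; exact mul_div_cancel₀ _ hm.ne'
      refine ⟨fun i => ρ i / m + (1 - r) / m,
        fun i _ => (div_nonneg (hρ0 i) hm.le).trans (hge i), ?_, fun β hβ => by simp at hβ,
        hgain _ fun i _ => hge i, mul_le_mul_of_nonneg_left ?_ ha⟩
      · rw [Finset.sum_add_distrib, ← hr, hsum2]
        ring
      · have h1 : ∑ i ∈ I, (ρ i / m + (1 - r) / m - 1 / m) ^ 2 =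
            ∑ i ∈ I, (ρ i / m - 1 / m) ^ 2 +
              2 * (1 - r) / m * (∑ i ∈ I, ρ i / m - ∑ _i ∈ I, 1 / m) +
              (1 - r) / m * ∑ _i ∈ I, (1 - r) / m := by
          rw [← Finset.sum_sub_distrib, Finset.mul_sum, Finset.mul_sum,
            ← Finset.sum_add_distrib, ← Finset.sum_add_distrib]
          exact Finset.sum_congr rfl fun i _ => by ring
        rw [h1, ← hr, hsum1, hsum2]
        have h2 : 2 * (1 - r) / m * (r - 1) + (1 - r) / m * (1 - r) = -((1 - r) ^ 2 / m) := by ring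
        have h3 : 0 ≤ (1 - r) ^ 2 / m := by positivity
        linarith

end Normalization

/-! ### A population reweighting is nearly achieved on a sample. -/

section LowerBound

variable {obj : Objective} {S : Type*} [MeasurableSpace S] {P₀ : Measure S}
  [IsProbabilityMeasure P₀]

theorem integral_eval {f : S → ℝ} (hf : Measurable f) (i : ℕ) :
    ∫ s : ℕ → S, f (s i) ∂(Measure.infinitePi fun _ : ℕ => P₀) = ∫ z, f z ∂P₀ := by
  have h := measurePreserving_eval_infinitePi (fun _ : ℕ => P₀) i
  have h2 := integral_map (μ := Measure.infinitePi fun _ : ℕ => P₀) h.measurable.aemeasurable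
    (f := f) hf.aestronglyMeasurable
  rw [h.map_eq] at h2
  exact h2.symm

theorem integrable_eval {f : S → ℝ} (hf : Integrable f P₀) (i : ℕ) :
    Integrable (fun s : ℕ → S => f (s i)) (Measure.infinitePi fun _ : ℕ => P₀) :=
  (measurePreserving_eval_infinitePi (fun _ : ℕ => P₀) i).integrable_comp_of_integrable hf

/-- The mean square deviation of an empirical mean. -/
theorem integral_sq_empirical_mean_sub {ρ : S → ℝ} (hρ : Measurable ρ) (hρ2 : MemLp ρ 2 P₀)
    (h1 : ∫ z, ρ z ∂P₀ = 1) {n : ℕ} (hn : 1 ≤ n) :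
    ∫ s : ℕ → S, (∑ i ∈ Finset.range n, ρ (s i) / (n : ℝ) - 1) ^ 2
      ∂(Measure.infinitePi fun _ : ℕ => P₀) = (∫ z, (ρ z - 1) ^ 2 ∂P₀) / (n : ℝ) := by
  have hn' : (n : ℝ) ≠ 0 := by positivity
  set ν := Measure.infinitePi fun _ : ℕ => P₀
  have hmem : ∀ i, MemLp (fun s : ℕ → S => ρ (s i)) 2 ν := fun i =>
    hρ2.comp_measurePreserving (measurePreserving_eval_infinitePi (fun _ : ℕ => P₀) i)
  have hind := iIndepFun_infinitePi (P := fun _ : ℕ => P₀) (X := fun _ => ρ) fun _ => hρ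
  have hvar := IndepFun.variance_sum (X := fun i (s : ℕ → S) => ρ (s i)) (s := Finset.range n)
    (fun i _ => hmem i) fun i _ j _ hij => hind.indepFun hij
  have hi : ∀ i, variance (fun s : ℕ → S => ρ (s i)) ν = ∫ z, (ρ z - 1) ^ 2 ∂P₀ := fun i => by
    rw [variance_eq_integral (hmem i).aestronglyMeasurable.aemeasurable, integral_eval hρ i, h1,
      integral_eval (f := fun z => (ρ z - 1) ^ 2) (by fun_prop) i]
  simp only [hi, Finset.sum_const, Finset.card_range, nsmul_eq_mul] at hvar
  have hmean : ∫ s : ℕ → S, (∑ i ∈ Finset.range n, fun s : ℕ → S => ρ (s i)) s ∂ν = n := by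
    simp only [Finset.sum_apply]
    rw [integral_finsetSum _ fun i _ => (hmem i).integrable one_le_two]
    simp [integral_eval hρ, h1, ν]
  rw [variance_eq_integral (Finset.aemeasurable_sum _
    fun i _ => (hmem i).aestronglyMeasurable.aemeasurable), hmean] at hvar
  have : ∀ s : ℕ → S, (∑ i ∈ Finset.range n, ρ (s i) / n - 1) ^ 2 =
      ((∑ i ∈ Finset.range n, fun s : ℕ → S => ρ (s i)) s - n) ^ 2 / n ^ 2 := fun s => by
    rw [← Finset.sum_div, Finset.sum_apply]
    field_simp
  simp only [this]
  rw [integral_div, hvar]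
  field_simp

/-- A reweighting of the distribution is nearly available on a sample. -/
theorem le_integral_batchLoss (h : obj.IsValid) {Z ρ : S → ℝ} {B K : ℝ} (hZ : Measurable Z)
    (hZ0 : ∀ z, 0 ≤ Z z) (hZB : ∀ z, Z z ≤ B) (hρ : Measurable ρ) (hρ0 : ∀ z, 0 ≤ ρ z)
    (hcap : ∀ α, obj = .cvar α → ∀ z, ρ z ≤ 1 / α) (hρ2 : MemLp ρ 2 P₀)
    (h1 : ∫ z, ρ z ∂P₀ = 1) (hK : 0 < K) (hV : ∫ z, (ρ z - 1) ^ 2 ∂P₀ ≤ K) {n : ℕ}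
    (hn : 1 ≤ n) :
    ∫ z, ρ z * Z z ∂P₀ - obj.curvature 1 / 2 * ∫ z, (ρ z - 1) ^ 2 ∂P₀ - B * √(K / n) ≤
      ∫ s : ℕ → S, batchLoss obj (fun i => Z (s i)) (Finset.range n)
        ∂(Measure.infinitePi fun _ : ℕ => P₀) := by
  set ν := Measure.infinitePi fun _ : ℕ => P₀
  have hn' : (0 : ℝ) < n := by positivity
  have hI : (Finset.range n).Nonempty := ⟨0, by simp; omega⟩
  obtain ⟨z₀⟩ : Nonempty S := nonempty_of_isProbabilityMeasure P₀
  have hB : 0 ≤ B := (hZ0 z₀).trans (hZB z₀)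
  set δ := √(K / n)
  have hδ : 0 < δ := Real.sqrt_pos.2 (by positivity)
  have hδ2 : δ ^ 2 = K / n := Real.sq_sqrt (by positivity)
  have hρi : Integrable ρ P₀ := hρ2.integrable one_le_two
  have hρZ : Integrable (fun z => ρ z * Z z) P₀ := by
    refine (hρi.mul_const B).mono (hρ.mul hZ).aestronglyMeasurable (ae_of_all _ fun z => ?_)
    rw [Real.norm_of_nonneg (mul_nonneg (hρ0 z) (hZ0 z)),
      Real.norm_of_nonneg (mul_nonneg (hρ0 z) hB)]
    exact mul_le_mul_of_nonneg_left (hZB z) (hρ0 z)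
  have hsq : Integrable (fun z => (ρ z - 1) ^ 2) P₀ := (hρ2.sub (memLp_const 1)).integrable_sq
  set Y : (ℕ → S) → ℝ := fun s => ∑ i ∈ Finset.range n, ρ (s i) / n - 1
  have hYm : MemLp Y 2 ν := by
    refine MemLp.sub (memLp_finsetSum _ fun i _ => ?_) (memLp_const 1)
    have := (hρ2.comp_measurePreserving
      (measurePreserving_eval_infinitePi (fun _ : ℕ => P₀) i)).mul_const (n : ℝ)⁻¹
    simpa [div_eq_mul_inv, Function.comp_def] using this
  have hY2 : ∫ s, Y s ^ 2 ∂ν = (∫ z, (ρ z - 1) ^ 2 ∂P₀) / n :=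
    integral_sq_empirical_mean_sub hρ hρ2 h1 hn
  have hlin : Integrable (fun s : ℕ → S => ∑ i ∈ Finset.range n, ρ (s i) / n * Z (s i)) ν :=
    integrable_finsetSum _ fun i _ => by
      have := (integrable_eval hρZ i).div_const (n : ℝ)
      refine this.congr (ae_of_all _ fun s => by ring)
  have hpen : Integrable (fun s : ℕ → S =>
      ∑ i ∈ Finset.range n, (ρ (s i) / n - 1 / n) ^ 2) ν :=
    integrable_finsetSum _ fun i _ => by
      have := (integrable_eval hsq i).div_const ((n : ℝ) ^ 2)
      refine this.congr (ae_of_all _ fun s => by field_simp)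
  have hcurv : obj.curvature n = n * obj.curvature 1 := by
    rw [← Objective.curvature_mul, mul_one]
  have hpt : ∀ s : ℕ → S, (∑ i ∈ Finset.range n, ρ (s i) / n * Z (s i) -
      n * obj.curvature 1 / 2 * ∑ i ∈ Finset.range n, (ρ (s i) / n - 1 / n) ^ 2) -
      (B * (δ / 2) + B / (2 * δ) * Y s ^ 2) ≤
      batchLoss obj (fun i => Z (s i)) (Finset.range n) := fun s => by
    have hb := weightGain_sub_le_batchLoss h hI (v := fun i => Z (s i)) (ρ := fun i => ρ (s i))
      (fun i => hZ0 _) (fun i => hZB _) (fun i => hρ0 _) (fun α hα i => hcap α hα _)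
    simp only [weightGain, Finset.card_range, hcurv] at hb
    refine le_trans (sub_le_sub_left ?_ _) hb
    -- Young's inequality replaces `E |Y| ≤ √(E Y²)`. As `E Y² ≤ δ²`, both terms contribute at most
    -- `δ / 2`.
    have : |Y s| ≤ δ / 2 + Y s ^ 2 / (2 * δ) := by
      rw [div_add_div _ _ two_ne_zero (by positivity), le_div_iff₀ (by positivity), ← sq_abs]
      nlinarith [sq_nonneg (|Y s| - δ)]
    refine (mul_le_mul_of_nonneg_left this hB).trans_eq ?_
    ring
  have hmeasL : Measurable fun s : ℕ → S => batchLoss obj (fun i => Z (s i)) (Finset.range n) :=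
    measurable_batchLoss h (fun i => hZ.comp (measurable_pi_apply i)) _
  have hLint : Integrable (fun s : ℕ → S => batchLoss obj (fun i => Z (s i)) (Finset.range n)) ν :=
    integrable_of_abs_le hmeasL (C := B) (ae_of_all _ fun s => by
      rw [abs_of_nonneg (batchLoss_nonneg h hI fun i => hZ0 _)]
      exact batchLoss_le h hI fun i => hZB _)
  have hint1 : Integrable (fun s : ℕ → S => ∑ i ∈ Finset.range n, ρ (s i) / n * Z (s i) -
      n * obj.curvature 1 / 2 * ∑ i ∈ Finset.range n, (ρ (s i) / n - 1 / n) ^ 2) ν :=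
    hlin.sub (hpen.const_mul (n * obj.curvature 1 / 2))
  have hint2 : Integrable (fun s => B * (δ / 2) + B / (2 * δ) * Y s ^ 2) ν :=
    (integrable_const (B * (δ / 2))).add
    (hYm.integrable_sq.const_mul (B / (2 * δ)))
  have hmono := integral_mono (hint1.sub hint2) hLint hpt
  simp only [Pi.sub_apply] at hmono
  rw [integral_sub hint1 hint2, integral_sub hlin (hpen.const_mul _),
    integral_add (integrable_const _) (hYm.integrable_sq.const_mul _), integral_const_mul,
    integral_const_mul (B / (2 * δ)), hY2] at hmono
  have e1 : ∫ s : ℕ → S, ∑ i ∈ Finset.range n, ρ (s i) / (n : ℝ) * Z (s i) ∂ν =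
      ∫ z, ρ z * Z z ∂P₀ := by
    have : ∀ i, ∫ s : ℕ → S, ρ (s i) / (n : ℝ) * Z (s i) ∂ν = (∫ z, ρ z * Z z ∂P₀) / n := fun i => by
      rw [← integral_eval (f := fun z => ρ z * Z z) (hρ.mul hZ) i, ← integral_div]
      exact integral_congr_ae (ae_of_all _ fun s => by ring)
    rw [integral_finsetSum _ fun i _ => ?_]
    · simp only [this, Finset.sum_const, Finset.card_range, nsmul_eq_mul]
      field_simp
    · exact ((integrable_eval hρZ i).div_const (n : ℝ)).congr (ae_of_all _ fun s => by ring)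
  have e2 : ∫ s : ℕ → S, ∑ i ∈ Finset.range n, (ρ (s i) / (n : ℝ) - 1 / n) ^ 2 ∂ν =
      (∫ z, (ρ z - 1) ^ 2 ∂P₀) / (n : ℝ) := by
    have : ∀ i, ∫ s : ℕ → S, (ρ (s i) / (n : ℝ) - 1 / n) ^ 2 ∂ν =
        (∫ z, (ρ z - 1) ^ 2 ∂P₀) / (n : ℝ) ^ 2 := fun i => by
      rw [← integral_eval (f := fun z => (ρ z - 1) ^ 2) (by fun_prop) i, ← integral_div]
      exact integral_congr_ae (ae_of_all _ fun s => by field_simp)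
    rw [integral_finsetSum _ fun i _ => ?_]
    · simp only [this, Finset.sum_const, Finset.card_range, nsmul_eq_mul]
      field_simp
    · exact ((integrable_eval hsq i).div_const ((n : ℝ) ^ 2)).congr
        (ae_of_all _ fun s => by field_simp)
  rw [e1, e2] at hmono
  simp only [integral_const, probReal_univ, one_smul] at hmono
  refine le_trans ?_ hmono
  have e3 : n * obj.curvature 1 / 2 * ((∫ z, (ρ z - 1) ^ 2 ∂P₀) / n) =
      obj.curvature 1 / 2 * ∫ z, (ρ z - 1) ^ 2 ∂P₀ := by field_simp
  rw [e3]
  have e4 : B / (2 * δ) * ((∫ z, (ρ z - 1) ^ 2 ∂P₀) / n) ≤ B / (2 * δ) * δ ^ 2 := by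
    rw [hδ2]
    gcongr
  have e5 : B / (2 * δ) * δ ^ 2 = B * (δ / 2) := by field_simp
  linarith

end LowerBound

/-! ### The risk compared with the expected robust loss of a sample. -/

variable {obj : Objective} {S : Type*} [MeasurableSpace S] {P₀ : Measure S}
  [IsProbabilityMeasure P₀]

theorem rnDeriv_le_of_le_smul {P Q : Measure S} [SigmaFinite P] {c : ENNReal}
    (hQ : Q ≤ c • P) : ∀ᵐ z ∂P, Q.rnDeriv P z ≤ c := by
  refine ae_le_of_forall_setLIntegral_le_of_sigmaFinite (Q.measurable_rnDeriv P) fun s _ _ => ?_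
  refine (Measure.setLIntegral_rnDeriv_le s).trans ((hQ s).trans_eq ?_)
  simp

/-- Drawing a sample and then one of its points with weights `w` yields a distribution whose
density is bounded by the scaled bound on the weights. -/
theorem exists_reweighted_law {n : ℕ} (hn : 1 ≤ n) {w : ℕ → (ℕ → S) → ℝ} {c : ℝ}
    (hw : ∀ i, Measurable (w i)) (hw0 : ∀ i s, 0 ≤ w i s)
    (hw1 : ∀ s, ∑ i ∈ Finset.range n, w i s = 1)
    (hwc : ∀ i ∈ Finset.range n, ∀ s, w i s ≤ c / n) :
    ∃ Q : Measure S, IsProbabilityMeasure Q ∧ Q ≪ P₀ ∧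
      (∀ᵐ z ∂P₀, Q.rnDeriv P₀ z ≤ ENNReal.ofReal c) ∧
      ∀ f : S → ℝ, Measurable f → ∀ C, (∀ z, |f z| ≤ C) →
        ∫ z, f z ∂Q = ∫ s : ℕ → S, ∑ i ∈ Finset.range n, w i s * f (s i)
          ∂(Measure.infinitePi fun _ : ℕ => P₀) := by
  set ν := Measure.infinitePi fun _ : ℕ => P₀
  have hn' : (0 : ℝ) < n := by positivity
  set R : ℕ → Measure S := fun i =>
    (ν.withDensity fun s => ENNReal.ofReal (w i s)).map fun s => s i with hR
  have hQle : (∑ i ∈ Finset.range n, R i) ≤ ENNReal.ofReal c • P₀ := by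
    have h1 : ∀ i ∈ Finset.range n, R i ≤ ENNReal.ofReal (c / n) • P₀ := by
      intro i hi
      have h2 : (ν.withDensity fun s => ENNReal.ofReal (w i s)) ≤ ENNReal.ofReal (c / n) • ν := by
        rw [← withDensity_const]
        exact withDensity_mono (ae_of_all _ fun s => ENNReal.ofReal_le_ofReal (hwc i hi s))
      refine (Measure.map_mono h2 (measurable_pi_apply i)).trans_eq ?_
      rw [Measure.map_smul]
      congr 1
      exact (measurePreserving_eval_infinitePi (fun _ : ℕ => P₀) i).map_eq
    refine (Finset.sum_le_sum h1).trans_eq ?_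
    rw [Finset.sum_const, Finset.card_range, ← Nat.cast_smul_eq_nsmul ENNReal, smul_smul,
      ← ENNReal.ofReal_natCast, ← ENNReal.ofReal_mul hn'.le, mul_div_cancel₀ _ hn'.ne']
  have hRfin : ∀ i ∈ Finset.range n, ∀ f : S → ℝ, Measurable f → ∀ C, (∀ z, |f z| ≤ C) →
      Integrable f (R i) ∧ ∫ z, f z ∂(R i) = ∫ s, w i s * f (s i) ∂ν := by
    intro i hi f hf C hC
    have hfin : IsFiniteMeasure (ν.withDensity fun s => ENNReal.ofReal (w i s)) := by
      refine isFiniteMeasure_withDensity (ne_of_lt ?_)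
      refine (lintegral_mono fun s => ENNReal.ofReal_le_ofReal (hwc i hi s)).trans_lt ?_
      simp
    refine ⟨integrable_of_abs_le hf (ae_of_all _ hC), ?_⟩
    rw [hR, integral_map (measurable_pi_apply i).aemeasurable hf.aestronglyMeasurable,
      integral_withDensity_eq_integral_toReal_smul (by fun_prop)
        (ae_of_all _ fun _ => ENNReal.ofReal_lt_top)]
    exact integral_congr_ae (ae_of_all _ fun s => by
      simp only [smul_eq_mul, ENNReal.toReal_ofReal (hw0 i s)])
  have hint : ∀ f : S → ℝ, Measurable f → ∀ C, (∀ z, |f z| ≤ C) →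
      ∫ z, f z ∂(∑ i ∈ Finset.range n, R i) =
        ∫ s : ℕ → S, ∑ i ∈ Finset.range n, w i s * f (s i) ∂ν := by
    intro f hf C hC
    rw [integral_finsetSum_measure fun i hi => (hRfin i hi f hf C hC).1,
      Finset.sum_congr rfl fun i hi => (hRfin i hi f hf C hC).2, integral_finsetSum _ fun i hi => ?_]
    refine integrable_of_abs_le ((hw i).mul (hf.comp (measurable_pi_apply i))) (C := c / n * C)
      (ae_of_all _ fun s => ?_)
    rw [abs_mul, abs_of_nonneg (hw0 i s)]
    exact mul_le_mul (hwc i hi s) (hC _) (abs_nonneg _) ((hw0 i s).trans (hwc i hi s))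
  have hfinQ : IsFiniteMeasure (∑ i ∈ Finset.range n, R i) :=
    ⟨(hQle Set.univ).trans_lt (by simp)⟩
  refine ⟨∑ i ∈ Finset.range n, R i, ?_, ?_, rnDeriv_le_of_le_smul hQle, hint⟩
  · have h1 := hint (fun _ => 1) measurable_const 1 (by simp)
    simp only [mul_one, hw1, integral_const, probReal_univ, smul_eq_mul] at h1
    constructor
    rw [Measure.real, ENNReal.toReal_eq_one_iff] at h1
    exact h1
  · exact (Measure.absolutelyContinuous_of_le hQle).trans
      (Measure.smul_absolutelyContinuous)

/-- A density that is linked to sample weights by `∫ f dQ = E ∑ w i f(s i)` has at most their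
divergence from the uniform distribution. -/
theorem integral_sq_rnDeriv_sub_one_le {n : ℕ} (hn : 1 ≤ n) {w : ℕ → (ℕ → S) → ℝ}
    (hw : ∀ i, Measurable (w i)) (hw0 : ∀ i s, 0 ≤ w i s) (hw1 : ∀ i s, w i s ≤ 1)
    {Q : Measure S} [IsProbabilityMeasure Q] (hQ : Q ≪ P₀) {c : ℝ} (hc : 0 ≤ c)
    (hQc : ∀ᵐ z ∂P₀, Q.rnDeriv P₀ z ≤ ENNReal.ofReal c)
    (hint : ∀ f : S → ℝ, Measurable f → ∀ C, (∀ z, |f z| ≤ C) →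
        ∫ z, f z ∂Q = ∫ s : ℕ → S, ∑ i ∈ Finset.range n, w i s * f (s i)
          ∂(Measure.infinitePi fun _ : ℕ => P₀)) :
    Integrable (fun z => ((Q.rnDeriv P₀ z).toReal - 1) ^ 2) P₀ ∧
    ∫ z, ((Q.rnDeriv P₀ z).toReal - 1) ^ 2 ∂P₀ ≤
      (n : ℝ) * ∫ s : ℕ → S, ∑ i ∈ Finset.range n, (w i s - 1 / (n : ℝ)) ^ 2
        ∂(Measure.infinitePi fun _ : ℕ => P₀) := by
  set ν := Measure.infinitePi fun _ : ℕ => P₀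
  have hn' : (0 : ℝ) < n := by positivity
  set r : S → ℝ := fun z => (Q.rnDeriv P₀ z).toReal
  have hrm : Measurable r := (Q.measurable_rnDeriv P₀).ennreal_toReal
  have hr0 : ∀ z, 0 ≤ r z := fun z => ENNReal.toReal_nonneg
  -- The truncation at `c` changes the density only on a null set and makes `f` bounded everywhere,
  -- as the test functions in `hint` must be.
  set f : S → ℝ := fun z => min (r z) c - 1
  have hfm : Measurable f := (hrm.min measurable_const).sub measurable_const
  have hfr : f =ᵐ[P₀] fun z => r z - 1 := by
    filter_upwards [hQc] with z hz
    simp only [f, r]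
    rw [min_eq_left]
    exact ENNReal.toReal_le_of_le_ofReal hc hz
  have hfC : ∀ z, |f z| ≤ c + 1 := fun z => by
    have h1 : 0 ≤ min (r z) c := le_min (hr0 z) hc
    have h2 : min (r z) c ≤ c := min_le_right _ _
    rw [abs_le]
    constructor <;> simp only [f] <;> linarith
  have hfi : Integrable f P₀ := integrable_of_abs_le hfm (ae_of_all _ hfC)
  have hfsq : Integrable (fun z => f z ^ 2) P₀ :=
    integrable_of_abs_le (hfm.pow_const 2) (C := (c + 1) ^ 2) (ae_of_all _ fun z => by
      rw [abs_pow]; exact pow_le_pow_left₀ (abs_nonneg _) (hfC z) 2)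
  have hsqeq : (fun z => f z ^ 2) =ᵐ[P₀] fun z => (r z - 1) ^ 2 := by
    filter_upwards [hfr] with z hz
    rw [hz]
  refine ⟨hfsq.congr hsqeq, ?_⟩
  rw [← integral_congr_ae hsqeq]
  have hrf : Integrable (fun z => r z * f z) P₀ := by
    refine integrable_of_abs_le (hrm.mul hfm) (C := c * (c + 1)) ?_
    filter_upwards [hQc] with z hz
    rw [abs_mul, abs_of_nonneg (hr0 z)]
    exact mul_le_mul (ENNReal.toReal_le_of_le_ofReal hc hz) (hfC z) (abs_nonneg _) hc
  have h1 : ∫ z, f z ^ 2 ∂P₀ = ∫ z, f z ∂Q - ∫ z, f z ∂P₀ := by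
    rw [← integral_toReal_rnDeriv_mul hQ, ← integral_sub hrf hfi]
    refine integral_congr_ae ?_
    filter_upwards [hfr] with z hz
    rw [sq]
    nth_rw 1 [hz]
    ring
  have hei : ∀ i, Integrable (fun s : ℕ → S => f (s i)) ν := fun i => integrable_eval hfi i
  have hwf : ∀ i, Integrable (fun s : ℕ → S => w i s * f (s i)) ν := fun i => by
    refine integrable_of_abs_le ((hw i).mul (hfm.comp (measurable_pi_apply i))) (C := 1 * (c + 1))
      (ae_of_all _ fun s => ?_)
    rw [abs_mul, abs_of_nonneg (hw0 i s)]
    exact mul_le_mul (hw1 i s) (hfC _) (abs_nonneg _) zero_le_one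
  have hwsq : ∀ i, Integrable (fun s : ℕ → S => (w i s - 1 / n) ^ 2) ν := fun i => by
    refine integrable_of_abs_le (((hw i).sub measurable_const).pow_const 2) (C := 1 ^ 2)
      (ae_of_all _ fun s => ?_)
    rw [abs_pow]
    have h2 : (1 : ℝ) / n ≤ 1 := (div_le_one hn').2 (by exact_mod_cast hn)
    have h3 : (0 : ℝ) ≤ 1 / n := by positivity
    refine pow_le_pow_left₀ (abs_nonneg _) (abs_le.2 ⟨?_, ?_⟩) 2
    · linarith [hw0 i s]
    · linarith [hw1 i s]
  have h2 : ∫ z, f z ∂P₀ = ∫ s : ℕ → S, ∑ i ∈ Finset.range n, 1 / (n : ℝ) * f (s i) ∂ν := by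
    rw [integral_finsetSum _ fun i _ => (hei i).const_mul _]
    simp only [integral_const_mul, integral_eval hfm, ν, Finset.sum_const, Finset.card_range,
      nsmul_eq_mul]
    field_simp
  have h3 : ∫ z, f z ^ 2 ∂P₀ = ∫ s : ℕ → S, ∑ i ∈ Finset.range n, 1 / (n : ℝ) * f (s i) ^ 2 ∂ν := by
    rw [integral_finsetSum _ fun i _ => (integrable_eval hfsq i).const_mul _]
    simp only [integral_const_mul, integral_eval (f := fun z => f z ^ 2) (hfm.pow_const 2),
      Finset.sum_const, Finset.card_range, nsmul_eq_mul]
    field_simp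
  have i1 : Integrable (fun s : ℕ → S => ∑ i ∈ Finset.range n, w i s * f (s i)) ν :=
    integrable_finsetSum _ fun i _ => hwf i
  have i2 : Integrable (fun s : ℕ → S => ∑ i ∈ Finset.range n, 1 / (n : ℝ) * f (s i)) ν :=
    integrable_finsetSum _ fun i _ => (hei i).const_mul _
  have i3 : Integrable (fun s : ℕ → S => ∑ i ∈ Finset.range n, (w i s - 1 / n) ^ 2) ν :=
    integrable_finsetSum _ fun i _ => hwsq i
  have i4 : Integrable (fun s : ℕ → S => ∑ i ∈ Finset.range n, 1 / (n : ℝ) * f (s i) ^ 2) ν :=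
    integrable_finsetSum _ fun i _ => (integrable_eval hfsq i).const_mul _
  -- The squared norm of `f` equals the mean of `∑ (w i - 1 / n) * f (s i)`. Young's inequality
  -- leaves half of that norm on the right, to be absorbed on the left.
  have h4 : ∫ z, f z ^ 2 ∂P₀ ≤ n / 2 * ∫ s : ℕ → S, ∑ i ∈ Finset.range n, (w i s - 1 / n) ^ 2 ∂ν +
      1 / 2 * ∫ z, f z ^ 2 ∂P₀ := by
    nth_rw 1 [h1]
    rw [hint f hfm _ hfC, h2, h3, ← integral_sub i1 i2, ← integral_const_mul, ← integral_const_mul,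
      ← integral_add (i3.const_mul _) (i4.const_mul _)]
    refine integral_mono (i1.sub i2) ((i3.const_mul _).add (i4.const_mul _)) fun s => ?_
    simp only [Finset.mul_sum, ← Finset.sum_sub_distrib, ← Finset.sum_add_distrib]
    refine Finset.sum_le_sum fun i _ => ?_
    have h5 : n / 2 * (w i s - 1 / n) ^ 2 + 1 / 2 * (1 / n * f (s i) ^ 2) -
        (w i s * f (s i) - 1 / n * f (s i)) = n / 2 * (w i s - 1 / n - f (s i) / n) ^ 2 := by
      field_simp
      ring
    have h6 : 0 ≤ n / 2 * (w i s - 1 / n - f (s i) / n) ^ 2 := by positivity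
    linarith
  linarith

theorem integral_le_of_le {Z : S → ℝ} {B : ℝ} (hZ : Measurable Z) (hZ0 : ∀ z, 0 ≤ Z z)
    (hZB : ∀ z, Z z ≤ B) (Q : Measure S) [IsProbabilityMeasure Q] : ∫ z, Z z ∂Q ≤ B := by
  have hi : Integrable Z Q := integrable_of_abs_le hZ (C := B) (ae_of_all _ fun z => by
    rw [abs_of_nonneg (hZ0 z)]; exact hZB z)
  refine (integral_mono hi (integrable_const B) hZB).trans_eq ?_
  simp

-- Boundedness is needed because `sSup` of a set that is unbounded above takes a default value in
-- `ℝ`; the same is true of nonemptiness below.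
omit [IsProbabilityMeasure P₀] in
theorem bddAbove_cvar {Z : S → ℝ} {B : ℝ} (hZ : Measurable Z) (hZ0 : ∀ z, 0 ≤ Z z)
    (hZB : ∀ z, Z z ≤ B) (α : ℝ) : B ∈ upperBounds {r : ℝ | ∃ Q : Measure S,
      IsProbabilityMeasure Q ∧ Q ≪ P₀ ∧
      (∀ᵐ s ∂P₀, Q.rnDeriv P₀ s ≤ ENNReal.ofReal (1 / α)) ∧ r = ∫ s, Z s ∂Q} := by
  rintro r ⟨Q, hQ, -, -, rfl⟩
  exact integral_le_of_le hZ hZ0 hZB Q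

omit [IsProbabilityMeasure P₀] in
theorem bddAbove_chiSqPen {Z : S → ℝ} {B lam : ℝ} (hZ : Measurable Z) (hZ0 : ∀ z, 0 ≤ Z z)
    (hZB : ∀ z, Z z ≤ B) (hlam : 0 < lam) : B ∈ upperBounds {r : ℝ | ∃ Q : Measure S,
      IsProbabilityMeasure Q ∧ Q ≪ P₀ ∧
      Integrable (fun s => ((Q.rnDeriv P₀ s).toReal - 1) ^ 2) P₀ ∧
      r = ∫ s, Z s ∂Q - lam * (1 / 2 * ∫ s, ((Q.rnDeriv P₀ s).toReal - 1) ^ 2 ∂P₀)} := by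
  rintro r ⟨Q, hQ, -, -, rfl⟩
  have h1 := integral_le_of_le hZ hZ0 hZB Q
  have h2 : 0 ≤ ∫ s, ((Q.rnDeriv P₀ s).toReal - 1) ^ 2 ∂P₀ := integral_nonneg fun _ => sq_nonneg _
  have h3 : 0 ≤ lam * (1 / 2 * ∫ s, ((Q.rnDeriv P₀ s).toReal - 1) ^ 2 ∂P₀) := by positivity
  linarith

theorem ae_rnDeriv_self_eq_one (P : Measure S) [IsProbabilityMeasure P] :
    ∀ᵐ z ∂P, P.rnDeriv P z = 1 := P.rnDeriv_self

theorem nonempty_cvar (Z : S → ℝ) {α : ℝ} (h : (Objective.cvar α).IsValid) :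
    {r : ℝ | ∃ Q : Measure S, IsProbabilityMeasure Q ∧ Q ≪ P₀ ∧
      (∀ᵐ s ∂P₀, Q.rnDeriv P₀ s ≤ ENNReal.ofReal (1 / α)) ∧ r = ∫ s, Z s ∂Q}.Nonempty := by
  refine ⟨_, P₀, inferInstance, Measure.AbsolutelyContinuous.rfl, ?_, rfl⟩
  filter_upwards [ae_rnDeriv_self_eq_one P₀] with z hz
  rw [hz, ← ENNReal.ofReal_one]
  exact ENNReal.ofReal_le_ofReal ((one_le_div h.1).2 h.2)

theorem nonempty_chiSqPen (Z : S → ℝ) (lam : ℝ) :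
    {r : ℝ | ∃ Q : Measure S, IsProbabilityMeasure Q ∧ Q ≪ P₀ ∧
      Integrable (fun s => ((Q.rnDeriv P₀ s).toReal - 1) ^ 2) P₀ ∧
      r = ∫ s, Z s ∂Q -
        lam * (1 / 2 * ∫ s, ((Q.rnDeriv P₀ s).toReal - 1) ^ 2 ∂P₀)}.Nonempty := by
  refine ⟨_, P₀, inferInstance, Measure.AbsolutelyContinuous.rfl, ?_, rfl⟩
  refine (integrable_const (0 : ℝ)).congr ?_
  filter_upwards [ae_rnDeriv_self_eq_one P₀] with z hz
  simp [hz]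

/-- The expected robust loss of a sample is at most the robust risk. -/
theorem integral_batchLoss_le_risk (h : obj.IsValid) {Z : S → ℝ} {B : ℝ} (hZ : Measurable Z)
    (hZ0 : ∀ z, 0 ≤ Z z) (hZB : ∀ z, Z z ≤ B) {n : ℕ} (hn : 1 ≤ n) :
    ∫ s : ℕ → S, batchLoss obj (fun i => Z (s i)) (Finset.range n)
        ∂(Measure.infinitePi fun _ : ℕ => P₀) ≤ obj.risk P₀ Z := by
  set ν := Measure.infinitePi fun _ : ℕ => P₀
  have hn' : (0 : ℝ) < n := by positivity
  have hI : (Finset.range n).Nonempty := ⟨0, by simp; omega⟩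
  set w : ℕ → (ℕ → S) → ℝ := fun i s => batchWeight obj (fun i => Z (s i)) (Finset.range n) i
  have hw : ∀ i, Measurable (w i) := fun i =>
    measurable_batchWeight h (fun i => hZ.comp (measurable_pi_apply i)) _ i
  have hw0 : ∀ i s, 0 ≤ w i s := fun i s => batchWeight_nonneg h _ _ i
  have hw1 : ∀ i s, w i s ≤ 1 := fun i s => batchWeight_le_one h _ _ i
  have hws : ∀ s, ∑ i ∈ Finset.range n, w i s = 1 := fun s => sum_batchWeight h hI _
  have hZabs : ∀ z, |Z z| ≤ B := fun z => by rw [abs_of_nonneg (hZ0 z)]; exact hZB z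
  cases obj with
  | cvar α =>
    obtain ⟨Q, hQ, hQP, hQr, hQint⟩ := exists_reweighted_law (P₀ := P₀) hn hw hw0 hws (c := 1 / α)
      fun i hi s => by
        rw [div_div]
        simpa using batchWeight_le h (fun i => Z (s i)) _ hi
    refine le_csSup ⟨B, bddAbove_cvar hZ hZ0 hZB α⟩ ⟨Q, hQ, hQP, hQr, ?_⟩
    rw [hQint Z hZ B hZabs]
    simp [batchLoss, weightGain, Objective.curvature, w, ν]
  | chiSqPen lam =>
    have hlam : 0 < lam := h
    -- The weights are at most one, which bounds the density by `n`. This bound only secures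
    -- boundedness and does not enter the estimate of the divergence.
    obtain ⟨Q, hQ, hQP, hQr, hQint⟩ := exists_reweighted_law (P₀ := P₀) hn hw hw0 hws (c := n)
      fun i hi s => by rw [div_self hn'.ne']; exact hw1 i s
    obtain ⟨hsq, hle⟩ := integral_sq_rnDeriv_sub_one_le hn hw hw0 hw1 hQP hn'.le hQr hQint
    refine le_trans ?_ (le_csSup ⟨B, bddAbove_chiSqPen hZ hZ0 hZB hlam⟩
      ⟨Q, hQ, hQP, hsq, rfl⟩)
    rw [hQint Z hZ B hZabs]
    have i1 : Integrable (fun s : ℕ → S => ∑ i ∈ Finset.range n, w i s * Z (s i)) ν :=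
      integrable_finsetSum _ fun i _ => integrable_of_abs_le
        ((hw i).mul (hZ.comp (measurable_pi_apply i))) (C := 1 * B) (ae_of_all _ fun s => by
          rw [abs_mul, abs_of_nonneg (hw0 i s)]
          exact mul_le_mul (hw1 i s) (hZabs _) (abs_nonneg _) zero_le_one)
    have i2 : Integrable (fun s : ℕ → S => ∑ i ∈ Finset.range n, (w i s - 1 / (n : ℝ)) ^ 2) ν :=
      integrable_finsetSum _ fun i _ => integrable_of_abs_le
        (((hw i).sub measurable_const).pow_const 2) (C := 1 ^ 2) (ae_of_all _ fun s => by
          rw [abs_pow]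
          have h2 : (1 : ℝ) / n ≤ 1 := (div_le_one hn').2 (by exact_mod_cast hn)
          have h3 : (0 : ℝ) ≤ 1 / n := by positivity
          refine pow_le_pow_left₀ (abs_nonneg _) (abs_le.2 ⟨?_, ?_⟩) 2
          · linarith [hw0 i s]
          · linarith [hw1 i s])
    have e : ∫ s : ℕ → S, batchLoss (.chiSqPen lam) (fun i => Z (s i)) (Finset.range n) ∂ν =
        ∫ s : ℕ → S, ∑ i ∈ Finset.range n, w i s * Z (s i) ∂ν -
          lam * n / 2 * ∫ s : ℕ → S, ∑ i ∈ Finset.range n, (w i s - 1 / (n : ℝ)) ^ 2 ∂ν := by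
      rw [← integral_const_mul, ← integral_sub i1 (i2.const_mul _)]
      simp [batchLoss, weightGain, Objective.curvature, w]
    rw [e]
    refine sub_le_sub_left ?_ _
    calc lam * (1 / 2 * ∫ s, ((Q.rnDeriv P₀ s).toReal - 1) ^ 2 ∂P₀) ≤
        lam * (1 / 2 * (n * ∫ s : ℕ → S, ∑ i ∈ Finset.range n, (w i s - 1 / (n : ℝ)) ^ 2 ∂ν)) := by
          gcongr
      _ = _ := by ring

/-- The robust risk exceeds the expected robust loss of a sample by little. -/
theorem risk_le_integral_batchLoss (h : obj.IsValid) {Z : S → ℝ} {B : ℝ} (hZ : Measurable Z)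
    (hZ0 : ∀ z, 0 ≤ Z z) (hZB : ∀ z, Z z ≤ B) {n : ℕ} (hn : 1 ≤ n) :
    obj.risk P₀ Z ≤ ∫ s : ℕ → S, batchLoss obj (fun i => Z (s i)) (Finset.range n)
        ∂(Measure.infinitePi fun _ : ℕ => P₀) + B * √(2 * obj.kappa B / n) := by
  obtain ⟨z₀⟩ : Nonempty S := nonempty_of_isProbabilityMeasure P₀
  have hB : 0 ≤ B := (hZ0 z₀).trans (hZB z₀)
  have hκ : 0 < obj.kappa B := one_pos.trans_le (Objective.one_le_kappa h hB)
  have hI : (Finset.range n).Nonempty := ⟨0, by simp; omega⟩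
  cases obj with
  | cvar α =>
    have hα : 0 < α := h.1
    refine csSup_le (nonempty_cvar Z h) ?_
    rintro _ ⟨Q, hQ, hQP, hQr, rfl⟩
    -- The truncation makes the cap hold everywhere instead of almost everywhere, since it is needed
    -- at every sample point.
    set ρ : S → ℝ := fun z => min (Q.rnDeriv P₀ z).toReal (1 / α)
    have hρm : Measurable ρ := (Q.measurable_rnDeriv P₀).ennreal_toReal.min measurable_const
    have hρ0 : ∀ z, 0 ≤ ρ z := fun z => le_min ENNReal.toReal_nonneg (by positivity)
    have hρc : ∀ z, ρ z ≤ 1 / α := fun z => min_le_right _ _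
    have hρe : ρ =ᵐ[P₀] fun z => (Q.rnDeriv P₀ z).toReal := by
      filter_upwards [hQr] with z hz
      exact min_eq_left (ENNReal.toReal_le_of_le_ofReal (by positivity) hz)
    have hρ2 : MemLp ρ 2 P₀ := MemLp.of_bound hρm.aestronglyMeasurable (1 / α)
      (ae_of_all _ fun z => by rw [Real.norm_of_nonneg (hρ0 z)]; exact hρc z)
    have hρ1 : ∫ z, ρ z ∂P₀ = 1 := by
      rw [integral_congr_ae hρe, Measure.integral_toReal_rnDeriv hQP]
      simp
    have hρi := hρ2.integrable one_le_two
    -- From `ρ² ≤ ρ / α` the integral is at most `1 / α + 1`, and `1 ≤ 1 / α`.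
    have hV : ∫ z, (ρ z - 1) ^ 2 ∂P₀ ≤ 2 * α⁻¹ := by
      have h1 : ∫ z, (ρ z - 1) ^ 2 ∂P₀ ≤ ∫ z, (1 / α * ρ z + 1) ∂P₀ := by
        refine integral_mono (hρ2.sub (memLp_const 1)).integrable_sq
          ((hρi.const_mul _).add (integrable_const 1)) fun z => ?_
        dsimp only
        nlinarith [hρ0 z, mul_le_mul_of_nonneg_right (hρc z) (hρ0 z)]
      rw [integral_add (hρi.const_mul _) (integrable_const 1), integral_const_mul, hρ1] at h1
      simp only [mul_one, integral_const, probReal_univ, smul_eq_mul] at h1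
      have h2 : 1 ≤ α⁻¹ := (one_le_inv₀ hα).2 h.2
      rw [one_div] at h1
      linarith
    have hmain := le_integral_batchLoss (P₀ := P₀) h hZ hZ0 hZB hρm hρ0
      (fun β hβ z => by obtain rfl : α = β := by simpa using hβ
                        exact hρc z) hρ2 hρ1 (by positivity) hV hn
    have e : ∫ z, ρ z * Z z ∂P₀ = ∫ z, Z z ∂Q := by
      rw [← integral_toReal_rnDeriv_mul hQP]
      refine integral_congr_ae ?_
      filter_upwards [hρe] with z hz
      rw [hz]
    rw [e] at hmain
    simp only [Objective.curvature, Objective.kappa, zero_div, zero_mul, sub_zero] at hmain ⊢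
    linarith
  | chiSqPen lam =>
    have hlam : 0 < lam := h
    refine csSup_le (nonempty_chiSqPen Z lam) ?_
    rintro _ ⟨Q, hQ, hQP, hQr, rfl⟩
    set ρ : S → ℝ := fun z => (Q.rnDeriv P₀ z).toReal
    change ∫ z, Z z ∂Q - lam * (1 / 2 * ∫ z, (ρ z - 1) ^ 2 ∂P₀) ≤ _
    have hρm : Measurable ρ := (Q.measurable_rnDeriv P₀).ennreal_toReal
    have hρ2 : MemLp ρ 2 P₀ := by
      have h1 : MemLp (fun z => ρ z - 1) 2 P₀ :=
        (memLp_two_iff_integrable_sq (hρm.sub measurable_const).aestronglyMeasurable).2 hQr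
      have h2 := h1.add (memLp_const (1 : ℝ))
      refine h2.ae_eq (ae_of_all _ fun z => ?_)
      simp
    have hρ1 : ∫ z, ρ z ∂P₀ = 1 := by
      rw [Measure.integral_toReal_rnDeriv hQP]
      simp
    -- A competitor of negative value loses against the nonnegative sample loss. For any other the
    -- penalty is at most `B`, which bounds the divergence integral by `2 * (B / lam)`.
    by_cases hneg : ∫ z, Z z ∂Q - lam * (1 / 2 * ∫ z, (ρ z - 1) ^ 2 ∂P₀) < 0
    · refine hneg.le.trans (add_nonneg (integral_nonneg fun s => ?_) (by positivity))
      exact batchLoss_nonneg h hI fun i => hZ0 _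
    push Not at hneg
    have hV : ∫ z, (ρ z - 1) ^ 2 ∂P₀ ≤ 2 * (1 + B / lam) := by
      have h1 := integral_le_of_le hZ hZ0 hZB Q
      have h2 : ∫ z, (ρ z - 1) ^ 2 ∂P₀ ≤ 2 * (B / lam) := by
        rw [← mul_div_assoc, le_div_iff₀ hlam]
        linarith
      linarith
    have hmain := le_integral_batchLoss (P₀ := P₀) h hZ hZ0 hZB hρm
      (fun _ => ENNReal.toReal_nonneg) (fun β hβ => by simp at hβ) hρ2 hρ1 (by positivity) hV hn
    rw [integral_toReal_rnDeriv_mul hQP] at hmain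
    simp only [Objective.curvature, Objective.kappa, mul_one] at hmain ⊢
    linarith

/-! ### The projection and one step of the gradient method. -/

section Projection

variable {E : Type*} [NormedAddCommGroup E] [InnerProductSpace ℝ E] [CompleteSpace E] {X : Set E}

theorem proj_spec (hne : X.Nonempty) (hcl : IsClosed X) (hconv : Convex ℝ X) (y : E) :
    proj X y ∈ X ∧ ∀ z ∈ X, ‖y - proj X y‖ ≤ ‖y - z‖ := by
  refine Classical.epsilon_spec (p := fun z => z ∈ X ∧ ∀ z' ∈ X, ‖y - z‖ ≤ ‖y - z'‖) ?_
  obtain ⟨p, hp, hmin⟩ := exists_norm_eq_iInf_of_complete_convex hne hcl.isComplete hconv y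
  refine ⟨p, hp, fun z hz => ?_⟩
  rw [hmin]
  exact ciInf_le ⟨0, by rintro _ ⟨z, rfl⟩; exact norm_nonneg _⟩ (⟨z, hz⟩ : X)

theorem proj_mem (hne : X.Nonempty) (hcl : IsClosed X) (hconv : Convex ℝ X) (y : E) :
    proj X y ∈ X := (proj_spec hne hcl hconv y).1

theorem inner_sub_proj_le (hne : X.Nonempty) (hcl : IsClosed X) (hconv : Convex ℝ X) (y : E)
    {z : E} (hz : z ∈ X) : inner ℝ (y - proj X y) (z - proj X y) ≤ 0 := by
  obtain ⟨h1, h2⟩ := proj_spec hne hcl hconv y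
  have : Nonempty X := hne.to_subtype
  refine (norm_eq_iInf_iff_real_inner_le_zero hconv h1).1 (le_antisymm ?_ ?_) z hz
  · exact le_ciInf fun w => h2 w w.2
  · exact ciInf_le ⟨0, by rintro _ ⟨z, rfl⟩; exact norm_nonneg _⟩ (⟨_, h1⟩ : X)

theorem norm_sq_proj_sub_le (hne : X.Nonempty) (hcl : IsClosed X) (hconv : Convex ℝ X) (y : E)
    {z : E} (hz : z ∈ X) : ‖proj X y - z‖ ^ 2 ≤ ‖y - z‖ ^ 2 := by
  have h1 := inner_sub_proj_le hne hcl hconv y hz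
  have h2 : y - z = (y - proj X y) - (z - proj X y) := by abel
  rw [h2, norm_sub_sq_real (y - proj X y), norm_sub_rev (proj X y)]
  nlinarith [sq_nonneg ‖y - proj X y‖]

/-- The projection is nonexpansive; its continuity makes the iterates measurable functions of the
draws. -/
theorem continuous_proj (hne : X.Nonempty) (hcl : IsClosed X) (hconv : Convex ℝ X) :
    Continuous (proj X) := by
  refine (LipschitzWith.of_dist_le_mul (K := 1) fun y z => ?_).continuous
  rw [dist_eq_norm, dist_eq_norm, NNReal.coe_one, one_mul]
  have h1 := inner_sub_proj_le hne hcl hconv y (proj_mem hne hcl hconv z)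
  have h2 := inner_sub_proj_le hne hcl hconv z (proj_mem hne hcl hconv y)
  set p := proj X y
  set q := proj X z
  have h3 : ‖p - q‖ ^ 2 ≤ inner ℝ (y - z) (p - q) := by
    have e1 : inner ℝ (y - p) (q - p) = -inner ℝ (y - p) (p - q) := by
      rw [← inner_neg_right, neg_sub]
    have e2 : inner ℝ (y - z) (p - q) =
        inner ℝ (y - p) (p - q) + inner ℝ (p - q) (p - q) - inner ℝ (z - q) (p - q) := by
      rw [← inner_add_left, ← inner_sub_left]
      congr 1
      abel
    rw [e2, real_inner_self_eq_norm_sq]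
    linarith
  have h4 := h3.trans (real_inner_le_norm _ _)
  by_contra! hlt
  nlinarith [norm_nonneg (y - z), norm_nonneg (p - q)]

end Projection

section Iterates

variable {D E : Type*} [NormedAddCommGroup E] [InnerProductSpace ℝ E] [CompleteSpace E]
  {X : Set E} {η : ℝ} {est : D → E → E} {x₀ : E}

theorem sgm_mem (hcl : IsClosed X) (hconv : Convex ℝ X) (hx₀ : x₀ ∈ X) (w : ℕ → D) (t : ℕ) :
    sgm X η est x₀ w t ∈ X := by
  cases t with
  | zero => exact hx₀
  | succ t => exact proj_mem ⟨x₀, hx₀⟩ hcl hconv _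

omit [CompleteSpace E] in
-- The iterate `t` sees only the draws before `t`; this is the hypothesis under which the draw `t`
-- is fresh.
theorem sgm_congr {w w' : ℕ → D} {t : ℕ} (h : ∀ i < t, w i = w' i) :
    sgm X η est x₀ w t = sgm X η est x₀ w' t := by
  induction t with
  | zero => rfl
  | succ t ih => simp only [sgm, ih fun i hi => h i (by omega), h t (by omega)]

theorem sgmAverage_mem (hcl : IsClosed X) (hconv : Convex ℝ X) (hx₀ : x₀ ∈ X) (w : ℕ → D)
    {T : ℕ} (hT : 1 ≤ T) : sgmAverage X η est x₀ w T ∈ X := by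
  have hT' : (T : ℝ) ≠ 0 := by positivity
  unfold sgmAverage
  rw [Finset.smul_sum]
  refine hconv.sum_mem (fun _ _ => by positivity) ?_ fun t _ => sgm_mem hcl hconv hx₀ w t
  simp [hT']

/-- One step of the method. -/
theorem norm_sq_sgm_succ_sub_le (hcl : IsClosed X) (hconv : Convex ℝ X) (hx₀ : x₀ ∈ X)
    (w : ℕ → D) (t : ℕ) {y : E} (hy : y ∈ X) :
    ‖sgm X η est x₀ w (t + 1) - y‖ ^ 2 ≤ ‖sgm X η est x₀ w t - y‖ ^ 2 -
      2 * η * inner ℝ (est (w t) (sgm X η est x₀ w t)) (sgm X η est x₀ w t - y) +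
      η ^ 2 * ‖est (w t) (sgm X η est x₀ w t)‖ ^ 2 := by
  refine (norm_sq_proj_sub_le ⟨x₀, hx₀⟩ hcl hconv _ hy).trans_eq ?_
  set x := sgm X η est x₀ w t
  have : x - η • est (w t) x - y = (x - y) - η • est (w t) x := by abel
  rw [this, norm_sub_sq_real, inner_smul_right, norm_smul, mul_pow, Real.norm_eq_abs, sq_abs,
    real_inner_comm]
  ring

end Iterates

/-! ### Independence of the current draw from the history. -/

section Fresh

variable {D : Type*} [MeasurableSpace D] (L : Measure D) [IsProbabilityMeasure L]

/-- The draw of step `t` is independent of what happened before: an average over a history and the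
current draw is an iterated average, if the quantity depends only on the history before `t`. -/
theorem integral_fresh {ψ : (ℕ → D) × D → ℝ} (hψ : Measurable ψ) {C : ℝ}
    (hC : ∀ᵐ d ∂L, ∀ w, |ψ (w, d)| ≤ C) {t : ℕ}
    (hdep : ∀ w w' d, (∀ i < t, w i = w' i) → ψ (w, d) = ψ (w', d)) :
    ∫ w, ψ (w, w t) ∂(Measure.infinitePi fun _ : ℕ => L) =
      ∫ w, ∫ d, ψ (w, d) ∂L ∂(Measure.infinitePi fun _ : ℕ => L) := by
  set M := Measure.infinitePi fun _ : ℕ => L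
  obtain ⟨d₀⟩ : Nonempty D := nonempty_of_isProbabilityMeasure L
  -- Overwriting the draws from time `t` on by a fixed `d₀` does not change `ψ`, and exhibits the
  -- history as a function of the first `t` draws, hence independent of draw `t`.
  let ext : (Finset.range t → D) → ℕ → D := fun u i => if h : i ∈ Finset.range t then u ⟨i, h⟩ else d₀
  have hext : Measurable ext := measurable_pi_lambda _ fun i => by
    by_cases h : i ∈ Finset.range t
    · simpa only [ext, h, dif_pos] using measurable_pi_apply _
    · simpa only [ext, h, dif_neg, not_false_eq_true] using measurable_const
  let past : (ℕ → D) → ℕ → D := fun w => ext fun i => w i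
  have hpast : Measurable past := hext.comp
    (measurable_pi_lambda (fun (w : ℕ → D) (i : Finset.range t) => w i) fun i => measurable_pi_apply _)
  have hpe : ∀ w d, ψ (past w, d) = ψ (w, d) := fun w d => hdep _ _ _ fun i hi => by
    simp [past, ext, hi]
  have hind : IndepFun past (fun w => w t) M := by
    have h1 := (iIndepFun_infinitePi (P := fun _ : ℕ => L) (X := fun _ d => d)
      fun _ => measurable_id).indepFun_finset (Finset.range t) {t} (by simp)
      fun i => measurable_pi_apply i
    exact h1.comp hext (measurable_pi_apply (⟨t, by simp⟩ : ({t} : Finset ℕ)))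
  have hmap : M.map (fun w => (past w, w t)) = (M.map past).prod L := by
    rw [(indepFun_iff_map_prod_eq_prod_map_map hpast.aemeasurable
      (measurable_pi_apply t).aemeasurable).1 hind]
    congr 1
    exact (measurePreserving_eval_infinitePi (fun _ : ℕ => L) t).map_eq
  have hprob : IsProbabilityMeasure (M.map past) := Measure.isProbabilityMeasure_map hpast.aemeasurable
  have hint : Integrable ψ ((M.map past).prod L) := by
    refine integrable_of_abs_le hψ (C := C) ?_
    filter_upwards [Measure.quasiMeasurePreserving_snd.ae hC] with p hp
    exact hp p.1
  calc ∫ w, ψ (w, w t) ∂M = ∫ w, ψ (past w, w t) ∂M := by simp only [hpe]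
    _ = ∫ p, ψ p ∂(M.map (fun w => (past w, w t))) :=
        (integral_map (hpast.prodMk (measurable_pi_apply t)).aemeasurable
          hψ.aestronglyMeasurable).symm
    _ = ∫ w, ∫ d, ψ (w, d) ∂L ∂(M.map past) := by rw [hmap, integral_prod _ hint]
    _ = ∫ w, ∫ d, ψ (past w, d) ∂L ∂M :=
        integral_map hpast.aemeasurable
          (hψ.stronglyMeasurable.integral_prod_right').aestronglyMeasurable
    _ = _ := by simp only [hpe]

end Fresh

/-! ### Convergence of the method in expected risk. -/

namespace IsLossModel

variable {obj : Objective} {E S Ω : Type*} [NormedAddCommGroup E] [InnerProductSpace ℝ E]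
  [MeasurableSpace E] [MeasurableSpace S] [MeasurableSpace Ω] {X : Set E} {G B : ℝ}
  {l : E → S → ℝ} {g : E → S → E} (hl : IsLossModel X G B l g) (P₀ : Measure S)
  [IsProbabilityMeasure P₀]
include hl

variable [BorelSpace E] [SecondCountableTopology E]

theorem surrogate_nonneg (h : obj.IsValid) {n : ℕ} (hn : 1 ≤ n) {x : E} (hx : x ∈ X) :
    0 ≤ surrogate obj P₀ l n x :=
  integral_nonneg fun s => batchLoss_nonneg h ⟨0, by simp; omega⟩ fun i => hl.nonneg x hx _

theorem abs_surrogate_le (h : obj.IsValid) {n : ℕ} (hn : 1 ≤ n) {x : E} (hx : x ∈ X) :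
    |surrogate obj P₀ l n x| ≤ B := by
  have hI : (Finset.range n).Nonempty := ⟨0, by simp; omega⟩
  rw [abs_of_nonneg (hl.surrogate_nonneg P₀ h hn hx)]
  refine (integral_mono (hl.integrable_batchLoss P₀ h hx hI) (integrable_const B)
    fun s => batchLoss_le h hI fun i => hl.le x hx _).trans_eq ?_
  simp

theorem measurable_surrogate_comp (h : obj.IsValid) (n : ℕ) {a : Ω → E} (ha : Measurable a)
    (haX : ∀ ω, a ω ∈ X) : Measurable fun ω => surrogate obj P₀ l n (a ω) := by
  have h1 : Measurable fun p : Ω × (ℕ → S) =>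
      batchLoss obj (fun i => l (a p.1) (p.2 i)) (Finset.range n) :=
    measurable_batchLoss h (fun i => hl.measurable_loss_comp (ha.comp measurable_fst)
      (fun p => haX p.1) ((measurable_pi_apply i).comp measurable_snd)) _
  exact (h1.stronglyMeasurable.integral_prod_right'
    (ν := Measure.infinitePi fun _ : ℕ => P₀)).measurable

theorem surrogate_le_risk (h : obj.IsValid) {n : ℕ} (hn : 1 ≤ n) {x : E} (hx : x ∈ X) :
    surrogate obj P₀ l n x ≤ obj.risk P₀ (l x) :=
  integral_batchLoss_le_risk h (hl.measurable_loss x hx) (hl.nonneg x hx) (hl.le x hx) hn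

theorem risk_le_surrogate_add (h : obj.IsValid) {n : ℕ} (hn : 1 ≤ n) {x : E} (hx : x ∈ X) :
    obj.risk P₀ (l x) ≤ surrogate obj P₀ l n x + B * √(2 * obj.kappa B / n) :=
  risk_le_integral_batchLoss h (hl.measurable_loss x hx) (hl.nonneg x hx) (hl.le x hx) hn

/-- The robust risk is measurable, being the limit of the surrogates. -/
theorem measurable_risk_comp (h : obj.IsValid) {a : Ω → E} (ha : Measurable a)
    (haX : ∀ ω, a ω ∈ X) : Measurable fun ω => obj.risk P₀ (l (a ω)) := by
  refine measurable_of_tendsto_metrizable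
    (fun n => hl.measurable_surrogate_comp P₀ (obj := obj) h (n + 1) ha haX)
    (tendsto_pi_nhds.2 fun ω => ?_)
  have hlim : Filter.Tendsto (fun n : ℕ => obj.risk P₀ (l (a ω)) -
      B * √(2 * obj.kappa B / ((n + 1 : ℕ) : ℝ))) Filter.atTop
      (nhds (obj.risk P₀ (l (a ω)) - B * √0)) := by
    refine (Filter.Tendsto.const_mul _ (Filter.Tendsto.sqrt ?_)).const_sub _
    exact (tendsto_const_div_atTop_nhds_zero_nat _).comp (Filter.tendsto_add_atTop_nat 1)
  rw [Real.sqrt_zero, mul_zero, sub_zero] at hlim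
  refine tendsto_of_tendsto_of_tendsto_of_le_of_le hlim tendsto_const_nhds (fun n => ?_)
    fun n => hl.surrogate_le_risk P₀ h (by omega) (haX ω)
  have := hl.risk_le_surrogate_add P₀ h (n := n + 1) (by omega) (haX ω)
  dsimp only
  linarith

variable [CompleteSpace E] {η : ℝ} {x₀ : E} {jmax n₀ : ℕ}

theorem measurable_sgm (h : obj.IsValid) (hx₀ : x₀ ∈ X) {W : Ω → ℕ → ℕ × (ℕ → S)}
    (hW : Measurable W) (t : ℕ) :
    Measurable fun ω => sgm X η (mlmcGrad obj l g jmax n₀) x₀ (W ω) t := by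
  induction t with
  | zero => exact measurable_const
  | succ t ih =>
    have hg := hl.measurable_mlmcGrad_comp h ih
      (fun ω => sgm_mem hl.isClosed hl.convex hx₀ (W ω) t) ((measurable_pi_apply t).comp hW)
      jmax n₀
    exact (continuous_proj ⟨x₀, hx₀⟩ hl.isClosed hl.convex).measurable.comp
      (ih.sub (hg.const_smul η))

theorem measurable_sgmAverage (h : obj.IsValid) (hx₀ : x₀ ∈ X) (T : ℕ) :
    Measurable fun w : ℕ → ℕ × (ℕ → S) =>
      sgmAverage X η (mlmcGrad obj l g jmax n₀) x₀ w T := by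
  have h1 : ∀ t, Measurable fun w : ℕ → ℕ × (ℕ → S) =>
      sgm X η (mlmcGrad obj l g jmax n₀) x₀ w t := fun t =>
    hl.measurable_sgm h hx₀ (W := fun w => w) measurable_id t
  have h2 : Measurable fun w : ℕ → ℕ × (ℕ → S) =>
      ∑ t ∈ Finset.Icc 1 T, sgm X η (mlmcGrad obj l g jmax n₀) x₀ w t :=
    Finset.measurable_fun_sum _ fun t _ => h1 t
  exact h2.const_smul (1 / (T : ℝ))

set_option maxHeartbeats 800000 in
/-- The expected progress of one step. -/
theorem integral_norm_sq_sgm_succ_sub_le (h : obj.IsValid) (hG : 0 ≤ G) (hB : 0 ≤ B)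
    (hj : 1 ≤ jmax) (hn₀ : 1 ≤ n₀) (hη : 0 ≤ η) {R : ℝ}
    (hR : ∀ x ∈ X, ∀ y ∈ X, ‖x - y‖ ≤ R) (hx₀ : x₀ ∈ X) {y : E} (hy : y ∈ X) (t : ℕ) :
    2 * η * (∫ w, surrogate obj P₀ l (2 ^ jmax * n₀)
        (sgm X η (mlmcGrad obj l g jmax n₀) x₀ w t)
          ∂(Measure.infinitePi fun _ : ℕ => drawLaw jmax P₀) -
        surrogate obj P₀ l (2 ^ jmax * n₀) y) ≤
      ∫ w, ‖sgm X η (mlmcGrad obj l g jmax n₀) x₀ w t - y‖ ^ 2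
          ∂(Measure.infinitePi fun _ : ℕ => drawLaw jmax P₀) -
        ∫ w, ‖sgm X η (mlmcGrad obj l g jmax n₀) x₀ w (t + 1) - y‖ ^ 2
          ∂(Measure.infinitePi fun _ : ℕ => drawLaw jmax P₀) +
        η ^ 2 * (2 * G ^ 2 + 4 * G ^ 2 * obj.spread B * jmax / n₀) := by
  have hLprob := isProbabilityMeasure_drawLaw P₀ hj
  set L := drawLaw jmax P₀
  set M := Measure.infinitePi fun _ : ℕ => L
  set est := mlmcGrad obj l g jmax n₀
  set x : (ℕ → ℕ × (ℕ → S)) → ℕ → E := fun w t => sgm X η est x₀ w t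
  set n := 2 ^ jmax * n₀
  set C := G + 2 ^ jmax * (2 * G)
  set V := 2 * G ^ 2 + 4 * G ^ 2 * obj.spread B * jmax / n₀
  have hn : 1 ≤ n := Nat.one_le_iff_ne_zero.2 (by positivity)
  have hxX : ∀ w t, x w t ∈ X := fun w t => sgm_mem hl.isClosed hl.convex hx₀ w t
  have hxm : ∀ t, Measurable fun w => x w t := fun t =>
    hl.measurable_sgm h hx₀ (W := fun w => w) measurable_id t
  have hR0 : 0 ≤ R := (norm_nonneg _).trans (hR y hy y hy)
  have hdm : Measurable fun p : (ℕ → ℕ × (ℕ → S)) × (ℕ × (ℕ → S)) => est p.2 (x p.1 t) :=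
    hl.measurable_mlmcGrad_comp h ((hxm t).comp measurable_fst) (fun p => hxX p.1 t)
      measurable_snd jmax n₀
  have hLae : ∀ᵐ d ∂L, ∀ w, ‖est d (x w t)‖ ≤ C := by
    filter_upwards [ae_mem_Icc_drawLaw P₀ jmax] with d hd w
    exact hl.norm_mlmcGrad_le h hG (hxX w t) hn₀ hd
  have hMae : ∀ᵐ w ∂M, ‖est (w t) (x w t)‖ ≤ C := by
    filter_upwards [(measurePreserving_eval_infinitePi (fun _ : ℕ => L)
      t).quasiMeasurePreserving.ae hLae] with w hw
    exact hw w
  have hdep : ∀ w w' : ℕ → ℕ × (ℕ → S), (∀ i < t, w i = w' i) → x w t = x w' t :=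
    fun w w' hww => sgm_congr hww
  -- the inner product term
  have hinner : ∫ w, inner ℝ (est (w t) (x w t)) (x w t - y) ∂M =
      ∫ w, ∫ d, inner ℝ (est d (x w t)) (x w t - y) ∂L ∂M := by
    refine integral_fresh L
      (ψ := fun p => inner ℝ (est p.2 (x p.1 t)) (x p.1 t - y))
      (hdm.inner (((hxm t).comp measurable_fst).sub_const y)) (C := C * R) ?_ ?_
    · filter_upwards [hLae] with d hd w
      exact (abs_real_inner_le_norm _ _).trans
        (mul_le_mul (hd w) (hR _ (hxX w t) y hy) (norm_nonneg _) ((norm_nonneg _).trans (hd w)))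
    · intro w w' d hww
      simp only [hdep w w' hww]
  have hsq : ∫ w, ‖est (w t) (x w t)‖ ^ 2 ∂M = ∫ w, ∫ d, ‖est d (x w t)‖ ^ 2 ∂L ∂M := by
    refine integral_fresh L (ψ := fun p => ‖est p.2 (x p.1 t)‖ ^ 2)
      (hdm.norm.pow_const 2) (C := C ^ 2) ?_ ?_
    · filter_upwards [hLae] with d hd w
      rw [abs_pow, abs_norm]
      exact pow_le_pow_left₀ (norm_nonneg _) (hd w) 2
    · intro w w' d hww
      simp only [hdep w w' hww]
  have hsurr : Integrable (fun w => surrogate obj P₀ l n (x w t)) M :=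
    integrable_of_abs_le (hl.measurable_surrogate_comp P₀ h n (hxm t) fun w => hxX w t)
      (ae_of_all _ fun w => hl.abs_surrogate_le P₀ h hn (hxX w t))
  have hinner2 : ∫ w, surrogate obj P₀ l n (x w t) ∂M - surrogate obj P₀ l n y ≤
      ∫ w, inner ℝ (est (w t) (x w t)) (x w t - y) ∂M := by
    rw [hinner]
    have : ∫ w, (surrogate obj P₀ l n (x w t) - surrogate obj P₀ l n y) ∂M =
        ∫ w, surrogate obj P₀ l n (x w t) ∂M - surrogate obj P₀ l n y := by
      rw [integral_sub hsurr (integrable_const _)]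
      simp
    rw [← this]
    refine integral_mono (hsurr.sub (integrable_const _)) ?_
      fun w => hl.surrogate_sub_le P₀ h hG (hxX w t) hy hj hn₀
    have hm : Measurable fun w => ∫ d, inner ℝ (est d (x w t)) (x w t - y) ∂L :=
      ((hdm.inner (((hxm t).comp measurable_fst).sub_const
        y)).stronglyMeasurable.integral_prod_right' (ν := L)).measurable
    refine integrable_of_abs_le hm (C := C * R) (ae_of_all _ fun w => ?_)
    rw [← Real.norm_eq_abs]
    refine (norm_integral_le_of_norm_le_const (C := C * R) ?_).trans_eq (by simp)
    filter_upwards [hLae] with d hd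
    exact (abs_real_inner_le_norm _ _).trans
      (mul_le_mul (hd w) (hR _ (hxX w t) y hy) (norm_nonneg _) ((norm_nonneg _).trans (hd w)))
  have hsq2 : ∫ w, ‖est (w t) (x w t)‖ ^ 2 ∂M ≤ V := by
    rw [hsq]
    refine (integral_mono_of_nonneg
      (ae_of_all _ fun w => integral_nonneg fun d => sq_nonneg _) (integrable_const V)
      (ae_of_all _ fun w => hl.integral_norm_sq_mlmcGrad_le P₀ h hG hB (hxX w t) hj hn₀)).trans_eq ?_
    simp
  have hem : Measurable fun w : ℕ → ℕ × (ℕ → S) => est (w t) (x w t) :=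
    hdm.comp (measurable_id.prodMk (measurable_pi_apply t))
  have hdist : ∀ t, Integrable (fun w => ‖x w t - y‖ ^ 2) M := fun t =>
    integrable_of_abs_le (((hxm t).sub_const y).norm.pow_const 2) (C := R ^ 2)
      (ae_of_all _ fun w => by
        rw [abs_pow, abs_norm]
        exact pow_le_pow_left₀ (norm_nonneg _) (hR _ (hxX w t) y hy) 2)
  have hi1 : Integrable (fun w => inner ℝ (est (w t) (x w t)) (x w t - y)) M := by
    refine integrable_of_abs_le (hem.inner ((hxm t).sub_const y)) (C := C * R) ?_
    filter_upwards [hMae] with w hw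
    exact (abs_real_inner_le_norm _ _).trans
      (mul_le_mul hw (hR _ (hxX w t) y hy) (norm_nonneg _) ((norm_nonneg _).trans hw))
  have hi2 : Integrable (fun w => ‖est (w t) (x w t)‖ ^ 2) M := by
    refine integrable_of_abs_le (hem.norm.pow_const 2) (C := C ^ 2) ?_
    filter_upwards [hMae] with w hw
    rw [abs_pow, abs_norm]
    exact pow_le_pow_left₀ (norm_nonneg _) hw 2
  have hi3 : Integrable (fun w => ‖x w t - y‖ ^ 2 -
      2 * η * inner ℝ (est (w t) (x w t)) (x w t - y)) M := (hdist t).sub (hi1.const_mul _)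
  have hstep := integral_mono (hdist (t + 1)) (hi3.add (hi2.const_mul (η ^ 2)))
    fun w => norm_sq_sgm_succ_sub_le hl.isClosed hl.convex hx₀ w t hy
  simp only [Pi.add_apply] at hstep
  rw [integral_add hi3 (hi2.const_mul _), integral_sub (hdist t) (hi1.const_mul _),
    integral_const_mul, integral_const_mul] at hstep
  have h1 := mul_le_mul_of_nonneg_left hinner2 (by positivity : 0 ≤ 2 * η)
  have h2 := mul_le_mul_of_nonneg_left hsq2 (sq_nonneg η)
  change 2 * η * (∫ w, surrogate obj P₀ l n (x w t) ∂M - surrogate obj P₀ l n y) ≤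
    ∫ w, ‖x w t - y‖ ^ 2 ∂M - ∫ w, ‖x w (t + 1) - y‖ ^ 2 ∂M + η ^ 2 * V
  linarith

/-- The convergence guarantee of the projected stochastic gradient method. -/
theorem integral_risk_sgmAverage_le (h : obj.IsValid) (hG : 0 ≤ G) (hB : 0 ≤ B)
    (hj : 1 ≤ jmax) (hn₀ : 1 ≤ n₀) (hη : 0 < η) {R : ℝ}
    (hR : ∀ x ∈ X, ∀ y ∈ X, ‖x - y‖ ≤ R) (hx₀ : x₀ ∈ X) {T : ℕ} (hT : 1 ≤ T) :
    Integrable (fun w => obj.risk P₀ (l (sgmAverage X η (mlmcGrad obj l g jmax n₀) x₀ w T)))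
      (Measure.infinitePi fun _ : ℕ => drawLaw jmax P₀) ∧
    ∀ y ∈ X, ∫ w, obj.risk P₀ (l (sgmAverage X η (mlmcGrad obj l g jmax n₀) x₀ w T))
        ∂(Measure.infinitePi fun _ : ℕ => drawLaw jmax P₀) ≤
      obj.risk P₀ (l y) + R ^ 2 / (2 * η * T) +
        η / 2 * (2 * G ^ 2 + 4 * G ^ 2 * obj.spread B * jmax / n₀) +
        B * √(2 * obj.kappa B / ((2 ^ jmax * n₀ : ℕ) : ℝ)) := by
  have hLprob := isProbabilityMeasure_drawLaw P₀ hj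
  set L := drawLaw jmax P₀
  set M := Measure.infinitePi fun _ : ℕ => L
  set est := mlmcGrad obj l g jmax n₀
  set x : (ℕ → ℕ × (ℕ → S)) → ℕ → E := fun w t => sgm X η est x₀ w t
  set a : (ℕ → ℕ × (ℕ → S)) → E := fun w => sgmAverage X η est x₀ w T
  set n := 2 ^ jmax * n₀
  set V := 2 * G ^ 2 + 4 * G ^ 2 * obj.spread B * jmax / n₀
  set β := B * √(2 * obj.kappa B / (n : ℝ))
  have hn : 1 ≤ n := Nat.one_le_iff_ne_zero.2 (by positivity)
  have hT' : (0 : ℝ) < T := by positivity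
  have hβ : 0 ≤ β := by positivity
  have hxX : ∀ w t, x w t ∈ X := fun w t => sgm_mem hl.isClosed hl.convex hx₀ w t
  have haX : ∀ w, a w ∈ X := fun w => sgmAverage_mem hl.isClosed hl.convex hx₀ w hT
  have hxm : ∀ t, Measurable fun w => x w t := fun t =>
    hl.measurable_sgm h hx₀ (W := fun w => w) measurable_id t
  have ham : Measurable a := hl.measurable_sgmAverage h hx₀ T
  have hrm : Measurable fun w => obj.risk P₀ (l (a w)) := hl.measurable_risk_comp P₀ h ham haX
  have hri : Integrable (fun w => obj.risk P₀ (l (a w))) M := by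
    refine integrable_of_abs_le hrm (C := B + β) (ae_of_all _ fun w => ?_)
    have h1 := hl.surrogate_le_risk P₀ h hn (haX w)
    have h2 := hl.risk_le_surrogate_add P₀ h hn (haX w)
    have h3 := hl.surrogate_nonneg P₀ h hn (haX w)
    have h4 := hl.abs_surrogate_le P₀ h hn (haX w)
    rw [abs_of_nonneg h3] at h4
    rw [abs_of_nonneg (h3.trans h1)]
    linarith
  refine ⟨hri, fun y hy => ?_⟩
  have hsurr : ∀ t, Integrable (fun w => surrogate obj P₀ l n (x w t)) M := fun t =>
    integrable_of_abs_le (hl.measurable_surrogate_comp P₀ h n (hxm t) fun w => hxX w t)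
      (ae_of_all _ fun w => hl.abs_surrogate_le P₀ h hn (hxX w t))
  have hpt : ∀ w, obj.risk P₀ (l (a w)) ≤
      1 / (T : ℝ) * ∑ t ∈ Finset.Icc 1 T, surrogate obj P₀ l n (x w t) + β := fun w => by
    have h1 := hl.risk_le_surrogate_add P₀ h hn (haX w)
    have h2 := hl.surrogate_average_le P₀ h hn hT (a := fun t => x w t) (fun t => hxX w t) (haX w)
    exact h1.trans (add_le_add_left h2 _)
  have hsi : Integrable (fun w => 1 / (T : ℝ) *
      ∑ t ∈ Finset.Icc 1 T, surrogate obj P₀ l n (x w t)) M :=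
    (integrable_finsetSum _ fun t _ => hsurr t).const_mul _
  have h1 := integral_mono hri (hsi.add (integrable_const β)) hpt
  simp only [Pi.add_apply] at h1
  rw [integral_add hsi (integrable_const β), integral_const_mul,
    integral_finsetSum _ fun t _ => hsurr t] at h1
  simp only [integral_const, probReal_univ, one_smul] at h1
  set Δ : ℕ → ℝ := fun t => ∫ w, ‖x w t - y‖ ^ 2 ∂M
  have hregret : ∑ t ∈ Finset.Icc 1 T, (2 * η * (∫ w, surrogate obj P₀ l n (x w t) ∂M -
      surrogate obj P₀ l n y)) ≤ R ^ 2 + T * (η ^ 2 * V) := by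
    have h2 : ∀ t ∈ Finset.Icc 1 T, 2 * η * (∫ w, surrogate obj P₀ l n (x w t) ∂M -
        surrogate obj P₀ l n y) ≤ Δ t - Δ (t + 1) + η ^ 2 * V := fun t _ =>
      hl.integral_norm_sq_sgm_succ_sub_le P₀ h hG hB hj hn₀ hη.le hR hx₀ hy t
    refine (Finset.sum_le_sum h2).trans ?_
    have htel : ∀ k : ℕ, ∑ t ∈ Finset.Icc 1 k, (Δ t - Δ (t + 1)) = Δ 1 - Δ (k + 1) := fun k => by
      induction k with
      | zero => simp
      | succ k ih => rw [Finset.sum_Icc_succ_top (by omega), ih]; ring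
    rw [Finset.sum_add_distrib, htel, Finset.sum_const, Nat.card_Icc, nsmul_eq_mul,
      Nat.add_sub_cancel]
    have h3 : 0 ≤ Δ (T + 1) := integral_nonneg fun w => sq_nonneg _
    -- The average runs over the iterates `1, …, T`, so the telescoping starts at `Δ 1`, which the
    -- diameter bounds.
    have h4 : Δ 1 ≤ R ^ 2 := by
      refine (integral_mono_of_nonneg (ae_of_all _ fun w => sq_nonneg _) (integrable_const (R ^ 2))
        (ae_of_all _ fun w =>
          pow_le_pow_left₀ (norm_nonneg _) (hR _ (hxX w 1) y hy) 2)).trans_eq ?_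
      simp
    linarith
  rw [← Finset.mul_sum, Finset.sum_sub_distrib, Finset.sum_const, Nat.card_Icc, nsmul_eq_mul,
    Nat.add_sub_cancel] at hregret
  set tot := ∑ t ∈ Finset.Icc 1 T, ∫ w, surrogate obj P₀ l n (x w t) ∂M
  have h5 : 1 / (T : ℝ) * tot ≤ surrogate obj P₀ l n y + R ^ 2 / (2 * η * T) + η / 2 * V := by
    have e : surrogate obj P₀ l n y + R ^ 2 / (2 * η * T) + η / 2 * V =
        (T * surrogate obj P₀ l n y + (R ^ 2 + T * (η ^ 2 * V)) / (2 * η)) / T := by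
      field_simp
      ring
    rw [e, one_div, inv_mul_eq_div]
    refine div_le_div_of_nonneg_right ?_ hT'.le
    rw [← sub_le_iff_le_add', le_div_iff₀ (by positivity)]
    linarith
  have h6 := hl.surrogate_le_risk P₀ h hn hy
  linarith

end IsLossModel

/-! ### The cost: a Chernoff bound for the sum of the batch sizes. -/

theorem card_mlmcQueries (n₀ : ℕ) (j : ℕ) : (mlmcQueries n₀ j).card = 2 ^ j * n₀ := by
  have h1 : n₀ ≤ 2 ^ j * n₀ := Nat.le_mul_of_pos_left _ (by positivity)
  have : mlmcQueries n₀ j = Finset.range (2 ^ j * n₀) := by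
    ext i
    simp only [mlmcQueries, Finset.mem_union, Finset.mem_range, Finset.mem_Ico]
    omega
  rw [this, Finset.card_range]

theorem exp_le_one_add_add_sq {y : ℝ} (h0 : 0 ≤ y) (h1 : y ≤ 1) :
    Real.exp y ≤ 1 + y + y ^ 2 := by
  have := Real.abs_exp_sub_one_sub_id_le (x := y) (by rwa [abs_of_nonneg h0])
  have := (abs_le.1 this).2
  linarith

/-- The moment generating function of the size `2 ^ J` of the largest batch. -/
theorem mgf_two_pow_levelLaw_le {jmax : ℕ} (hj : 1 ≤ jmax) {θ : ℝ} (h0 : 0 ≤ θ)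
    (h1 : θ * 2 ^ jmax ≤ 1) :
    mgf (fun j : ℕ => (2 : ℝ) ^ j) (levelLaw jmax) θ ≤
      Real.exp (θ * (jmax + 1) + 3 * θ ^ 2 * 2 ^ jmax) := by
  rw [mgf, integral_levelLaw]
  have hle : ∀ j ∈ Finset.Icc 1 jmax, levelProb jmax j * Real.exp (θ * 2 ^ j) ≤
      levelProb jmax j + θ * (levelProb jmax j * 2 ^ j) +
        θ ^ 2 * (levelProb jmax j * (2 ^ j) ^ 2) := fun j hjm => by
    have hj2 : (2 : ℝ) ^ j ≤ 2 ^ jmax := pow_le_pow_right₀ one_le_two (Finset.mem_Icc.1 hjm).2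
    have h := exp_le_one_add_add_sq (y := θ * 2 ^ j) (by positivity)
      ((mul_le_mul_of_nonneg_left hj2 h0).trans h1)
    refine (mul_le_mul_of_nonneg_left h (levelProb_pos jmax j).le).trans_eq ?_
    ring
  refine (Finset.sum_le_sum hle).trans ?_
  rw [Finset.sum_add_distrib, Finset.sum_add_distrib, ← Finset.mul_sum, ← Finset.mul_sum,
    sum_levelProb hj, sum_levelProb_mul_two_pow hj]
  have h2 := mul_le_mul_of_nonneg_left (sum_levelProb_mul_four_pow_le hj) (sq_nonneg θ)
  have h3 := Real.add_one_le_exp (θ * (jmax + 1) + 3 * θ ^ 2 * 2 ^ jmax)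
  linarith

variable {S Ω : Type*} [MeasurableSpace S] [MeasurableSpace Ω] {P₀ : Measure S}
  [IsProbabilityMeasure P₀] {μ : Measure Ω} [IsProbabilityMeasure μ] {jmax : ℕ}
  {w : ℕ → Ω → ℕ × (ℕ → S)}

theorem hasLaw_level {t : ℕ} (hw : HasLaw (w t) (drawLaw jmax P₀) μ) (hj : 1 ≤ jmax) :
    HasLaw (fun ω => (w t ω).1) (levelLaw jmax) μ := by
  have := isProbabilityMeasure_levelLaw hj
  have h : HasLaw (Prod.fst : ℕ × (ℕ → S) → ℕ) (levelLaw jmax) (drawLaw jmax P₀) :=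
    measurePreserving_fst.hasLaw
  exact h.fun_comp hw

/-- A Chernoff bound for the sum of the batch sizes. -/
theorem measure_sum_two_pow_ge_le (hw : ∀ t, HasLaw (w t) (drawLaw jmax P₀) μ)
    (hind : iIndepFun w μ) (hj : 1 ≤ jmax) (T : ℕ) {θ : ℝ} (h0 : 0 ≤ θ)
    (h1 : θ * 2 ^ jmax ≤ 1) (s : ℝ) :
    μ.real {ω | T * (jmax + 1) + s ≤ ∑ t ∈ Finset.range T, (2 : ℝ) ^ (w t ω).1} ≤
      Real.exp (-(θ * s) + 3 * θ ^ 2 * (2 ^ jmax * T)) := by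
  set Y : ℕ → Ω → ℝ := fun t ω => (2 : ℝ) ^ (w t ω).1
  have hlaw : ∀ t, HasLaw (fun ω => (w t ω).1) (levelLaw jmax) μ := fun t =>
    hasLaw_level (hw t) hj
  have hf : Measurable fun d : ℕ × (ℕ → S) => (2 : ℝ) ^ d.1 :=
    (measurable_from_nat (f := fun j => (2 : ℝ) ^ j)).comp measurable_fst
  have hYm : ∀ t, AEMeasurable (Y t) μ := fun t => hf.comp_aemeasurable (hw t).aemeasurable
  have hYind : iIndepFun Y μ := hind.comp (fun _ d => (2 : ℝ) ^ d.1) fun _ => hf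
  have hmgf : ∀ t, mgf (Y t) μ θ ≤ Real.exp (θ * (jmax + 1) + 3 * θ ^ 2 * 2 ^ jmax) := fun t => by
    refine (mgf_two_pow_levelLaw_le hj h0 h1).trans_eq' ?_
    exact ((hlaw t).integral_comp (f := fun j => Real.exp (θ * 2 ^ j))
      measurable_from_nat.aestronglyMeasurable).symm
  have hint : Integrable (fun ω => Real.exp (θ * (∑ t ∈ Finset.range T, Y t) ω)) μ := by
    refine Integrable.of_bound
      (((Finset.aemeasurable_sum _ fun t _ => hYm t).const_mul θ).exp.aestronglyMeasurable)
      (Real.exp (θ * (T * 2 ^ jmax))) ?_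
    have hae : ∀ᵐ ω ∂μ, ∀ t, (w t ω).1 ∈ Finset.Icc 1 jmax := ae_all_iff.2 fun t =>
      ((hlaw t).ae_iff (p := fun j => j ∈ Finset.Icc 1 jmax) (by measurability)).2
        (ae_mem_Icc_levelLaw jmax)
    filter_upwards [hae] with ω hω
    rw [Real.norm_eq_abs, Real.abs_exp, Real.exp_le_exp, Finset.sum_apply]
    refine mul_le_mul_of_nonneg_left ?_ h0
    refine (Finset.sum_le_card_nsmul _ _ ((2 : ℝ) ^ jmax) fun t _ =>
      pow_le_pow_right₀ one_le_two (Finset.mem_Icc.1 (hω t)).2).trans_eq ?_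
    simp
  have hch := measure_ge_le_exp_mul_mgf (μ := μ) (X := ∑ t ∈ Finset.range T, Y t)
    (T * (jmax + 1) + s) h0 hint
  rw [hYind.mgf_sum₀ hYm] at hch
  have hprod : ∏ t ∈ Finset.range T, mgf (Y t) μ θ ≤
      Real.exp (T * (θ * (jmax + 1) + 3 * θ ^ 2 * 2 ^ jmax)) := by
    refine (Finset.prod_le_prod (fun t _ => mgf_nonneg) fun t _ => hmgf t).trans_eq ?_
    rw [Finset.prod_const, Finset.card_range, ← Real.exp_nat_mul]
  simp only [Finset.sum_apply] at hch
  refine hch.trans ((mul_le_mul_of_nonneg_left hprod (Real.exp_pos _).le).trans_eq ?_)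
  rw [← Real.exp_add]
  congr 1
  ring

/-- With probability at least `1 - 1 / n` the number of evaluations is at most `evalBound`. -/
theorem ofReal_one_sub_le_measure_evalCount_le (hw : ∀ t, HasLaw (w t) (drawLaw jmax P₀) μ)
    (hind : iIndepFun w μ) (hj : 1 ≤ jmax) {n₀ : ℕ} (hn₀ : 1 ≤ n₀) (T : ℕ) :
    ENNReal.ofReal (1 - 1 / ((2 ^ jmax * n₀ : ℕ) : ℝ)) ≤
      μ {ω | (evalCount n₀ T (fun t => w t ω) : ℝ) ≤
        evalBound ((2 ^ jmax * n₀ : ℕ) : ℝ) n₀ T} := by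
  set n := 2 ^ jmax * n₀
  have hn₀' : (0 : ℝ) < n₀ := by positivity
  have hnN : (n : ℝ) = 2 ^ jmax * n₀ := by simp [n]
  have hn2 : 2 ≤ n := by
    calc 2 = 2 ^ 1 * 1 := by norm_num
      _ ≤ 2 ^ jmax * n₀ := Nat.mul_le_mul (Nat.pow_le_pow_right (by norm_num) hj) hn₀
  have hn : (0 : ℝ) < n := by positivity
  set N : ℝ := 2 ^ jmax
  have hN : 0 < N := by positivity
  set L := Real.log n
  have hL : 0 < L := Real.log_pos (by exact_mod_cast hn2)
  -- In units of `n₀` the evaluation bound reads `T (jmax + 1) + 5 √Q`: the mean plus a deviation.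
  set Q := (N * L) ^ 2 + N * T * L
  have hQ1 : (N * L) ^ 2 ≤ Q := le_add_of_nonneg_right (by positivity)
  have hQ2 : N * T * L ≤ Q := le_add_of_nonneg_left (by positivity)
  have hQ : 0 < Q := lt_of_lt_of_le (by positivity) hQ1
  have hsq : N * L ≤ √Q := Real.le_sqrt_of_sq_le hQ1
  have hsQ : 0 < √Q := Real.sqrt_pos.2 hQ
  have hbound : evalBound n n₀ T = n₀ * (T * (jmax + 1) + 5 * √Q) := by
    have e1 : Real.logb 2 (2 * n / n₀) = jmax + 1 := by
      have : 2 * (n : ℝ) / n₀ = 2 ^ (jmax + 1) := by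
        rw [hnN, pow_succ]
        change 2 * (N * n₀) / n₀ = N * 2
        field_simp
      rw [this, Real.logb_pow, Real.logb_self_eq_one one_lt_two]
      push_cast
      ring
    have e2 : (n * L) ^ 2 + n₀ * n * T * L = n₀ ^ 2 * Q := by
      rw [hnN]; ring
    rw [evalBound, e1, e2, Real.sqrt_mul (sq_nonneg _), Real.sqrt_sq hn₀'.le]
    ring
  have hcount : ∀ ω, (evalCount n₀ T (fun t => w t ω) : ℝ) =
      n₀ * ∑ t ∈ Finset.range T, (2 : ℝ) ^ (w t ω).1 := fun ω => by
    simp only [evalCount, card_mlmcQueries, Finset.mul_sum]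
    push_cast
    exact Finset.sum_congr rfl fun t _ => mul_comm _ _
  set A := {ω | (evalCount n₀ T (fun t => w t ω) : ℝ) ≤ evalBound (n : ℝ) n₀ T}
  -- With this `θ` the linear term of the exponent is `-2 L`. The summand `N T L` of `Q` keeps the
  -- quadratic term below `L`, so `exp (-L) = 1 / n` remains; the summand `(N L) ^ 2` ensures `θ N ≤
  -- 1`, as the bound on the moment generating function requires.
  set θ := 2 * L / (5 * √Q)
  have hθ0 : 0 ≤ θ := by positivity
  have hθ1 : θ * N ≤ 1 := by
    rw [div_mul_eq_mul_div, div_le_one (by positivity)]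
    linarith
  have hθs : θ * (5 * √Q) = 2 * L := div_mul_cancel₀ _ (by positivity)
  have hθ2 : 3 * θ ^ 2 * (N * T) ≤ L := by
    have e : θ ^ 2 * Q = 4 / 25 * L ^ 2 := by
      simp only [θ, div_pow, mul_pow, Real.sq_sqrt hQ.le]
      field_simp
      norm_num
    have h := mul_le_mul_of_nonneg_left hQ2 (sq_nonneg θ)
    rw [e] at h
    have : θ ^ 2 * (N * T) ≤ 4 / 25 * L := by
      refine le_of_mul_le_mul_right ?_ hL
      linarith
    linarith
  have hAc : μ Aᶜ ≤ ENNReal.ofReal (1 / n) := by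
    have hsub : Aᶜ ⊆ {ω | T * (jmax + 1) + 5 * √Q ≤
        ∑ t ∈ Finset.range T, (2 : ℝ) ^ (w t ω).1} := fun ω hω => by
      have h : evalBound (n : ℝ) n₀ T < evalCount n₀ T (fun t => w t ω) := not_le.1 hω
      rw [hbound, hcount] at h
      exact (lt_of_mul_lt_mul_left h hn₀'.le).le
    refine (measure_mono hsub).trans ?_
    rw [← ofReal_measureReal]
    refine ENNReal.ofReal_le_ofReal
      ((measure_sum_two_pow_ge_le hw hind hj T hθ0 hθ1 (5 * √Q)).trans ?_)
    rw [hθs, one_div, ← Real.exp_log hn, ← Real.exp_neg, Real.exp_le_exp]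
    change -(2 * L) + 3 * θ ^ 2 * (N * T) ≤ -L
    linarith
  rw [ENNReal.ofReal_sub _ (by positivity), ENNReal.ofReal_one, tsub_le_iff_right]
  calc (1 : ENNReal) = μ Set.univ := measure_univ.symm
    _ = μ (A ∪ Aᶜ) := by rw [Set.union_compl_self]
    _ ≤ μ A + μ Aᶜ := measure_union_le _ _
    _ ≤ μ A + ENNReal.ofReal (1 / n) := by gcongr

/-! ### Numerical consequences of the choice of parameters. -/

section Parameters

variable {κ B ε n n₀ T D C₀ Cn CT : ℝ} {p : ℕ}

/-- The constant in the bound on `evalBound`. -/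
noncomputable def evalBoundConst (C₀ Cn CT : ℝ) (p : ℕ) : ℝ :=
  (9 * (CT + C₀) + 5 * Cn) * (2 * |Real.log Cn| + 1) ^ (p + 1)

theorem evalBoundConst_pos (hC₀ : 0 < C₀) (hCn : 0 < Cn) (hCT : 0 < CT) :
    0 < evalBoundConst C₀ Cn CT p := by
  unfold evalBoundConst
  positivity

theorem one_le_log_of_eight_le (hn : 8 ≤ n) : 1 ≤ Real.log n := by
  rw [Real.le_log_iff_exp_le (by linarith)]
  exact Real.exp_one_lt_d9.le.trans (by linarith)

theorem evalBound_le (hκ : 1 ≤ κ) (hB : 0 < B) (hε : 0 < ε) (hεB : ε < B) (hD : 0 ≤ D)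
    (hC₀ : 0 < C₀) (hCn : 0 < Cn) (hCT : 0 < CT) (hp : 1 ≤ p)
    (hn : 8 * (κ * B ^ 2 / ε ^ 2) ≤ n) (hn' : n ≤ Cn * (κ * B ^ 2 / ε ^ 2))
    (hn₀ : 1 ≤ n₀) (hn₀' : n₀ ≤ C₀ * (κ * Real.log n)) (hT : 0 ≤ T)
    (hT' : T ≤ CT * (κ * D ^ 2 / (n₀ * ε ^ 2) * Real.log n ^ p) + 1) :
    evalBound n n₀ T ≤ evalBoundConst C₀ Cn CT p *
      (κ * (D + B) ^ 2 / ε ^ 2 * Real.log (1 + κ * B ^ 2 / ε ^ 2) ^ (p + 1)) := by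
  set N := κ * B ^ 2 / ε ^ 2
  set L := Real.log n
  set W := κ * (D + B) ^ 2 / ε ^ 2
  set lN := Real.log (1 + N)
  set A := 2 * |Real.log Cn| + 1
  have hκ0 : 0 < κ := by linarith
  have hn₀0 : 0 < n₀ := by linarith
  have hN : 1 ≤ N := by
    rw [one_le_div (by positivity)]
    have : ε ^ 2 ≤ B ^ 2 := pow_le_pow_left₀ hε.le hεB.le 2
    nlinarith [sq_nonneg B]
  have hNW : N ≤ W := by
    have : B ^ 2 ≤ (D + B) ^ 2 := pow_le_pow_left₀ hB.le (by linarith) 2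
    simp only [N, W]
    gcongr
  have hDW : κ * D ^ 2 / ε ^ 2 ≤ W := by
    have : D ^ 2 ≤ (D + B) ^ 2 := pow_le_pow_left₀ hD (by linarith) 2
    simp only [W]
    gcongr
  have hκW : κ ≤ W := by
    have : ε ^ 2 ≤ (D + B) ^ 2 := pow_le_pow_left₀ hε.le (by linarith) 2
    rw [le_div_iff₀ (by positivity)]
    gcongr
  have hW : 0 < W := hκ0.trans_le hκW
  have hn8 : 8 ≤ n := by linarith
  have hL : 1 ≤ L := one_le_log_of_eight_le hn8
  have hlog2 : (1 : ℝ) / 2 ≤ Real.log 2 := by linarith [Real.log_two_gt_d9]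
  have hlN : 1 / 2 ≤ lN := hlog2.trans (Real.log_le_log (by norm_num) (by linarith))
  -- Because `lN ≥ 1 / 2`, the additive `|log Cn|` is absorbed into the factor `A`.
  have hLA : L ≤ A * lN := by
    have h1 : L ≤ Real.log (Cn * (1 + N)) :=
      Real.log_le_log (by linarith) (hn'.trans (mul_le_mul_of_nonneg_left (by linarith) hCn.le))
    rw [Real.log_mul hCn.ne' (by linarith)] at h1
    have h2 := le_abs_self (Real.log Cn)
    have h3 : |Real.log Cn| * (1 / 2) ≤ |Real.log Cn| * lN :=
      mul_le_mul_of_nonneg_left hlN (abs_nonneg _)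
    simp only [A]
    change L ≤ Real.log Cn + lN at h1
    linarith
  have hLp : 1 ≤ L ^ p := one_le_pow₀ hL
  have hLLp : L ≤ L ^ p := le_self_pow₀ hL (by omega)
  -- Rounding `T` up costs one step, that is `n₀` evaluations. The upper bound on `n₀`, together
  -- with `κ ≤ W`, which rests on `ε < B`, makes this harmless.
  have hm : n₀ * T ≤ (CT + C₀) * (W * L ^ p) := by
    have h1 : n₀ * T ≤ CT * (κ * D ^ 2 / ε ^ 2 * L ^ p) + n₀ := by
      refine (mul_le_mul_of_nonneg_left hT' hn₀0.le).trans_eq ?_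
      field_simp
    have h2 : κ * D ^ 2 / ε ^ 2 * L ^ p ≤ W * L ^ p :=
      mul_le_mul_of_nonneg_right hDW (by positivity)
    have h3 : κ * L ≤ W * L ^ p := mul_le_mul hκW hLLp (by linarith) hW.le
    have h4 := mul_le_mul_of_nonneg_left h2 hCT.le
    have h5 := mul_le_mul_of_nonneg_left h3 hC₀.le
    linarith
  have hm0 : 0 ≤ n₀ * T := by positivity
  have hlogb : Real.logb 2 (2 * n / n₀) ≤ 4 * L := by
    have h1 : Real.log (2 * n / n₀) ≤ 2 * L := by
      have h2 : Real.log (2 * n / n₀) ≤ Real.log (n ^ 2) := by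
        refine Real.log_le_log (by positivity) ((div_le_self (by linarith) hn₀).trans ?_)
        nlinarith
      rwa [Real.log_pow] at h2
    rw [Real.logb, div_le_iff₀ (by linarith)]
    nlinarith
  have hsqrt : √((n * L) ^ 2 + n₀ * n * T * L) ≤ n * L + n₀ * T := by
    refine Real.sqrt_le_iff.2 ⟨by positivity, ?_⟩
    have : 0 ≤ n * L * (n₀ * T) := by positivity
    nlinarith [sq_nonneg (n₀ * T)]
  have hA : 1 ≤ A := by simp only [A]; linarith [abs_nonneg (Real.log Cn)]
  have hpow : L ^ (p + 1) ≤ A ^ (p + 1) * lN ^ (p + 1) := by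
    rw [← mul_pow]
    exact pow_le_pow_left₀ (by linarith) hLA _
  have hmL : n₀ * T * L ≤ (CT + C₀) * (W * L ^ (p + 1)) := by
    refine (mul_le_mul_of_nonneg_right hm (by linarith)).trans_eq ?_
    ring
  have hnL : n * L ≤ Cn * (W * L ^ (p + 1)) := by
    have h1 : n ≤ Cn * W := hn'.trans (mul_le_mul_of_nonneg_left hNW hCn.le)
    have h2 : L ≤ L ^ (p + 1) := le_self_pow₀ hL (by omega)
    refine (mul_le_mul h1 h2 (by linarith) (by positivity)).trans_eq ?_
    ring
  have hmm : n₀ * T ≤ n₀ * T * L := le_mul_of_one_le_right hm0 hL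
  calc evalBound n n₀ T ≤ n₀ * T * (4 * L) + 5 * (n * L + n₀ * T) := by
        have h1 := mul_le_mul_of_nonneg_left hlogb hm0
        rw [evalBound]
        linarith
    _ ≤ (9 * (CT + C₀) + 5 * Cn) * (W * L ^ (p + 1)) := by linarith
    _ ≤ (9 * (CT + C₀) + 5 * Cn) * (W * (A ^ (p + 1) * lN ^ (p + 1))) := by gcongr
    _ = evalBoundConst C₀ Cn CT p * (W * lN ^ (p + 1)) := by
        rw [evalBoundConst]; ring

/-- This fixes the universal constant `8`: squaring shows that it is what makes the bias at most `ε
/ 2`. -/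
theorem bias_term_le (hκ : 1 ≤ κ) (hB : 0 < B) (hε : 0 < ε)
    (hn : 8 * (κ * B ^ 2 / ε ^ 2) ≤ n) : B * √(2 * κ / n) ≤ ε / 2 := by
  have hκ0 : 0 < κ := by linarith
  have hn0 : 0 < n := lt_of_lt_of_le (by positivity) hn
  have h : √(2 * κ / n) ≤ ε / (2 * B) := by
    refine Real.sqrt_le_iff.2 ⟨by positivity, ?_⟩
    rw [← mul_div_assoc, div_le_iff₀ (by positivity)] at hn
    rw [div_pow, div_le_div_iff₀ hn0 (by positivity)]
    linarith
  calc B * √(2 * κ / n) ≤ B * (ε / (2 * B)) := mul_le_mul_of_nonneg_left h hB.le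
    _ = ε / 2 := by field_simp

/-- The constant in the lower bound on the number of steps. -/
noncomputable def stepConst (cη Cη C₀ : ℝ) : ℝ := 4 * (C₀ + 1) * (1 / (2 * cη) + 3 * Cη) ^ 2

theorem stepConst_pos {cη Cη : ℝ} (hcη : 0 < cη) (hCη : 0 < Cη) (hC₀ : 0 < C₀) :
    0 < stepConst cη Cη C₀ := by
  unfold stepConst
  positivity

/-- The optimisation error for a step size of the order of `R / √(Γ T)`, where `V` is the bound
on the second moment of the gradient estimator. -/
theorem optimization_error_le {cη Cη R G Γ V η : ℝ} (hcη : 0 < cη) (hCη : 0 < Cη) (hC₀ : 0 < C₀)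
    (hR : 0 < R) (hG : 0 < G) (hε : 0 < ε) (hκ : 1 ≤ κ) (hp : 1 ≤ p) (hn₀ : 0 < n₀) (hT : 0 < T)
    (hL : 1 ≤ Real.log n) (hΓ : 0 < Γ) (hV : V ≤ 6 * Γ)
    (hΓ' : n₀ * Γ ≤ G ^ 2 * ((C₀ + 1) * (κ * Real.log n)))
    (hT' : stepConst cη Cη C₀ * (κ * (G * R) ^ 2 / (n₀ * ε ^ 2) * Real.log n ^ p) ≤ T)
    (hη : cη * (R / (√T * √Γ)) ≤ η) (hη' : η ≤ Cη * (R / (√T * √Γ))) :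
    R ^ 2 / (2 * η * T) + η / 2 * V ≤ ε / 2 := by
  set L := Real.log n
  -- In units of `R √Γ / √T`, the distance term contributes `1 / (2 * cη)`, through the lower bound
  -- on `η`, and the noise term `3 * Cη`, through the upper bound and `V ≤ 6 * Γ`. Here `Γ` is
  -- already the squared scale.
  set K := 1 / (2 * cη) + 3 * Cη
  have hK : 0 < K := by positivity
  have hκ0 : 0 < κ := by linarith
  have hsT : 0 < √T := Real.sqrt_pos.2 hT
  have hsΓ : 0 < √Γ := Real.sqrt_pos.2 hΓ
  have hη0 : 0 < η := lt_of_lt_of_le (by positivity) hη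
  have h1 : R ^ 2 / (2 * η * T) ≤ 1 / (2 * cη) * (R * √Γ / √T) := by
    calc R ^ 2 / (2 * η * T) ≤ R ^ 2 / (2 * (cη * (R / (√T * √Γ))) * T) := by gcongr
      _ = 1 / (2 * cη) * (R * √Γ / √T) := by
        have : T = √T * √T := (Real.mul_self_sqrt hT.le).symm
        rw [this, Real.sqrt_mul_self hsT.le]
        field_simp
  have h2 : η / 2 * V ≤ 3 * Cη * (R * √Γ / √T) := by
    calc η / 2 * V ≤ η / 2 * (6 * Γ) := mul_le_mul_of_nonneg_left hV (by positivity)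
      _ ≤ Cη * (R / (√T * √Γ)) / 2 * (6 * Γ) := by gcongr
      _ = 3 * Cη * (R * √Γ / √T) := by
        have : Γ = √Γ * √Γ := (Real.mul_self_sqrt hΓ.le).symm
        rw [this, Real.sqrt_mul_self hsΓ.le]
        field_simp
        norm_num
  have h3 : 4 * K ^ 2 * (R ^ 2 * Γ) ≤ ε ^ 2 * T := by
    have h4 : R ^ 2 * Γ ≤ (C₀ + 1) * (κ * (G * R) ^ 2 / n₀ * L ^ p) := by
      have h5 : L ≤ L ^ p := le_self_pow₀ hL (by omega)
      have h6 : Γ ≤ G ^ 2 * ((C₀ + 1) * (κ * L ^ p)) / n₀ := by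
        rw [le_div_iff₀ hn₀, mul_comm Γ]
        refine hΓ'.trans ?_
        gcongr
      refine (mul_le_mul_of_nonneg_left h6 (sq_nonneg R)).trans_eq ?_
      ring
    calc 4 * K ^ 2 * (R ^ 2 * Γ)
        ≤ 4 * K ^ 2 * ((C₀ + 1) * (κ * (G * R) ^ 2 / n₀ * L ^ p)) := by gcongr
      _ = ε ^ 2 * (stepConst cη Cη C₀ * (κ * (G * R) ^ 2 / (n₀ * ε ^ 2) * L ^ p)) := by
        rw [stepConst]
        change _ = ε ^ 2 * (4 * (C₀ + 1) * K ^ 2 * _)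
        field_simp
      _ ≤ ε ^ 2 * T := by gcongr
  have h7 : K * (R * √Γ / √T) ≤ ε / 2 := by
    rw [← mul_div_assoc, div_le_iff₀ hsT]
    refine le_of_sq_le_sq ?_ (by positivity)
    rw [mul_pow, mul_pow, mul_pow, Real.sq_sqrt hΓ.le, Real.sq_sqrt hT.le]
    linarith
  have : K * (R * √Γ / √T) = 1 / (2 * cη) * (R * √Γ / √T) + 3 * Cη * (R * √Γ / √T) := add_mul _ _ _
  linarith

end Parameters

/-! ### The second moment bound in terms of the scale of the step size. -/

theorem log_div_eq_of_eq_two_pow_mul {jmax n₀ : ℕ} (hn₀ : 1 ≤ n₀) :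
    Real.log (((2 ^ jmax * n₀ : ℕ) : ℝ) / n₀) = jmax * Real.log 2 := by
  have hn₀' : (n₀ : ℝ) ≠ 0 := by positivity
  have : ((2 ^ jmax * n₀ : ℕ) : ℝ) / n₀ = 2 ^ jmax := by
    push_cast
    field_simp
  rw [this, Real.log_pow]

/-- The number of levels is `log (n / n₀) / log 2`, and the factor `6` works since `4 ≤ 6 * log 2`.
-/
theorem Objective.second_moment_bound_le {obj : Objective} (h : obj.IsValid) {B G : ℝ}
    (hB : 0 ≤ B) {jmax n₀ : ℕ} (hn₀ : 1 ≤ n₀) :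
    2 * G ^ 2 + 4 * G ^ 2 * obj.spread B * jmax / n₀ ≤
      6 * obj.secondMomentScale G B ((2 ^ jmax * n₀ : ℕ) : ℝ) n₀ := by
  have hs := Objective.spread_nonneg h hB
  have hn₀' : (0 : ℝ) < n₀ := by positivity
  rw [Objective.secondMomentScale_eq, log_div_eq_of_eq_two_pow_mul hn₀]
  have hlog : 4 ≤ 6 * Real.log 2 := by linarith [Real.log_two_gt_d9]
  set c := G ^ 2 * (obj.spread B * jmax / n₀)
  have hc : 0 ≤ c := by positivity
  have e1 : 4 * G ^ 2 * obj.spread B * jmax / n₀ = 4 * c := by ring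
  have e2 : 6 * (G ^ 2 * (1 + obj.spread B * (jmax * Real.log 2) / n₀)) =
      6 * G ^ 2 + 6 * Real.log 2 * c := by ring
  rw [e1, e2]
  have := mul_le_mul_of_nonneg_right hlog hc
  linarith [sq_nonneg G]

/-- Multiplied by `n₀`, the scale is `G²` times `n₀` plus a logarithmic term of size at most `κ log
n`. The upper bound on `n₀` absorbs the first summand, whence `C₀ + 1`. -/
theorem Objective.mul_secondMomentScale_le {obj : Objective} (h : obj.IsValid) {B G C₀ : ℝ}
    {n n₀ : ℝ} (hn₀ : 1 ≤ n₀) (hn : n₀ ≤ n)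
    (hκ : 0 ≤ obj.kappa B)
    (hn₀' : n₀ ≤ C₀ * (obj.kappa B * Real.log n)) :
    n₀ * obj.secondMomentScale G B n n₀ ≤
      G ^ 2 * ((C₀ + 1) * (obj.kappa B * Real.log n)) := by
  rw [Objective.secondMomentScale_eq]
  have hlog0 : 0 ≤ Real.log (n / n₀) := Real.log_nonneg ((one_le_div (by linarith)).2 hn)
  have hlog : Real.log (n / n₀) ≤ Real.log n :=
    Real.log_le_log (div_pos (by linarith) (by linarith)) (div_le_self (by linarith) hn₀)
  have h1 : obj.spread B * Real.log (n / n₀) ≤ obj.kappa B * Real.log (n / n₀) :=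
    mul_le_mul_of_nonneg_right (Objective.spread_le_kappa h) hlog0
  have h2 : obj.kappa B * Real.log (n / n₀) ≤ obj.kappa B * Real.log n :=
    mul_le_mul_of_nonneg_left hlog hκ
  have e : n₀ * (G ^ 2 * (1 + obj.spread B * Real.log (n / n₀) / n₀)) =
      G ^ 2 * (n₀ + obj.spread B * Real.log (n / n₀)) := by
    have : n₀ ≠ 0 := by linarith
    field_simp
  rw [e]
  exact mul_le_mul_of_nonneg_left (by linarith) (sq_nonneg G)

end DRO

/-! ### Assembly of the guarantees. -/

theorem theorem2 :
    ∃ cn : ℝ, 0 < cn ∧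
    ∀ cη Cη C₀ : ℝ, 0 < cη → 0 < Cη → 0 < C₀ →
    ∃ cT : ℝ, 0 < cT ∧
    ∀ (p : ℕ) (Cn CT : ℝ), 1 ≤ p → 0 < Cn → 0 < CT →
    ∃ C : ℝ, 0 < C ∧
    -- the problem instance
    ∀ (obj : DRO.Objective) (d : ℕ) (S : Type*) [MeasurableSpace S]
      (P₀ : MeasureTheory.Measure S) [MeasureTheory.IsProbabilityMeasure P₀]
      (X : Set (EuclideanSpace ℝ (Fin d))) (R G B ε : ℝ)
      (l : EuclideanSpace ℝ (Fin d) → S → ℝ)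
      (g : EuclideanSpace ℝ (Fin d) → S → EuclideanSpace ℝ (Fin d)),
      obj.IsValid →
      IsClosed X → Convex ℝ X → (∀ x ∈ X, ∀ y ∈ X, ‖x - y‖ ≤ R) →
      0 < R → 0 < G → 0 < ε → ε < B →
      (∀ x ∈ X, ∀ s, 0 ≤ l x s ∧ l x s ≤ B) →
      (∀ s, ConvexOn ℝ X fun x => l x s) →
      (∀ s, ∀ x ∈ X, ∀ y ∈ X, |l x s - l y s| ≤ G * ‖x - y‖) →
      (∀ x ∈ X, Measurable (l x)) →
      -- `g` is a measurable choice of subgradients of norm at most `G`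
      (∀ s, ∀ x ∈ X, ‖g x s‖ ≤ G ∧ ∀ y ∈ X, l x s + inner ℝ (g x s) (y - x) ≤ l y s) →
      Measurable (Function.uncurry g) →
    -- the parameters of the method
    ∀ (jmax n₀ n T : ℕ) (η : ℝ) (x₀ : EuclideanSpace ℝ (Fin d)),
      1 ≤ jmax → n = 2 ^ jmax * n₀ →
      cn * (obj.kappa B * B ^ 2 / ε ^ 2) ≤ n → n ≤ Cn * (obj.kappa B * B ^ 2 / ε ^ 2) →
      1 ≤ n₀ → n₀ ≤ C₀ * (obj.kappa B * Real.log n) →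
      1 ≤ T →
      cT * (obj.kappa B * (G * R) ^ 2 / (n₀ * ε ^ 2) * Real.log n ^ p) ≤ T →
      T ≤ CT * (obj.kappa B * (G * R) ^ 2 / (n₀ * ε ^ 2) * Real.log n ^ p) + 1 →
      cη * (R / (√T * √(obj.secondMomentScale G B n n₀))) ≤ η →
      η ≤ Cη * (R / (√T * √(obj.secondMomentScale G B n n₀))) →
      x₀ ∈ X →
    -- the random draws, independent from step to step
    ∀ (Ω : Type*) [MeasurableSpace Ω] (μ : MeasureTheory.Measure Ω)
      [MeasureTheory.IsProbabilityMeasure μ] (w : ℕ → Ω → ℕ × (ℕ → S)),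
      (∀ t, ProbabilityTheory.HasLaw (w t) (DRO.drawLaw jmax P₀) μ) →
      ProbabilityTheory.iIndepFun w μ →
    -- the average of the iterates is `ε`-suboptimal in expectation
    (MeasureTheory.Integrable (fun ω => obj.risk P₀
        (l (DRO.sgmAverage X η (DRO.mlmcGrad obj l g jmax n₀) x₀ (fun t => w t ω) T))) μ ∧
      ∫ ω, obj.risk P₀
          (l (DRO.sgmAverage X η (DRO.mlmcGrad obj l g jmax n₀) x₀ (fun t => w t ω) T)) ∂μ -
        sInf ((fun x => obj.risk P₀ (l x)) '' X) ≤ ε) ∧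
    -- the number of evaluations of `∇ℓ` is small with high probability
    ENNReal.ofReal (1 - 1 / n) ≤
      μ {ω | (DRO.evalCount n₀ T (fun t => w t ω) : ℝ) ≤ DRO.evalBound n n₀ T} ∧
    DRO.evalBound n n₀ T ≤ C * (obj.kappa B * (G * R + B) ^ 2 / ε ^ 2 *
      Real.log (1 + obj.kappa B * B ^ 2 / ε ^ 2) ^ (p + 1)) := by
  refine ⟨8, by norm_num, fun cη Cη C₀ hcη hCη hC₀ => ⟨DRO.stepConst cη Cη C₀,
    DRO.stepConst_pos hcη hCη hC₀, fun p Cn CT hp hCn hCT => ⟨DRO.evalBoundConst C₀ Cn CT p,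
    DRO.evalBoundConst_pos hC₀ hCn hCT, ?_⟩⟩⟩
  intro obj d S _ P₀ _ X R G B ε l g hobj hXc hXconv hXR hR hG hε hεB hlB hlconv hlLip hlm hg hgm
    jmax n₀ n T η x₀ hj hn hn1 hn2 hn₀ hn₀' hT hT1 hT2 hη1 hη2 hx₀ Ω _ μ _ w hw hind
  subst hn
  have hB : 0 < B := hε.trans hεB
  have hκ := DRO.Objective.one_le_kappa hobj hB.le
  have hl : DRO.IsLossModel X G B l g :=
    { isClosed := hXc
      convex := hXconv
      nonneg := fun x hx s => (hlB x hx s).1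
      le := fun x hx s => (hlB x hx s).2
      lipschitz := hlLip
      measurable_loss := hlm
      norm_le := fun s x hx => (hg s x hx).1
      subgradient := fun s x hx y hy => (hg s x hx).2 y hy
      measurable_grad := hgm }
  -- From `ε < B` and `κ ≥ 1` it follows that `n ≥ 8`, hence `log n ≥ 1`, so higher powers of the
  -- logarithm dominate lower ones.
  have hN : 1 ≤ obj.kappa B * B ^ 2 / ε ^ 2 := by
    rw [one_le_div (by positivity)]
    have : ε ^ 2 ≤ B ^ 2 := pow_le_pow_left₀ hε.le hεB.le 2
    nlinarith [sq_nonneg B]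
  have hL : 1 ≤ Real.log ((2 ^ jmax * n₀ : ℕ) : ℝ) :=
    DRO.one_le_log_of_eight_le (by linarith)
  have hn₀r : (1 : ℝ) ≤ n₀ := by exact_mod_cast hn₀
  have hTr : (1 : ℝ) ≤ T := by exact_mod_cast hT
  refine ⟨?_, DRO.ofReal_one_sub_le_measure_evalCount_le hw hind hj hn₀ T,
    DRO.evalBound_le hκ hB hε hεB (by positivity) hC₀ hCn hCT hp hn1 hn2 hn₀r hn₀' (by linarith)
      hT2⟩
  have hΓ : 0 < obj.secondMomentScale G B ((2 ^ jmax * n₀ : ℕ) : ℝ) n₀ := by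
    have h := DRO.Objective.second_moment_bound_le (G := G) hobj hB.le (jmax := jmax) hn₀
    have h2 : 0 ≤ 4 * G ^ 2 * obj.spread B * jmax / n₀ := by
      have := DRO.Objective.spread_nonneg hobj hB.le
      positivity
    have h3 : 0 < G ^ 2 := by positivity
    linarith
  have hη : 0 < η := by
    have : 0 < √(T : ℝ) := Real.sqrt_pos.2 (by linarith)
    have := Real.sqrt_pos.2 hΓ
    exact lt_of_lt_of_le (by positivity) hη1
  obtain ⟨hint, hbound⟩ := hl.integral_risk_sgmAverage_le P₀ hobj hG.le hB.le hj hn₀ hη hXR hx₀ hT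
  -- Independence identifies the joint law of the draws with the infinite product, where the
  -- convergence bound was proved.
  have hlaw := hind.hasLaw_infinitePi hw (aemeasurable_pi_iff.2 fun t => (hw t).aemeasurable)
  have hopt := DRO.optimization_error_le hcη hCη hC₀ hR hG hε hκ hp (by linarith) (by linarith) hL
    hΓ (DRO.Objective.second_moment_bound_le hobj hB.le hn₀)
    (DRO.Objective.mul_secondMomentScale_le hobj hn₀r
      (by exact_mod_cast Nat.le_mul_of_pos_left n₀ (by positivity)) (by linarith) hn₀') hT1 hη1 hη2
  have hbias := DRO.bias_term_le hκ hB hε hn1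
  rw [← hlaw.map_eq] at hint hbound
  refine ⟨(integrable_map_measure hint.aestronglyMeasurable hlaw.aemeasurable).1 hint, ?_⟩
  -- The bound holds against every comparison point `y` in `X`, so no minimizer has to exist.
  rw [sub_le_comm]
  refine le_csInf ⟨_, x₀, hx₀, rfl⟩ ?_
  rintro _ ⟨y, hy, rfl⟩
  have h := hbound y hy
  rw [integral_map hlaw.aemeasurable hint.aestronglyMeasurable] at h
  linarith
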